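/- **Setting.** Let $f:\mathbb R\to\mathbb R$ be infinitely differentiable and let $C_f\in\mathbb Z_{\ge 0}$, $\widetilde C_f>0$ be constants such that for all $n\ge 1$, all $\theta\in\mathbb R$ and all $\tau\ge 2\sqrt2\,(1\vee|\theta|)$ $$\int_{\mathbb R}\Big(\sum_{j=1}^{n}\frac{|f^{(j)}((\theta+\sqrt2x)/\tau)|}{\widetilde C_f^{\,j}\,j!}\Big)^{n}\frac{e^{-x^2/2}}{\sqrt{2\pi}}\,dx\le (C_f n)! .$$ Put $\overline C_f=32\pi^2(2e)^{4(1+C_f)}e^{4(1+C_f)^2}$ and $$L_f(n)=\sup_{|x|\le1}\sum_{j=1}^n\frac{|f^{(j)}(x)|}{\widetilde C_f^{\,j}j!},\qquad \widetilde L_f(n,\tau)=\sup_{|x|\ge1}\sum_{j=1}^n\frac{|f^{(j)}(x)|}{\widetilde C_f^{\,j}j!}\exp\Big(-\frac{\tau^2x^2}{8n}\Big).$$ Let $\Theta\subseteq\mathbb R$, $\tau>0$, $N\in\mathbb N$. Let $u(\cdot;\theta)$ be the density of $\mathcal N(\theta,1)$ (source model $\mathcal U$, $\theta\in\Theta$)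 and $v(\cdot;\theta)$ that of $\mathcal N(f(\theta/\tau),1)$ (target model $\mathcal V$, $\theta\in\Theta$; $v(\cdot;\theta)$ is defined for all $\theta\in\mathbb R$). Define $$\mathcal S_N^\star(y\mid x)=\sum_{k=0}^N\frac{(-1)^k}{(2k)!!}\,\nabla^{(2k)}_\theta v(y;\theta)\big|_{\theta=x},\qquad \mathcal T_N^\star(y\mid x)=\frac{\mathcal S_N^\star(y\mid x)\vee0}{\int_{\mathbb R}[\mathcal S_N^\star(y'\mid x)\vee0]\,dy'},$$ and $\delta(\mathcal U,\mathcal V;\mathcal T)=\sup_{\theta\in\Theta}\frac12\big\|\int\mathcal T(\cdot\mid x)u(x;\theta)\,dx-v(\cdot;\theta)\big\|_1$. Running times refer to randomized algebraic computation trees over the reals (real constants, arithmetic, the exponential, evaluation of $f$, branching on a sign, and drawing a sample from $\mathrm{Unif}([0,1])$ or $\mathcal N(0,1)$ all take unit time; any further measurable primitive operations, each with its own cost, may be available). $T_{\mathsf{eval}}(N)$, assumed finite, is the least worst-case time, over all inputs $x,y\in\mathbb R$, in which $\mathcal S_N^\star(y\mid x)$ can be evaluated. **Theorem.** There are universal constants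 $C,C'>0$ such that the following holds whenever $$2N+1\ge\overline C_f\quad\text{and}\quad \tau^2\ge C\Big[(\widetilde C_f\vee1)^4\big(L_f(2N)\vee\widetilde L_f(2N,\tau)\vee1\big)^2N^2\ \vee\ \sup_{\theta\in\Theta}\theta^2\Big].\qquad(\ast)$$ (a) $$\delta(\mathcal U,\mathcal V;\mathcal T_N^\star)\le\overline C_f\exp\Big(-\frac{(2N+1)^{\frac1{2(1+C_f)}}}{2e}\Big)+12e^{-\tau/8}+15\sup_{\theta\in\Theta}\exp\Big(\frac{\theta^2}2-\frac{\tau^2}8\Big).$$ (b) For each $\epsilon\in(0,1)$, if in addition $$2N+1\ge\big(2e\log(4\overline C_f/\epsilon)\big)^{2(1+C_f)}\quad\text{and}\quad\tau^2\ge 64\log^2(96/\epsilon)\ \vee\ \Big[8\log(120/\epsilon)+4\sup_{\theta\in\Theta}\theta^2\Big],$$ then there is a randomized algorithm $\mathsf K:\mathbb R\to\mathbb R$ with worst-case running time at most $C'\log(4/\epsilon)\,T_{\mathsf{eval}}(N)$ such that, for $X_\theta\sim\mathcal N(\theta,1)$ and $Y_\theta\sim\mathcal N(f(\theta/\tau),1)$,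 $$\sup_{\theta\in\Theta}\mathsf d_{\mathsf{TV}}\big(\mathsf K(X_\theta),Y_\theta\big)\le\epsilon .$$ -/

import Mathlib

open MeasureTheory ProbabilityTheory
open scoped ENNReal Nat ContDiff

noncomputable section

namespace GaussianReduction

/-! ### Models, signed kernel, Markov kernel, deficiency -/

/-- The source density `u(x; θ)`, that of `N(θ, 1)`. -/
def sourceDensity (x θ : ℝ) : ℝ := gaussianPDFReal θ 1 x

/-- The target density `v(y; θ)`, that of `N(f(θ/τ), 1)`, for every real `θ`. -/
def targetDensity (f : ℝ → ℝ) (τ : ℝ) (y θ : ℝ) : ℝ := gaussianPDFReal (f (θ / τ)) 1 y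

/-- The truncated signed kernel (for source variance one)
`S_N(y | x) = ∑_{k=0}^{N} (-1)^k / (2k)!! · ∂_θ^{2k} v(y; θ) |_{θ = x}`. -/
def signedKernel (v : ℝ → ℝ → ℝ) (N : ℕ) (y x : ℝ) : ℝ :=
  ∑ k ∈ Finset.range (N + 1),
    (-1 : ℝ) ^ k / ((2 * k)‼ : ℝ) * iteratedDeriv (2 * k) (fun t => v y t) x

/-- The Markov kernel `T_N(y | x)`: the positive part of `S_N(· | x)`, normalized. -/
def markovKernel (v : ℝ → ℝ → ℝ) (N : ℕ) (y x : ℝ) : ℝ :=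
  max (signedKernel v N y x) 0 / ∫ y', max (signedKernel v N y' x) 0

/-- The TV-deficiency
`δ(U, V; T) = sup_{θ ∈ Θ} (1/2) ‖∫ T(· | x) u(x; θ) dx - v(·; θ)‖₁`. -/
def deficiency (Θ : Set ℝ) (u v T : ℝ → ℝ → ℝ) : ℝ≥0∞ :=
  ⨆ θ ∈ Θ, (1 / 2) * ∫⁻ y, ‖(∫ x, T y x * u x θ) - v y θ‖ₑ

/-- Total variation distance `sup_A |μ(A) - ν(A)|` of two probability measures on `ℝ`. -/
def tvDist (μ ν : Measure ℝ) : ℝ≥0∞ :=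
  ⨆ (A : Set ℝ) (_ : MeasurableSet A), ENNReal.ofReal |μ.real A - ν.real A|

/-! ### The link function -/

/-- `∑_{j=1}^{n} |f^{(j)}(x)| / (c^j j!)`. -/
def derivSum (f : ℝ → ℝ) (c : ℝ) (n : ℕ) (x : ℝ) : ℝ :=
  ∑ j ∈ Finset.Icc 1 n, |iteratedDeriv j f x| / (c ^ j * (j ! : ℝ))

/-- `f` is analytic with respect to the Gaussian measure, with constants `(Cf, Ct)`. -/
structure IsGaussianAnalytic (f : ℝ → ℝ) (Cf : ℕ) (Ct : ℝ) : Prop where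
  smooth : ContDiff ℝ ∞ f
  pos : 0 < Ct
  bound : ∀ n : ℕ, 1 ≤ n → ∀ θ τ : ℝ, 2 * √2 * max 1 |θ| ≤ τ →
    ∫⁻ x : ℝ, ENNReal.ofReal
      (derivSum f Ct n ((θ + √2 * x) / τ) ^ n *
        (Real.exp (-x ^ 2 / 2) / √(2 * Real.pi))) ≤ ((Cf * n)! : ℝ≥0∞)

/-- `C̄_f = 32 π² (2e)^{4(1+C_f)} e^{4(1+C_f)²}`. -/
def barC (Cf : ℕ) : ℝ :=
  32 * Real.pi ^ 2 * (2 * Real.exp 1) ^ (4 * (1 + Cf)) * Real.exp (4 * (1 + (Cf : ℝ)) ^ 2)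

/-- `L_f(n)`, the supremum of `derivSum` over `|x| ≤ 1`. -/
def linkL (f : ℝ → ℝ) (Ct : ℝ) (n : ℕ) : ℝ≥0∞ :=
  ⨆ (x : ℝ) (_ : |x| ≤ 1), ENNReal.ofReal (derivSum f Ct n x)

/-- `L̃_f(n, τ)`, a weighted supremum of `derivSum` over `|x| ≥ 1`; it may be infinite. -/
def linkLTilde (f : ℝ → ℝ) (Ct : ℝ) (n : ℕ) (τ : ℝ) : ℝ≥0∞ :=
  ⨆ (x : ℝ) (_ : 1 ≤ |x|),
    ENNReal.ofReal (derivSum f Ct n x * Real.exp (-(τ ^ 2 * x ^ 2 / (8 * n))))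

/-- `sup_{θ ∈ Θ} θ²`; infinite when `Θ` is unbounded. -/
def supSq (Θ : Set ℝ) : ℝ≥0∞ := ⨆ θ ∈ Θ, ENNReal.ofReal (θ ^ 2)

/-! ### Randomized computation over the reals with a cost measure

Algorithms are randomized algebraic computation trees: a real random access machine that halts
within a fixed number of steps on every input, unrolled. A configuration is the vector of all
values computed so far, the most recent one at index `0`. -/

/-- Additional primitive operations that a machine may have (for instance derivatives of the link
function or special functions), each with a cost of its own. -/
structure Primitives where
  Idx : Type
  arity : Idx → ℕ
  fn : (a : Idx) → (Fin (arity a) → ℝ) → ℝ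
  measurable_fn : ∀ a, Measurable (fn a)
  cost : Idx → ℕ

/-- An instruction appends one real number to the `n` numbers present: a real constant, an
arithmetic operation, the exponential, the link function, an additional primitive, or a fresh
independent sample from `Unif([0,1])` or from `N(0,1)`. -/
inductive Instr (P : Primitives) (n : ℕ) : Type
  | const (c : ℝ)
  | add (i j : Fin n)
  | sub (i j : Fin n)
  | mul (i j : Fin n)
  | div (i j : Fin n)
  | exp (i : Fin n)
  | link (i : Fin n)
  | prim (a : P.Idx) (args : Fin (P.arity a) → Fin n)
  | unif
  | gauss

/-- The law of the number that an instruction produces; a point mass unless it is a sample. -/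
def Instr.law {P : Primitives} {n : ℕ} (f : ℝ → ℝ) (s : Fin n → ℝ) : Instr P n → Measure ℝ
  | .const c => Measure.dirac c
  | .add i j => Measure.dirac (s i + s j)
  | .sub i j => Measure.dirac (s i - s j)
  | .mul i j => Measure.dirac (s i * s j)
  | .div i j => Measure.dirac (s i / s j)
  | .exp i => Measure.dirac (Real.exp (s i))
  | .link i => Measure.dirac (f (s i))
  | .prim a args => Measure.dirac (P.fn a (fun l => s (args l)))
  | .unif => volume.restrict (Set.Icc 0 1)
  | .gauss => gaussianReal 0 1

/-- Every instruction takes unit time, except that an additional primitive has its own cost. -/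
def Instr.cost {P : Primitives} {n : ℕ} : Instr P n → ℕ
  | .prim a _ => P.cost a
  | _ => 1

/-- Programs with `n` numbers present: halt with one of them as the output, execute an
instruction and go on with `n + 1` numbers, or branch on the sign of one of them. -/
inductive Program (P : Primitives) : ℕ → Type
  | halt {n : ℕ} (i : Fin n) : Program P n
  | step {n : ℕ} (a : Instr P n) (p : Program P (n + 1)) : Program P n
  | branch {n : ℕ} (i : Fin n) (p q : Program P n) : Program P n

/-- The law of the output of a program, started with the vector `s` of numbers present. -/
def Program.law {P : Primitives} (f : ℝ → ℝ) :
    {n : ℕ} → Program P n → (Fin n → ℝ) → Measure ℝ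
  | _, .halt i, s => Measure.dirac (s i)
  | _, .step a p, s => (a.law f s).bind (fun z => p.law f (Matrix.vecCons z s))
  | _, .branch i p q, s => if s i ≤ 0 then p.law f s else q.law f s

/-- The worst-case running time. -/
def Program.cost {P : Primitives} : {n : ℕ} → Program P n → ℕ
  | _, .halt _ => 1
  | _, .step a p => a.cost + p.cost
  | _, .branch _ p q => 1 + max p.cost q.cost

/-- `E` evaluates `S`: on input `(x, y)` it outputs `S y x`, for all real `x` and `y`. -/
def Evaluates {P : Primitives} (f : ℝ → ℝ) (E : Program P 2) (S : ℝ → ℝ → ℝ) : Prop :=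
  ∀ x y : ℝ, E.law f ![x, y] = Measure.dirac (S y x)

/-- The least worst-case time in which the machine evaluates `S`, over all inputs `(x, y)`;
`⊤` if no program evaluates `S`. -/
def evalTime (P : Primitives) (f : ℝ → ℝ) (S : ℝ → ℝ → ℝ) : ℕ∞ :=
  ⨅ (E : Program P 2) (_ : Evaluates f E S), (E.cost : ℕ∞)

/-- The law of `K(X)` for `X` with law `μ` and a randomized algorithm `K : ℝ → ℝ`. -/
def Program.outputLaw {P : Primitives} (f : ℝ → ℝ) (K : Program P 1) (μ : Measure ℝ) :
    Measure ℝ :=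
  μ.bind (fun x => K.law f ![x])

end GaussianReduction

end

/-!
The signed kernel `S_N = ∑_k (-1)^k / (2k)!! ∂^{2k} v` is a truncation of `exp(-Δ/2) v`, the inverse
of the heat semigroup at time one applied to `v`. Averaging over `X ~ N(θ, 1)` applies the heat
semigroup itself, so up to truncation the average of `S_N(· | X)` is the target `v(·; θ)`, and
`S_N(· | x)` integrates to one. The proof controls the truncation error, then the negative part of
`S_N`, and then simulates the normalized positive part by rejection sampling.

*Bias.* After integration by parts the average of `S_N` pairs `v` with the partial sum `δ_N` of the
Hermite expansion of a point mass at the centre. By the Christoffel–Darboux identity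
`x δ_N(x) = const · H_{2N+1}(x)`, so `δ_N` reproduces the value at the centre of every polynomial of
degree at most `2N + 1`. The error is therefore a weighted integral of `∂^n v` for any `n ≤ 2N + 2`
of one's choice (`hermite_projection_error`), with a weight `e^{-u²/4}`, which is what the moment
hypothesis on the link function integrates. Faà di Bruno's formula, in the form of coefficients of
powers of a Taylor polynomial (`iteratedDeriv_comp_eq`), bounds `∂^n v` by `n! (c/τ)^n` times powers
of `derivSum`. Taking `n` near the exponent of the rate, much smaller than `2N`, keeps the resulting
factorials below `(τ/c)^n` (`factorial_bound`, `LinkBound.lintegral_bias_le_rate`).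

*Negative part.* For `|x| ≤ τ` the higher terms of `S_N` form a geometric series with a small ratio,
so `|S_N - v| ≤ v · exp(-2 + |z|/√N)` with `z = y - f(x/τ)`. Where `S_N < 0` this relative error
exceeds one, hence it may be replaced by its `N`-th power, and the negative mass is at most
`2 e^{-N}` (`LinkBound.lintegral_neg_signedKernel_le`). For `|x| > τ` the weighted bound on the link
function only gives `O(e^{x²/8})`, which the Gaussian tail of the source absorbs. Because `S_N` has
total mass one, normalizing its positive part costs no more than twice the negative mass
(`lintegral_markovKernel_sub_le`). Together these give `LinkBound.lintegral_deficiency_le`.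

*Simulation.* For `|x| ≤ τ` the same estimate gives the envelope `S_N ≤ 4 q` with `q` the density of
`N(f(x/τ), 2)`. A round of rejection sampling with proposals from `q` accepts with probability at
least `1/4` and, given acceptance, has the required law, so `⌈4 log(4/ε)⌉` rounds leave an error of
at most `ε/4` (`LinkBound.rejectionLaw_apply_le`). The program is built by running a shortest
evaluator of `S_N` as a subroutine once per round (`Program.call`, `law_rejection`).
-/

noncomputable section

namespace GaussianReduction

/-! ### Hermite polynomials and the standard Gaussian density -/

/-- The density of `N(0, 1)`. -/
def stdPDF (x : ℝ) : ℝ := gaussianPDFReal 0 1 x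

/-- The probabilists' Hermite polynomial, as a function on the reals. -/
def hermiteFun (n : ℕ) (x : ℝ) : ℝ :=
  ((Polynomial.hermite n).map (Int.castRingHom ℝ)).eval x

lemma stdPDF_eq (x : ℝ) : stdPDF x = (√(2 * Real.pi))⁻¹ * Real.exp (-x ^ 2 / 2) := by
  simp [stdPDF, gaussianPDFReal]

lemma stdPDF_pos (x : ℝ) : 0 < stdPDF x := gaussianPDFReal_pos 0 1 x one_ne_zero

lemma stdPDF_nonneg (x : ℝ) : 0 ≤ stdPDF x := (stdPDF_pos x).le

lemma gaussianPDFReal_one_eq (m y : ℝ) : gaussianPDFReal m 1 y = stdPDF (y - m) := by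
  simp [stdPDF, gaussianPDFReal]

lemma inv_sqrt_two_pi_le_one : (√(2 * Real.pi))⁻¹ ≤ 1 := by
  apply inv_le_one_of_one_le₀
  rw [Real.one_le_sqrt]
  linarith [Real.pi_gt_three]

lemma continuous_stdPDF : Continuous stdPDF := by
  have : stdPDF = fun x => (√(2 * Real.pi))⁻¹ * Real.exp (-x ^ 2 / 2) := funext stdPDF_eq
  rw [this]; fun_prop

lemma stdPDF_le_exp (x : ℝ) : stdPDF x ≤ Real.exp (-x ^ 2 / 2) := by
  rw [stdPDF_eq]
  exact mul_le_of_le_one_left (Real.exp_pos _).le inv_sqrt_two_pi_le_one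

lemma contDiff_stdPDF {n : WithTop ℕ∞} : ContDiff ℝ n stdPDF := by
  have : stdPDF = fun x => (√(2 * Real.pi))⁻¹ * Real.exp (-x ^ 2 / 2) := funext stdPDF_eq
  rw [this]; fun_prop

lemma hasDerivAt_stdPDF (x : ℝ) : HasDerivAt stdPDF (-(x * stdPDF x)) x := by
  have h : stdPDF = fun x => (√(2 * Real.pi))⁻¹ * Real.exp (-x ^ 2 / 2) := funext stdPDF_eq
  have h1 : HasDerivAt (fun x : ℝ => -x ^ 2 / 2) (-x) x := by
    refine (((hasDerivAt_id' x).fun_pow 2).neg.div_const 2).congr_deriv ?_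
    simp; ring
  have h2 := h1.exp.const_mul ((√(2 * Real.pi))⁻¹)
  rw [h]
  exact h2.congr_deriv (by ring)

@[simp] lemma hermiteFun_zero (x : ℝ) : hermiteFun 0 x = 1 := by
  simp [hermiteFun]

@[simp] lemma hermiteFun_one (x : ℝ) : hermiteFun 1 x = x := by
  simp [hermiteFun]

lemma derivative_hermite_succ (n : ℕ) :
    Polynomial.derivative (Polynomial.hermite (n + 1)) =
      (n + 1 : Polynomial ℤ) * Polynomial.hermite n := by
  induction n with
  | zero => simp
  | succ n ih =>
    rw [Polynomial.hermite_succ (n + 1)]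
    simp only [Polynomial.derivative_sub, Polynomial.derivative_mul, Polynomial.derivative_X, ih,
      Polynomial.derivative_add, Polynomial.derivative_natCast, Polynomial.derivative_one]
    rw [Polynomial.hermite_succ n]
    push_cast
    ring

lemma hermiteFun_add_two (n : ℕ) (x : ℝ) :
    hermiteFun (n + 2) x = x * hermiteFun (n + 1) x - (n + 1) * hermiteFun n x := by
  unfold hermiteFun
  rw [Polynomial.hermite_succ (n + 1), derivative_hermite_succ]
  simp

lemma hasDerivAt_hermiteFun_succ (n : ℕ) (x : ℝ) :
    HasDerivAt (hermiteFun (n + 1)) ((n + 1) * hermiteFun n x) x := by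
  have := ((Polynomial.hermite (n + 1)).map (Int.castRingHom ℝ)).hasDerivAt x
  rw [Polynomial.derivative_map, derivative_hermite_succ] at this
  refine this.congr_deriv ?_
  simp [hermiteFun]

lemma hasDerivAt_hermiteFun_zero (x : ℝ) : HasDerivAt (hermiteFun 0) 0 x := by
  have h : hermiteFun 0 = fun _ => (1 : ℝ) := funext hermiteFun_zero
  rw [h]; exact hasDerivAt_const x 1

lemma continuous_hermiteFun (n : ℕ) : Continuous (hermiteFun n) := Polynomial.continuous _

lemma hasDerivAt_hermiteFun_mul_stdPDF (n : ℕ) (x : ℝ) :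
    HasDerivAt (fun t => hermiteFun n t * stdPDF t) (-(hermiteFun (n + 1) x * stdPDF x)) x := by
  cases n with
  | zero =>
    exact ((hasDerivAt_hermiteFun_zero x).mul (hasDerivAt_stdPDF x)).congr_deriv (by simp)
  | succ n =>
    refine ((hasDerivAt_hermiteFun_succ n x).mul (hasDerivAt_stdPDF x)).congr_deriv ?_
    rw [hermiteFun_add_two]; ring

lemma abs_hermiteFun_add_two_le (n : ℕ) (x : ℝ) :
    |hermiteFun (n + 2) x| ≤ |x| * |hermiteFun (n + 1) x| + (n + 1) * |hermiteFun n x| := by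
  rw [hermiteFun_add_two]
  refine (abs_sub _ _).trans ?_
  rw [abs_mul, abs_mul, abs_of_nonneg (by positivity : (0 : ℝ) ≤ n + 1)]

/-- The generating function `∑ |H_l(z)| s^l / l!` is dominated by that of the polynomials with the
signs of the recursion made positive: its derivative in `s` is at most `|z| + s` times itself. -/
lemma sum_abs_hermiteFun_le (m : ℕ) (z s : ℝ) (hs : 0 ≤ s) :
    ∑ l ∈ Finset.range m, |hermiteFun l z| / (l ! : ℝ) * s ^ l ≤
      Real.exp (s * |z| + s ^ 2 / 2) := by
  rcases Nat.eq_zero_or_pos m with rfl | hm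
  · simpa using (Real.exp_pos _).le
  obtain ⟨m, rfl⟩ : ∃ k, m = k + 1 := ⟨m - 1, by omega⟩
  set b : ℕ → ℝ := fun l => |hermiteFun l z| / (l ! : ℝ) with hb
  have hb0 : ∀ l, 0 ≤ b l := fun l => by positivity
  have hb1 : b 1 = |z| * b 0 := by simp [hb]
  have hb2 : ∀ l : ℕ, (l + 2 : ℝ) * b (l + 2) ≤ |z| * b (l + 1) + b l := by
    intro l
    have h := abs_hermiteFun_add_two_le l z
    have e1 : (l + 2 : ℝ) * b (l + 2) = |hermiteFun (l + 2) z| / ((l + 1)! : ℝ) := by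
      simp only [hb]
      rw [show (l + 2)! = (l + 2) * (l + 1)! from Nat.factorial_succ (l + 1)]
      push_cast
      field_simp
    have e2 : |z| * b (l + 1) + b l =
        (|z| * |hermiteFun (l + 1) z| + (l + 1) * |hermiteFun l z|) / ((l + 1)! : ℝ) := by
      simp only [hb]
      rw [Nat.factorial_succ l]
      push_cast
      field_simp
    rw [e1, e2]
    gcongr
  -- a Grönwall argument for the partial sum `P` as a function of `t`
  set P : ℝ → ℝ := fun t => ∑ l ∈ Finset.range (m + 1), b l * t ^ l with hP
  set P' : ℝ → ℝ := fun t => ∑ l ∈ Finset.range m, (l + 1) * b (l + 1) * t ^ l with hP'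
  have hder : ∀ t, HasDerivAt P (P' t) t := by
    intro t
    have h1 : HasDerivAt P (∑ l ∈ Finset.range (m + 1), b l * (l * t ^ (l - 1))) t := by
      apply HasDerivAt.fun_sum
      intro l _
      exact (hasDerivAt_pow l t).const_mul (b l)
    convert h1 using 1
    rw [Finset.sum_range_succ']
    simp only [hP', Nat.cast_zero, zero_mul, mul_zero, add_zero, Nat.cast_add, Nat.cast_one,
      Nat.add_sub_cancel]
    exact Finset.sum_congr rfl fun l _ => by ring
  have hle : ∀ t, 0 ≤ t → P' t ≤ (|z| + t) * P t := by
    intro t ht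
    have hk : ∀ k, ∑ l ∈ Finset.range k, (l + 1) * b (l + 1) * t ^ l ≤
        |z| * ∑ l ∈ Finset.range k, b l * t ^ l + t * ∑ l ∈ Finset.range (k - 1), b l * t ^ l := by
      intro k
      induction k with
      | zero => simp
      | succ k ih =>
        rw [Finset.sum_range_succ, Finset.sum_range_succ]
        cases k with
        | zero => simp [hb1]
        | succ k =>
          have h3 := hb2 k
          have h4 : (((k + 1 : ℕ) : ℝ) + 1) * b (k + 1 + 1) * t ^ (k + 1) ≤
              |z| * (b (k + 1) * t ^ (k + 1)) + t * (b k * t ^ k) := by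
            calc (((k + 1 : ℕ) : ℝ) + 1) * b (k + 1 + 1) * t ^ (k + 1)
                = ((k + 2 : ℝ) * b (k + 2)) * t ^ (k + 1) := by push_cast; ring_nf
              _ ≤ (|z| * b (k + 1) + b k) * t ^ (k + 1) := by gcongr
              _ = _ := by ring
          simp only [Nat.add_sub_cancel] at ih ⊢
          rw [Finset.sum_range_succ (fun l => b l * t ^ l) k] at ih ⊢
          linarith
    have hmono : ∀ k, k ≤ m + 1 → ∑ l ∈ Finset.range k, b l * t ^ l ≤ P t := fun k hk =>
      Finset.sum_le_sum_of_subset_of_nonneg (Finset.range_mono hk)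
        fun i _ _ => mul_nonneg (hb0 i) (pow_nonneg ht i)
    calc P' t ≤ _ := hk m
      _ ≤ |z| * P t + t * P t := by
          gcongr
          · exact hmono _ (by omega)
          · exact hmono _ (by omega)
      _ = _ := by ring
  have hanti : AntitoneOn (fun t => P t * Real.exp (-(t * |z| + t ^ 2 / 2))) (Set.Ici 0) := by
    have hd : ∀ t, HasDerivAt (fun t => P t * Real.exp (-(t * |z| + t ^ 2 / 2)))
        ((P' t - (|z| + t) * P t) * Real.exp (-(t * |z| + t ^ 2 / 2))) t := by
      intro t
      have h1 : HasDerivAt (fun t : ℝ => -(t * |z| + t ^ 2 / 2)) (-(|z| + t)) t := by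
        refine (((hasDerivAt_id' t).mul_const |z|).add
          (((hasDerivAt_id' t).fun_pow 2).div_const 2)).neg.congr_deriv ?_
        simp
      exact ((hder t).mul h1.exp).congr_deriv (by ring)
    apply antitoneOn_of_deriv_nonpos (convex_Ici 0)
    · exact fun t _ => (hd t).continuousAt.continuousWithinAt
    · exact fun t _ => (hd t).differentiableAt.differentiableWithinAt
    · intro t ht
      rw [interior_Ici] at ht
      rw [(hd t).deriv]
      exact mul_nonpos_of_nonpos_of_nonneg (sub_nonpos.2 (hle t (le_of_lt ht))) (Real.exp_pos _).le
  have := hanti (Set.mem_Ici.2 le_rfl) (Set.mem_Ici.2 hs) hs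
  have h0 : P 0 = 1 := by simp [hP, Finset.sum_range_succ', hb]
  simp only [h0] at this
  have h5 : P s * Real.exp (-(s * |z| + s ^ 2 / 2)) ≤ 1 := by simpa using this
  rw [Real.exp_neg, ← div_eq_mul_inv, div_le_one (Real.exp_pos _)] at h5
  exact h5

lemma sum_abs_hermiteFun_le_exp (m : ℕ) (z : ℝ) :
    ∑ l ∈ Finset.range m, |hermiteFun l z| / (l ! : ℝ) ≤ Real.exp (|z| + 1 / 2) := by
  simpa using sum_abs_hermiteFun_le m z 1 zero_le_one

lemma abs_hermiteFun_le (l : ℕ) (z : ℝ) : |hermiteFun l z| ≤ l ! * Real.exp (|z| + 1 / 2) := by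
  have h := (Finset.single_le_sum (f := fun l => |hermiteFun l z| / (l ! : ℝ))
    (fun i _ => by positivity) (Finset.self_mem_range_succ l)).trans
      (sum_abs_hermiteFun_le_exp (l + 1) z)
  rw [div_le_iff₀ (by positivity)] at h
  linarith

lemma exp_abs_mul_exp_neg_le (c x : ℝ) :
    Real.exp (c * |x|) * Real.exp (-x ^ 2 / 4) ≤ Real.exp (c ^ 2) := by
  rw [← Real.exp_add]
  apply Real.exp_le_exp.2
  nlinarith [sq_nonneg (|x| / 2 - c), sq_abs x]

lemma integrable_exp_neg_sq_div_four : Integrable fun x : ℝ => Real.exp (-x ^ 2 / 4) := by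
  have := integrable_exp_neg_mul_sq (b := 1 / 4) (by norm_num)
  refine this.congr (Filter.Eventually.of_forall fun x => ?_)
  simp only; congr 1; ring

lemma integral_stdPDF : ∫ x, stdPDF x = 1 := integral_gaussianPDFReal_eq_one 0 one_ne_zero

lemma integrable_exp_mul_abs_mul_stdPDF (c : ℝ) :
    Integrable fun x : ℝ => Real.exp (c * |x|) * stdPDF x := by
  refine (integrable_exp_neg_sq_div_four.const_mul (Real.exp (c ^ 2))).mono'
    ((by fun_prop : Continuous fun x : ℝ => Real.exp (c * |x|)).mul
      continuous_stdPDF).aestronglyMeasurable (Filter.Eventually.of_forall fun x => ?_)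
  rw [Real.norm_of_nonneg (mul_nonneg (Real.exp_pos _).le (stdPDF_nonneg _))]
  calc Real.exp (c * |x|) * stdPDF x ≤ Real.exp (c * |x|) * Real.exp (-x ^ 2 / 2) := by
        gcongr; exact stdPDF_le_exp x
    _ = (Real.exp (c * |x|) * Real.exp (-x ^ 2 / 4)) * Real.exp (-x ^ 2 / 4) := by
        rw [mul_assoc, ← Real.exp_add (-x ^ 2 / 4)]; congr 2; ring
    _ ≤ _ := by gcongr; exact exp_abs_mul_exp_neg_le c x

lemma integral_exp_mul_stdPDF (c : ℝ) :
    ∫ x, Real.exp (c * x) * stdPDF x = Real.exp (c ^ 2 / 2) := by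
  have h := congrFun (mgf_fun_id_gaussianReal (μ := 0) (v := 1)) c
  rw [mgf, integral_gaussianReal_eq_integral_smul one_ne_zero] at h
  simp only [smul_eq_mul, zero_mul, zero_add, NNReal.coe_one, one_mul] at h
  rw [← h]
  exact integral_congr_ae (Filter.Eventually.of_forall fun x => mul_comm _ _)

lemma integrable_exp_mul_stdPDF (c : ℝ) :
    Integrable fun x : ℝ => Real.exp (c * x) * stdPDF x := by
  refine (integrable_exp_mul_abs_mul_stdPDF |c|).mono'
    ((by fun_prop : Continuous fun x : ℝ => Real.exp (c * x)).mul
      continuous_stdPDF).aestronglyMeasurable (Filter.Eventually.of_forall fun x => ?_)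
  rw [Real.norm_of_nonneg (mul_nonneg (Real.exp_pos _).le (stdPDF_nonneg _)), ← abs_mul]
  gcongr
  · exact stdPDF_nonneg x
  · exact le_abs_self _

lemma integral_exp_mul_abs_mul_stdPDF_le (c : ℝ) :
    ∫ x, Real.exp (c * |x|) * stdPDF x ≤ 2 * Real.exp (c ^ 2 / 2) := by
  have h1 := integral_exp_mul_stdPDF c
  have h2 := integral_exp_mul_stdPDF (-c)
  have h3 : ∫ x, (Real.exp (c * x) * stdPDF x + Real.exp (-c * x) * stdPDF x) =
      2 * Real.exp (c ^ 2 / 2) := by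
    rw [integral_add (integrable_exp_mul_stdPDF c) (integrable_exp_mul_stdPDF (-c)), h1, h2]
    simp; ring
  rw [← h3]
  refine integral_mono (integrable_exp_mul_abs_mul_stdPDF c)
    ((integrable_exp_mul_stdPDF c).add (integrable_exp_mul_stdPDF (-c))) fun x => ?_
  simp only
  rw [← add_mul]
  gcongr
  · exact stdPDF_nonneg x
  · rcases abs_cases x with ⟨h, _⟩ | ⟨h, _⟩ <;> rw [h]
    · linarith [Real.exp_pos (-c * x)]
    · rw [mul_neg, ← neg_mul]; linarith [Real.exp_pos (c * x)]

lemma integrable_hermiteFun_mul_stdPDF (l : ℕ) :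
    Integrable fun x => hermiteFun l x * stdPDF x := by
  refine ((integrable_exp_mul_abs_mul_stdPDF 1).const_mul (l ! * Real.exp (1 / 2))).mono'
    ((continuous_hermiteFun l).mul continuous_stdPDF).aestronglyMeasurable
    (Filter.Eventually.of_forall fun x => ?_)
  rw [norm_mul, Real.norm_eq_abs, Real.norm_of_nonneg (stdPDF_nonneg x)]
  calc |hermiteFun l x| * stdPDF x ≤ (l ! * Real.exp (|x| + 1 / 2)) * stdPDF x := by
        gcongr
        · exact stdPDF_nonneg x
        · exact abs_hermiteFun_le l x
    _ = _ := by rw [one_mul, Real.exp_add]; ring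

lemma integral_hermiteFun_succ_mul_stdPDF (l : ℕ) :
    ∫ x, hermiteFun (l + 1) x * stdPDF x = 0 := by
  have h := integral_eq_zero_of_hasDerivAt_of_integrable
    (fun x => hasDerivAt_hermiteFun_mul_stdPDF l x)
    (integrable_hermiteFun_mul_stdPDF (l + 1)).neg (integrable_hermiteFun_mul_stdPDF l)
  rwa [integral_neg, neg_eq_zero] at h

/-! ### Faà di Bruno's formula through powers of the Taylor polynomial -/

/-- The Taylor polynomial `∑_{j=1}^{M} h^{(j)}(t) / j! · X^j` of `h` at `t`, without its constant
term. -/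
def jet (h : ℝ → ℝ) (M : ℕ) (t : ℝ) : Polynomial ℝ :=
  ∑ j ∈ Finset.Icc 1 M, Polynomial.monomial j (iteratedDeriv j h t / (j ! : ℝ))

lemma coeff_jet (h : ℝ → ℝ) (M : ℕ) (t : ℝ) (j : ℕ) :
    (jet h M t).coeff j = if j ∈ Finset.Icc 1 M then iteratedDeriv j h t / (j ! : ℝ) else 0 := by
  simp only [jet, Polynomial.finsetSum_coeff, Polynomial.coeff_monomial]
  exact Finset.sum_ite_eq' _ _ _

lemma iteratedDeriv_succ_comp {F h : ℝ → ℝ} (hF : ContDiff ℝ ∞ F) (hh : ContDiff ℝ ∞ h)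
    (n : ℕ) (t : ℝ) :
    iteratedDeriv (n + 1) (fun x => F (h x)) t =
      ∑ i ∈ Finset.range (n + 1), (n.choose i : ℝ) *
        iteratedDeriv i (fun x => deriv F (h x)) t * iteratedDeriv (n - i + 1) h t := by
  have hF' : ContDiff ℝ ∞ (deriv F) := (contDiff_infty_iff_deriv.1 hF).2
  have hh' : ContDiff ℝ ∞ (deriv h) := (contDiff_infty_iff_deriv.1 hh).2
  have hd : deriv (fun x => F (h x)) = fun x => deriv F (h x) * deriv h x := by
    funext x
    exact ((hF.differentiable (by simp)).differentiableAt.hasDerivAt.comp x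
      (hh.differentiable (by simp)).differentiableAt.hasDerivAt).deriv
  have h1 : ContDiff ℝ ∞ (fun x => deriv F (h x)) := hF'.comp hh
  rw [iteratedDeriv_succ', hd, iteratedDeriv_fun_mul (n := n)
    (h1.contDiffAt.of_le (mod_cast le_top)) (hh'.contDiffAt.of_le (mod_cast le_top))]
  simp only [← iteratedDeriv_succ']

/-- **Faà di Bruno's formula**: the `n`-th Taylor coefficient of `F ∘ h` is a combination of the
coefficients of the powers of the Taylor polynomial of `h`. Both sides satisfy the recursion
given by `(F ∘ h)' = (F' ∘ h) h'` and `(β^l)' = l β^(l-1) β'`. -/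
theorem iteratedDeriv_comp_eq {h : ℝ → ℝ} (hh : ContDiff ℝ ∞ h) (M : ℕ) (t : ℝ) :
    ∀ n ≤ M, ∀ F : ℝ → ℝ, ContDiff ℝ ∞ F →
      iteratedDeriv n (fun x => F (h x)) t =
        n ! * ∑ l ∈ Finset.range (n + 1),
          iteratedDeriv l F (h t) / (l ! : ℝ) * ((jet h M t) ^ l).coeff n := by
  intro n
  induction n using Nat.strong_induction_on with
  | _ n ih =>
    intro hn F hF
    rcases n with _ | n
    · simp
    have hF' : ContDiff ℝ ∞ (deriv F) := (contDiff_infty_iff_deriv.1 hF).2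
    rw [iteratedDeriv_succ_comp hF hh]
    set β := jet h M t with hβ
    -- `X ∣ β`, so the sum over `l` may be extended beyond the order of the derivative
    have hvan : ∀ i l : ℕ, i < l → (β ^ l).coeff i = 0 := by
      intro i l hil
      have hX : Polynomial.X ∣ β := by
        rw [Polynomial.X_dvd_iff, hβ, coeff_jet]; simp
      exact Polynomial.X_pow_dvd_iff.1 (pow_dvd_pow_of_dvd hX l) i hil
    have hcoef : ∀ i ≤ n, iteratedDeriv (n - i + 1) h t =
        ((n - i)! : ℝ) * (Polynomial.derivative β).coeff (n - i) := by
      intro i hi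
      rw [Polynomial.coeff_derivative, hβ, coeff_jet,
        if_pos (Finset.mem_Icc.2 ⟨by omega, by omega⟩), Nat.factorial_succ]
      push_cast
      field_simp
    have hrec : ∀ l : ℕ, ((β ^ (l + 1)).coeff (n + 1)) * (n + 1) =
        (l + 1) * ∑ i ∈ Finset.range (n + 1),
          (β ^ l).coeff i * (Polynomial.derivative β).coeff (n - i) := by
      intro l
      rw [← Polynomial.coeff_derivative, Polynomial.derivative_pow_succ, mul_assoc,
        Polynomial.coeff_C_mul, Polynomial.coeff_mul, Finset.Nat.sum_antidiagonal_eq_sum_range_succ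
        (fun i j => (β ^ l).coeff i * (Polynomial.derivative β).coeff j)]
    have hterm : ∀ i ∈ Finset.range (n + 1), (n.choose i : ℝ) *
        iteratedDeriv i (fun x => deriv F (h x)) t * iteratedDeriv (n - i + 1) h t =
        (n ! : ℝ) * ∑ l ∈ Finset.range (n + 1), iteratedDeriv (l + 1) F (h t) / (l ! : ℝ) *
          ((β ^ l).coeff i * (Polynomial.derivative β).coeff (n - i)) := by
      intro i hi
      have hi' : i ≤ n := by simpa [Nat.lt_succ_iff] using hi
      rw [ih i (by omega) (by omega) (deriv F) hF', hcoef i hi']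
      have hext : ∑ l ∈ Finset.range (i + 1), iteratedDeriv l (deriv F) (h t) / (l ! : ℝ) *
          (β ^ l).coeff i = ∑ l ∈ Finset.range (n + 1),
            iteratedDeriv (l + 1) F (h t) / (l ! : ℝ) * (β ^ l).coeff i := by
        simp only [← iteratedDeriv_succ']
        refine Finset.sum_subset (Finset.range_mono (by omega)) fun l _ hl => ?_
        rw [hvan i l (by simpa using hl), mul_zero]
      rw [hext]
      have hch : (n.choose i : ℝ) * (i ! : ℝ) * ((n - i)! : ℝ) = n ! := by
        exact_mod_cast Nat.choose_mul_factorial_mul_factorial hi'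
      rw [← hch]
      simp only [← mul_assoc _ ((β ^ _).coeff i), ← Finset.sum_mul]
      ring
    rw [Finset.sum_congr rfl hterm, ← Finset.mul_sum, Finset.sum_comm,
      Finset.sum_range_succ' _ (n + 1), Nat.factorial_succ]
    simp only [pow_zero, Polynomial.coeff_one, Nat.add_eq_zero_iff, one_ne_zero, and_false,
      if_false, mul_zero, add_zero]
    rw [Nat.cast_mul, mul_comm ((n + 1 : ℕ) : ℝ), mul_assoc]
    congr 1
    rw [Finset.mul_sum]
    refine Finset.sum_congr rfl fun l _ => ?_
    rw [← Finset.mul_sum]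
    have h1 := hrec l
    rw [Nat.factorial_succ]
    push_cast
    field_simp
    linear_combination (-(iteratedDeriv (l + 1) F (h t))) * h1

/-- The coefficients of `p^l` are at most those of the power of the majorant of `p`. -/
lemma abs_coeff_pow_le (p : Polynomial ℝ) (M : ℕ) (hp : ∀ j, M < j → p.coeff j = 0)
    (c A : ℝ) (hc : 0 < c) (hA : ∑ j ∈ Finset.range (M + 1), |p.coeff j| / c ^ j ≤ A) (l n : ℕ) :
    |(p ^ l).coeff n| ≤ c ^ n * A ^ l := by
  have hA0 : 0 ≤ A := le_trans (Finset.sum_nonneg fun j _ => by positivity) hA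
  have hsum : ∀ n, ∑ j ∈ Finset.range (n + 1), |p.coeff j| / c ^ j ≤ A := by
    intro n
    refine le_trans ?_ hA
    have hsub : ∑ j ∈ Finset.range (n + 1), |p.coeff j| / c ^ j ≤
        ∑ j ∈ Finset.range (max n M + 1), |p.coeff j| / c ^ j :=
      Finset.sum_le_sum_of_subset_of_nonneg (Finset.range_mono (by omega)) fun i _ _ => by
        positivity
    refine hsub.trans_eq (Finset.sum_subset (Finset.range_mono (by omega)) fun i _ hi => ?_).symm
    rw [hp i (by simpa [Nat.lt_succ_iff] using hi)]; simp
  induction l generalizing n with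
  | zero =>
    rw [pow_zero, pow_zero, Polynomial.coeff_one]
    split_ifs with h
    · subst h; simp
    · simp; positivity
  | succ l ih =>
    rw [pow_succ, mul_comm, Polynomial.coeff_mul, Finset.Nat.sum_antidiagonal_eq_sum_range_succ
      (fun i j => p.coeff i * (p ^ l).coeff j)]
    calc |∑ i ∈ Finset.range (n + 1), p.coeff i * (p ^ l).coeff (n - i)|
        ≤ ∑ i ∈ Finset.range (n + 1), |p.coeff i * (p ^ l).coeff (n - i)| :=
          Finset.abs_sum_le_sum_abs _ _
      _ ≤ ∑ i ∈ Finset.range (n + 1), (|p.coeff i| / c ^ i) * (c ^ n * A ^ l) := by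
          refine Finset.sum_le_sum fun i hi => ?_
          have hi' : i ≤ n := by simpa [Nat.lt_succ_iff] using hi
          rw [abs_mul]
          calc |p.coeff i| * |(p ^ l).coeff (n - i)| ≤ |p.coeff i| * (c ^ (n - i) * A ^ l) := by
                gcongr; exact ih _
            _ = _ := by
                rw [← Nat.sub_add_cancel hi', pow_add]
                simp only [Nat.add_sub_cancel]
                field_simp
      _ ≤ A * (c ^ n * A ^ l) := by
          rw [← Finset.sum_mul]; gcongr; exact hsum n
      _ = _ := by ring

/-! ### The Hermite expansion of a function at the centre of a Gaussian -/

lemma abs_hermiteFun_mul_stdPDF_le (m : ℕ) (x : ℝ) :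
    |hermiteFun m x| * stdPDF x ≤ (m ! * Real.exp (3 / 2)) * Real.exp (-x ^ 2 / 4) := by
  have h1 := exp_abs_mul_exp_neg_le 1 x
  rw [one_mul, one_pow] at h1
  calc |hermiteFun m x| * stdPDF x
      ≤ (m ! * Real.exp (|x| + 1 / 2)) * Real.exp (-x ^ 2 / 2) := by
        gcongr
        · exact stdPDF_nonneg x
        · exact abs_hermiteFun_le m x
        · exact stdPDF_le_exp x
    _ = (m ! * Real.exp (1 / 2)) * ((Real.exp |x| * Real.exp (-x ^ 2 / 4)) *
          Real.exp (-x ^ 2 / 4)) := by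
        rw [Real.exp_add, mul_assoc (Real.exp |x|), ← Real.exp_add (-x ^ 2 / 4),
          show -x ^ 2 / 4 + -x ^ 2 / 4 = -x ^ 2 / 2 by ring]
        ring
    _ ≤ (m ! * Real.exp (1 / 2)) * (Real.exp 1 * Real.exp (-x ^ 2 / 4)) := by gcongr
    _ = _ := by
        rw [show (3 / 2 : ℝ) = 1 / 2 + 1 by norm_num, Real.exp_add]; ring

lemma integrable_mul_hermiteFun_mul_stdPDF {g : ℝ → ℝ} (m : ℕ)
    (hg : Integrable fun t => g t * Real.exp (-t ^ 2 / 4)) :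
    Integrable fun t => g t * (hermiteFun m t * stdPDF t) := by
  have hc : Continuous fun t : ℝ => hermiteFun m t * stdPDF t * Real.exp (t ^ 2 / 4) :=
    ((continuous_hermiteFun m).mul continuous_stdPDF).mul (by fun_prop)
  have hcancel : ∀ t : ℝ, Real.exp (-t ^ 2 / 4) * Real.exp (t ^ 2 / 4) = 1 := fun t => by
    rw [← Real.exp_add]; simp [neg_div]
  have h := hg.mul_bdd (c := m ! * Real.exp (3 / 2)) hc.aestronglyMeasurable
    (Filter.Eventually.of_forall fun t => by
      rw [norm_mul, norm_mul, Real.norm_eq_abs, Real.norm_of_nonneg (stdPDF_nonneg t),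
        Real.norm_of_nonneg (Real.exp_pos _).le]
      calc |hermiteFun m t| * stdPDF t * Real.exp (t ^ 2 / 4)
          ≤ (m ! * Real.exp (3 / 2)) * Real.exp (-t ^ 2 / 4) * Real.exp (t ^ 2 / 4) := by
            exact mul_le_mul_of_nonneg_right (abs_hermiteFun_mul_stdPDF_le m t) (Real.exp_pos _).le
        _ = _ := by rw [mul_assoc, hcancel, mul_one])
  refine h.congr (Filter.Eventually.of_forall fun t => ?_)
  simp only
  linear_combination (g t * hermiteFun m t * stdPDF t) * hcancel t

lemma integral_deriv_mul_hermiteFun {g g' : ℝ → ℝ} (m : ℕ) (hd : ∀ t, HasDerivAt g (g' t) t)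
    (hg : Integrable fun t => g t * Real.exp (-t ^ 2 / 4))
    (hg' : Integrable fun t => g' t * Real.exp (-t ^ 2 / 4)) :
    ∫ t, g' t * (hermiteFun m t * stdPDF t) = ∫ t, g t * (hermiteFun (m + 1) t * stdPDF t) := by
  have h := integral_mul_deriv_eq_deriv_mul_of_integrable (u := g) (u' := g')
    (v := fun t => hermiteFun m t * stdPDF t)
    (v' := fun t => -(hermiteFun (m + 1) t * stdPDF t)) (fun x _ => hd x)
    (fun x _ => hasDerivAt_hermiteFun_mul_stdPDF m x)
    (by
      refine (integrable_mul_hermiteFun_mul_stdPDF (m + 1) hg).neg.congr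
        (Filter.Eventually.of_forall fun t => ?_)
      simp)
    (integrable_mul_hermiteFun_mul_stdPDF m hg') (integrable_mul_hermiteFun_mul_stdPDF m hg)
  simp only [mul_neg, integral_neg, neg_inj] at h
  exact h.symm

lemma integral_iteratedDeriv_mul_hermiteFun {g : ℝ → ℝ} (hg : ContDiff ℝ ∞ g) (k : ℕ)
    (hint : ∀ j ≤ k, Integrable fun t => iteratedDeriv j g t * Real.exp (-t ^ 2 / 4)) (m : ℕ) :
    ∫ t, iteratedDeriv k g t * (hermiteFun m t * stdPDF t) =
      ∫ t, g t * (hermiteFun (m + k) t * stdPDF t) := by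
  induction k generalizing m with
  | zero => simp
  | succ k ih =>
    have hd : ∀ t, HasDerivAt (iteratedDeriv k g) (iteratedDeriv (k + 1) g t) t := fun t => by
      rw [iteratedDeriv_succ]
      exact ((hg.differentiable_iteratedDeriv k (mod_cast WithTop.coe_lt_top _)) t).hasDerivAt
    rw [integral_deriv_mul_hermiteFun m hd (hint k (by omega)) (hint (k + 1) le_rfl),
      ih (fun j hj => hint j (by omega)) (m + 1)]
    simp only [show m + 1 + k = m + (k + 1) by ring]

lemma integrable_pow_mul_exp_neg (j : ℕ) :
    Integrable fun t : ℝ => t ^ j * Real.exp (-t ^ 2 / 4) := by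
  have := integrable_rpow_mul_exp_neg_mul_sq (b := 1 / 4) (by norm_num) (s := j)
    (by linarith [Nat.cast_nonneg (α := ℝ) j])
  refine this.congr (Filter.Eventually.of_forall fun x => ?_)
  simp only [Real.rpow_natCast]; congr 2; ring

lemma integrable_hermiteFun_mul_exp_neg (m : ℕ) :
    Integrable fun t : ℝ => hermiteFun m t * Real.exp (-t ^ 2 / 4) := by
  set p := (Polynomial.hermite m).map (Int.castRingHom ℝ) with hp
  have h : (fun t : ℝ => hermiteFun m t * Real.exp (-t ^ 2 / 4)) = fun t =>
      ∑ i ∈ Finset.range (p.natDegree + 1), p.coeff i * (t ^ i * Real.exp (-t ^ 2 / 4)) := by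
    funext t
    rw [hermiteFun, ← hp, Polynomial.eval_eq_sum_range, Finset.sum_mul]
    exact Finset.sum_congr rfl fun i _ => by ring
  rw [h]
  exact integrable_finsetSum _ fun i _ => (integrable_pow_mul_exp_neg i).const_mul _

lemma integral_pow_mul_hermiteFun_of_lt {j m : ℕ} (hjm : j < m) :
    ∫ t, t ^ j * (hermiteFun m t * stdPDF t) = 0 := by
  induction j generalizing m with
  | zero =>
    obtain ⟨m, rfl⟩ : ∃ k, m = k + 1 := ⟨m - 1, by omega⟩
    simpa using integral_hermiteFun_succ_mul_stdPDF m
  | succ j ih =>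
    obtain ⟨m, rfl⟩ : ∃ k, m = k + 1 := ⟨m - 1, by omega⟩
    have h := integral_deriv_mul_hermiteFun (g := fun t => t ^ (j + 1))
      (g' := fun t => (j + 1) * t ^ j) m (fun t => by simpa using hasDerivAt_pow (j + 1) t)
      (integrable_pow_mul_exp_neg (j + 1))
      (((integrable_pow_mul_exp_neg j).const_mul (j + 1)).congr
        (Filter.Eventually.of_forall fun t => by simp only; ring))
    rw [← h]
    simp only [mul_assoc]
    rw [integral_const_mul, ih (by omega), mul_zero]

lemma integral_hermiteFun_sq_mul_stdPDF (m : ℕ) :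
    ∫ t, hermiteFun m t * (hermiteFun m t * stdPDF t) = m ! := by
  induction m with
  | zero => simpa using integral_stdPDF
  | succ m ih =>
    have h := integral_deriv_mul_hermiteFun (g := hermiteFun (m + 1))
      (g' := fun t => (m + 1) * hermiteFun m t) m (hasDerivAt_hermiteFun_succ m)
      (integrable_hermiteFun_mul_exp_neg (m + 1))
      (((integrable_hermiteFun_mul_exp_neg m).const_mul (m + 1)).congr
        (Filter.Eventually.of_forall fun t => by simp only; ring))
    rw [← h]
    simp only [mul_assoc]
    rw [integral_const_mul, ih, Nat.factorial_succ]
    push_cast; ring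

/-- The coefficients `(-1)^k / (2k)!!` of the truncated inverse heat semigroup. -/
def heatCoeff (k : ℕ) : ℝ := (-1 : ℝ) ^ k / ((2 * k)‼ : ℝ)

lemma heatCoeff_succ (k : ℕ) : (2 * k + 2) * heatCoeff (k + 1) = -heatCoeff k := by
  have h : (2 * (k + 1))‼ = (2 * k + 2) * (2 * k)‼ := Nat.doubleFactorial_add_two (2 * k)
  have hpos : ((2 * k)‼ : ℝ) ≠ 0 := by exact_mod_cast (Nat.doubleFactorial_pos _).ne'
  rw [heatCoeff, heatCoeff, h]
  push_cast
  field_simp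
  ring

/-- `∑_{k ≤ N} heatCoeff k · H_{2k}`, the Hermite expansion of the point mass at `0`, truncated. -/
def deltaKernel (N : ℕ) (x : ℝ) : ℝ :=
  ∑ k ∈ Finset.range (N + 1), heatCoeff k * hermiteFun (2 * k) x

/-- The Christoffel–Darboux identity at `0`: the sum telescopes. -/
lemma mul_deltaKernel (N : ℕ) (x : ℝ) :
    x * deltaKernel N x = heatCoeff N * hermiteFun (2 * N + 1) x := by
  induction N with
  | zero => simp [deltaKernel, mul_comm]
  | succ N ih =>
    rw [deltaKernel, Finset.sum_range_succ, ← deltaKernel, mul_add, ih,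
      show 2 * (N + 1) + 1 = (2 * N + 1) + 2 by ring, hermiteFun_add_two]
    have := heatCoeff_succ N
    rw [show 2 * (N + 1) = 2 * N + 1 + 1 by ring]
    push_cast
    linear_combination (hermiteFun (2 * N + 1) x) * this

lemma integral_pow_mul_deltaKernel {j N : ℕ} (hj : j ≤ 2 * N + 1) :
    ∑ k ∈ Finset.range (N + 1), heatCoeff k * ∫ t, t ^ j * (hermiteFun (2 * k) t * stdPDF t) =
      if j = 0 then 1 else 0 := by
  rcases j with _ | j
  · rw [Finset.sum_range_succ']
    have h : ∀ k, ∫ t, hermiteFun (2 * (k + 1)) t * stdPDF t = 0 := fun k =>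
      integral_hermiteFun_succ_mul_stdPDF (2 * k + 1)
    simp [h, heatCoeff, integral_stdPDF]
  · have hI : ∀ k, Integrable fun t => t ^ (j + 1) * (hermiteFun (2 * k) t * stdPDF t) := fun k =>
      integrable_mul_hermiteFun_mul_stdPDF _ (integrable_pow_mul_exp_neg (j + 1))
    simp only [← integral_const_mul]
    rw [← integral_finsetSum _ fun k _ => (hI k).const_mul _]
    have h : ∀ t, ∑ k ∈ Finset.range (N + 1), heatCoeff k *
        (t ^ (j + 1) * (hermiteFun (2 * k) t * stdPDF t)) =
        heatCoeff N * (t ^ j * (hermiteFun (2 * N + 1) t * stdPDF t)) := by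
      intro t
      calc _ = t ^ j * stdPDF t * (t * deltaKernel N t) := by
            rw [deltaKernel, Finset.mul_sum, Finset.mul_sum]
            exact Finset.sum_congr rfl fun k _ => by ring
        _ = _ := by rw [mul_deltaKernel]; ring
    simp only [h]
    rw [integral_const_mul, integral_pow_mul_hermiteFun_of_lt (by omega)]
    simp

/-- The coefficient compensates the `L²` norm `√(2k)!` of the Hermite polynomial. -/
lemma abs_heatCoeff_mul_sqrt_le (k : ℕ) : |heatCoeff k| * √((2 * k)! : ℝ) ≤ 1 := by
  have hpos : (0 : ℝ) < ((2 * k)‼ : ℝ) := by exact_mod_cast Nat.doubleFactorial_pos _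
  have h1 : (2 * k)! ≤ (2 * k)‼ * (2 * k)‼ := by
    rcases k with _ | k
    · simp
    · rw [show 2 * (k + 1) = (2 * k + 1) + 1 by ring, Nat.factorial_eq_mul_doubleFactorial]
      gcongr
      have : ∀ n, n‼ ≤ (n + 1)‼ := by
        intro n
        induction n using Nat.strong_induction_on with
        | _ n ih =>
          match n with
          | 0 => simp
          | 1 => simp [Nat.doubleFactorial]
          | n + 2 =>
            rw [Nat.doubleFactorial_add_two, show n + 2 + 1 = (n + 1) + 2 by ring,
              Nat.doubleFactorial_add_two]
            exact Nat.mul_le_mul (by omega) (ih n (by omega))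
      exact this _
  rw [heatCoeff, abs_div, abs_pow, abs_neg, abs_one, one_pow, abs_of_pos hpos, one_div,
    inv_mul_le_one₀ hpos, Real.sqrt_le_left hpos.le, sq]
  exact_mod_cast h1

/-- For `u` between `0` and `x`, the Gaussian weight at `x` splits into the weights at `u` and at
`x - u`, because `u² + (x - u)² ≤ x²`. -/
lemma hermite_kernel_le (m k : ℕ) (x u : ℝ) (hu : 0 ≤ u * (x - u)) :
    |hermiteFun m x| * stdPDF x * (|x - u| ^ k / (k ! : ℝ)) ≤
      Real.exp (-u ^ 2 / 4) * (√(m ! : ℝ) / 2) *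
        (hermiteFun m x * (hermiteFun m x * stdPDF x) / (m ! : ℝ) +
          Real.exp (2 * |x - u|) * stdPDF (x - u)) := by
  have hs : 0 < √(m ! : ℝ) := Real.sqrt_pos.2 (by positivity)
  have hs2 : √(m ! : ℝ) ^ 2 = m ! := Real.sq_sqrt (by positivity)
  have hw : |x - u| ^ k / (k ! : ℝ) ≤ Real.exp |x - u| :=
    Real.pow_div_factorial_le_exp _ (abs_nonneg _) k
  have hφ : stdPDF x ^ 2 ≤ stdPDF x * (stdPDF (x - u) * Real.exp (-u ^ 2 / 4) ^ 2) := by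
    rw [sq]
    gcongr
    · exact stdPDF_nonneg x
    · rw [stdPDF_eq, stdPDF_eq, mul_assoc, ← Real.exp_nat_mul, ← Real.exp_add]
      gcongr
      push_cast
      nlinarith
  have hp1 := stdPDF_nonneg x
  have hp2 := stdPDF_nonneg (x - u)
  set a := |hermiteFun m x| with ha
  have ha2 : hermiteFun m x * (hermiteFun m x * stdPDF x) = a ^ 2 * stdPDF x := by
    rw [ha, sq_abs]; ring
  have hb2 : Real.exp (2 * |x - u|) = Real.exp |x - u| ^ 2 := by
    rw [← Real.exp_nat_mul]; norm_num
  rw [ha2, hb2]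
  set b := Real.exp |x - u|
  set e := Real.exp (-u ^ 2 / 4)
  set s := √(m ! : ℝ)
  have hb : 0 < b := Real.exp_pos _
  have he : 0 < e := Real.exp_pos _
  have ha0 : 0 ≤ a := abs_nonneg _
  refine (mul_le_mul_of_nonneg_left hw (by positivity)).trans ?_
  rw [← hs2]
  -- the inequality of arithmetic and geometric means, after squaring
  refine (pow_le_pow_iff_left₀ (by positivity) (by positivity) two_ne_zero).1 ?_
  calc (a * stdPDF x * b) ^ 2 = a ^ 2 * b ^ 2 * stdPDF x ^ 2 := by ring
    _ ≤ a ^ 2 * b ^ 2 * (stdPDF x * (stdPDF (x - u) * e ^ 2)) := by gcongr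
    _ = e ^ 2 * ((a ^ 2 * stdPDF x / s) * (s * (b ^ 2 * stdPDF (x - u)))) := by field_simp
    _ ≤ e ^ 2 * (((a ^ 2 * stdPDF x / s) + (s * (b ^ 2 * stdPDF (x - u)))) / 2) ^ 2 := by
        gcongr
        nlinarith [sq_nonneg ((a ^ 2 * stdPDF x / s) - (s * (b ^ 2 * stdPDF (x - u))))]
    _ = _ := by field_simp

lemma taylor_eq (g : ℝ → ℝ) (hg : ContDiff ℝ ∞ g) (n : ℕ) (x : ℝ) :
    g x - ∑ j ∈ Finset.range (n + 1), iteratedDeriv j g 0 / (j ! : ℝ) * x ^ j =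
      ∫ u in (0 : ℝ)..x, (x - u) ^ n / (n ! : ℝ) * iteratedDeriv (n + 1) g u := by
  rcases eq_or_ne 0 x with rfl | hx
  · simp [Finset.sum_range_succ']
  have hU : UniqueDiffOn ℝ (Set.uIcc 0 x) := uniqueDiffOn_uIcc hx
  have hd : ∀ k, ∀ u ∈ Set.uIcc 0 x, iteratedDerivWithin k g (Set.uIcc 0 x) u =
      iteratedDeriv k g u := fun k u hu =>
    iteratedDerivWithin_eq_iteratedDeriv hU (hg.contDiffAt.of_le (mod_cast le_top)) hu
  have h := taylor_integral_remainder (f := g) (x := x) (x₀ := 0) (n := n)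
    ((hg.of_le (mod_cast le_top)).contDiffOn)
  rw [taylor_within_apply] at h
  have h1 : ∑ k ∈ Finset.range (n + 1), ((k ! : ℝ)⁻¹ * (x - 0) ^ k) •
      iteratedDerivWithin k g (Set.uIcc 0 x) 0 =
      ∑ j ∈ Finset.range (n + 1), iteratedDeriv j g 0 / (j ! : ℝ) * x ^ j :=
    Finset.sum_congr rfl fun k _ => by
      rw [hd k 0 Set.left_mem_uIcc, sub_zero, smul_eq_mul]; ring
  rw [h1] at h
  rw [h]
  refine intervalIntegral.integral_congr fun u hu => ?_
  simp only [smul_eq_mul]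
  rw [hd _ u hu]

lemma enorm_taylor_remainder_le (g : ℝ → ℝ) (hg : ContDiff ℝ ∞ g) (n : ℕ) (x : ℝ) :
    ‖g x - ∑ j ∈ Finset.range (n + 1), iteratedDeriv j g 0 / (j ! : ℝ) * x ^ j‖ₑ ≤
      ∫⁻ u in Set.uIoc 0 x, ‖iteratedDeriv (n + 1) g u‖ₑ *
        ENNReal.ofReal (|x - u| ^ n / (n ! : ℝ)) := by
  rw [taylor_eq g hg n x, intervalIntegral.intervalIntegral_eq_integral_uIoc]
  have h1 : ‖(if 0 ≤ x then 1 else -1 : ℝ)‖ₑ = 1 := by split_ifs <;> simp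
  rw [smul_eq_mul, enorm_mul, h1, one_mul]
  refine (enorm_integral_le_lintegral_enorm _).trans_eq (lintegral_congr fun u => ?_)
  rw [enorm_mul, mul_comm]
  congr 1
  rw [Real.enorm_eq_ofReal_abs, abs_div, abs_pow, Nat.abs_cast]

/-- The majorant of `hermite_kernel_le`. -/
def kernelBound (m : ℕ) (x u : ℝ) : ℝ :=
  Real.exp (-u ^ 2 / 4) * (√(m ! : ℝ) / 2) *
    (hermiteFun m x * (hermiteFun m x * stdPDF x) / (m ! : ℝ) +
      Real.exp (2 * |x - u|) * stdPDF (x - u))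

lemma kernelBound_nonneg (m : ℕ) (x u : ℝ) : 0 ≤ kernelBound m x u := by
  have h1 := stdPDF_nonneg x
  have h2 := stdPDF_nonneg (x - u)
  rw [kernelBound, show hermiteFun m x * (hermiteFun m x * stdPDF x) =
    hermiteFun m x ^ 2 * stdPDF x by ring]
  positivity

lemma continuous_kernelBound (m : ℕ) : Continuous fun p : ℝ × ℝ => kernelBound m p.1 p.2 := by
  have h1 := continuous_hermiteFun m
  have h2 := continuous_stdPDF
  unfold kernelBound
  fun_prop

lemma lintegral_kernelBound_le (m : ℕ) (u : ℝ) :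
    ∫⁻ x, ENNReal.ofReal (kernelBound m x u) ≤
      ENNReal.ofReal (8 * √(m ! : ℝ) * Real.exp (-u ^ 2 / 4)) := by
  have hI1 : Integrable fun x => hermiteFun m x * (hermiteFun m x * stdPDF x) / (m ! : ℝ) :=
    (integrable_mul_hermiteFun_mul_stdPDF m (integrable_hermiteFun_mul_exp_neg m)).div_const _
  have hI2 : Integrable fun x => Real.exp (2 * |x - u|) * stdPDF (x - u) :=
    (integrable_exp_mul_abs_mul_stdPDF 2).comp_sub_right u
  have hI : Integrable fun x => kernelBound m x u := (hI1.add hI2).const_mul _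
  rw [← ofReal_integral_eq_lintegral_ofReal hI
    (Filter.Eventually.of_forall fun x => kernelBound_nonneg m x u)]
  apply ENNReal.ofReal_le_ofReal
  simp only [kernelBound]
  rw [integral_const_mul, integral_add hI1 hI2, integral_div, integral_hermiteFun_sq_mul_stdPDF,
    div_self (by positivity), integral_sub_right_eq_self (fun x => Real.exp (2 * |x|) * stdPDF x)]
  have h2 := integral_exp_mul_abs_mul_stdPDF_le 2
  have h3 : Real.exp (2 ^ 2 / 2) ≤ 7.4 := by
    have := Real.exp_one_lt_d9
    rw [show (2 : ℝ) ^ 2 / 2 = 1 + 1 by norm_num, Real.exp_add]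
    nlinarith [Real.exp_pos 1]
  calc Real.exp (-u ^ 2 / 4) * (√(m ! : ℝ) / 2) *
      (1 + ∫ x, Real.exp (2 * |x|) * stdPDF x)
      ≤ Real.exp (-u ^ 2 / 4) * (√(m ! : ℝ) / 2) * 16 := by gcongr; linarith
    _ = _ := by ring

/-- The truncated Hermite expansion at the centre is exact on polynomials of degree at most
`2N + 1`, so only the Taylor remainder of order `n + 1` contributes to its error. -/
theorem hermite_projection_error {g : ℝ → ℝ} (hg : ContDiff ℝ ∞ g) (N n : ℕ) (hn : n ≤ 2 * N + 1)
    (hint : ∀ j, Integrable fun t => iteratedDeriv j g t * Real.exp (-t ^ 2 / 4)) :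
    ‖(∑ k ∈ Finset.range (N + 1), heatCoeff k * ∫ t, iteratedDeriv (2 * k) g t * stdPDF t) - g 0‖ₑ ≤
      ∫⁻ u, ‖iteratedDeriv (n + 1) g u‖ₑ *
        ENNReal.ofReal (8 * (N + 1) * Real.exp (-u ^ 2 / 4)) := by
  set T : ℝ → ℝ := fun x => ∑ j ∈ Finset.range (n + 1), iteratedDeriv j g 0 / (j ! : ℝ) * x ^ j
    with hT
  have hgi : Integrable fun t => g t * Real.exp (-t ^ 2 / 4) := by simpa using hint 0
  have hTi : Integrable fun t => T t * Real.exp (-t ^ 2 / 4) := by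
    have : (fun t => T t * Real.exp (-t ^ 2 / 4)) = fun t => ∑ j ∈ Finset.range (n + 1),
        iteratedDeriv j g 0 / (j ! : ℝ) * (t ^ j * Real.exp (-t ^ 2 / 4)) := by
      funext t
      simp only [hT, Finset.sum_mul, mul_assoc]
    rw [this]
    exact integrable_finsetSum _ fun j _ => (integrable_pow_mul_exp_neg j).const_mul _
  -- exactness on the Taylor polynomial
  have hTsum : ∑ k ∈ Finset.range (N + 1), heatCoeff k *
      ∫ t, T t * (hermiteFun (2 * k) t * stdPDF t) = g 0 := by
    have h1 : ∀ k, ∫ t, T t * (hermiteFun (2 * k) t * stdPDF t) =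
        ∑ j ∈ Finset.range (n + 1), iteratedDeriv j g 0 / (j ! : ℝ) *
          ∫ t, t ^ j * (hermiteFun (2 * k) t * stdPDF t) := by
      intro k
      simp only [← integral_const_mul]
      rw [← integral_finsetSum _ fun j _ => (integrable_mul_hermiteFun_mul_stdPDF _
        (integrable_pow_mul_exp_neg j)).const_mul _]
      simp only [hT, Finset.sum_mul, mul_assoc]
    simp only [h1, Finset.mul_sum]
    rw [Finset.sum_comm]
    have h2 : ∀ j ∈ Finset.range (n + 1), ∑ k ∈ Finset.range (N + 1), heatCoeff k *
        (iteratedDeriv j g 0 / (j ! : ℝ) * ∫ t, t ^ j * (hermiteFun (2 * k) t * stdPDF t)) =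
        if j = 0 then g 0 else 0 := by
      intro j hj
      have hj' : j ≤ 2 * N + 1 := by have := Finset.mem_range.1 hj; omega
      have := integral_pow_mul_deltaKernel hj'
      calc _ = iteratedDeriv j g 0 / (j ! : ℝ) * ∑ k ∈ Finset.range (N + 1), heatCoeff k *
            ∫ t, t ^ j * (hermiteFun (2 * k) t * stdPDF t) := by
            rw [Finset.mul_sum]; exact Finset.sum_congr rfl fun k _ => by ring
        _ = _ := by
            rw [this]; split_ifs with h
            · subst h; simp
            · simp
    rw [Finset.sum_congr rfl h2]
    simp
  have hdiff : (∑ k ∈ Finset.range (N + 1), heatCoeff k *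
      ∫ t, iteratedDeriv (2 * k) g t * stdPDF t) - g 0 =
      ∑ k ∈ Finset.range (N + 1), heatCoeff k *
        ∫ t, (g t - T t) * (hermiteFun (2 * k) t * stdPDF t) := by
    conv_lhs => rw [← hTsum]
    rw [← Finset.sum_sub_distrib]
    refine Finset.sum_congr rfl fun k _ => ?_
    have h1 := integral_iteratedDeriv_mul_hermiteFun hg (2 * k) (fun j _ => hint j) 0
    simp only [hermiteFun_zero, one_mul, zero_add] at h1
    rw [h1, ← mul_sub, ← integral_sub (integrable_mul_hermiteFun_mul_stdPDF _ hgi)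
      (integrable_mul_hermiteFun_mul_stdPDF _ hTi)]
    simp only [sub_mul]
  have hmeas : Measurable fun u => ‖iteratedDeriv (n + 1) g u‖ₑ :=
    (hg.continuous_iteratedDeriv (n + 1) (mod_cast le_top)).measurable.enorm
  have hterm : ∀ m, ‖∫ t, (g t - T t) * (hermiteFun m t * stdPDF t)‖ₑ ≤
      ∫⁻ u, ‖iteratedDeriv (n + 1) g u‖ₑ *
        ENNReal.ofReal (8 * √(m ! : ℝ) * Real.exp (-u ^ 2 / 4)) := by
    intro m
    calc ‖∫ t, (g t - T t) * (hermiteFun m t * stdPDF t)‖ₑ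
        ≤ ∫⁻ x, ‖(g x - T x) * (hermiteFun m x * stdPDF x)‖ₑ := enorm_integral_le_lintegral_enorm _
      _ ≤ ∫⁻ x, ∫⁻ u, ‖iteratedDeriv (n + 1) g u‖ₑ * ENNReal.ofReal (kernelBound m x u) := by
          refine lintegral_mono fun x => ?_
          rw [enorm_mul, mul_comm]
          refine (mul_le_mul_right (enorm_taylor_remainder_le g hg n x) _).trans ?_
          rw [← lintegral_const_mul' _ _ enorm_ne_top]
          refine (setLIntegral_mono' measurableSet_uIoc fun u hu => ?_).trans
            (setLIntegral_le_lintegral _ _)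
          rw [mul_left_comm]
          refine mul_le_mul_right ?_ _
          rw [Real.enorm_eq_ofReal_abs, ← ENNReal.ofReal_mul (abs_nonneg _), abs_mul,
            abs_of_nonneg (stdPDF_nonneg x)]
          refine ENNReal.ofReal_le_ofReal (hermite_kernel_le m n x u ?_)
          rcases Set.mem_uIoc.1 hu with ⟨h1, h2⟩ | ⟨h1, h2⟩
          · exact mul_nonneg h1.le (by linarith)
          · exact mul_nonneg_of_nonpos_of_nonpos h2 (by linarith)
      _ = ∫⁻ u, ∫⁻ x, ‖iteratedDeriv (n + 1) g u‖ₑ * ENNReal.ofReal (kernelBound m x u) := by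
          rw [lintegral_lintegral_swap]
          exact ((hmeas.comp measurable_snd).mul
            (continuous_kernelBound m).measurable.ennreal_ofReal).aemeasurable
      _ ≤ _ := by
          refine lintegral_mono fun u => ?_
          rw [lintegral_const_mul' _ _ enorm_ne_top]
          exact mul_le_mul_right (lintegral_kernelBound_le m u) _
  rw [hdiff]
  refine (enorm_sum_le _ _).trans ?_
  have hk : ∀ k ∈ Finset.range (N + 1), ‖heatCoeff k *
      ∫ t, (g t - T t) * (hermiteFun (2 * k) t * stdPDF t)‖ₑ ≤
      ∫⁻ u, ‖iteratedDeriv (n + 1) g u‖ₑ * ENNReal.ofReal (8 * Real.exp (-u ^ 2 / 4)) := by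
    intro k _
    rw [enorm_mul]
    refine (mul_le_mul_right (hterm (2 * k)) _).trans ?_
    rw [← lintegral_const_mul' _ _ enorm_ne_top]
    refine lintegral_mono fun u => ?_
    rw [mul_left_comm]
    refine mul_le_mul_right ?_ _
    rw [Real.enorm_eq_ofReal_abs, ← ENNReal.ofReal_mul (abs_nonneg _)]
    apply ENNReal.ofReal_le_ofReal
    have := abs_heatCoeff_mul_sqrt_le k
    calc |heatCoeff k| * (8 * √((2 * k)! : ℝ) * Real.exp (-u ^ 2 / 4))
        = (|heatCoeff k| * √((2 * k)! : ℝ)) * (8 * Real.exp (-u ^ 2 / 4)) := by ring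
      _ ≤ 1 * (8 * Real.exp (-u ^ 2 / 4)) := by gcongr
      _ = _ := one_mul _
  refine (Finset.sum_le_sum hk).trans_eq ?_
  rw [Finset.sum_const, Finset.card_range, nsmul_eq_mul,
    ← lintegral_const_mul' _ _ (ENNReal.natCast_ne_top _)]
  refine lintegral_congr fun u => ?_
  rw [mul_left_comm, ← ENNReal.ofReal_natCast, ← ENNReal.ofReal_mul (by positivity)]
  push_cast
  ring_nf

/-! ### The signed kernel -/

lemma derivSum_nonneg (f : ℝ → ℝ) {c : ℝ} (hc : 0 < c) (n : ℕ) (x : ℝ) : 0 ≤ derivSum f c n x :=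
  Finset.sum_nonneg fun j _ => by positivity

lemma continuous_derivSum {f : ℝ → ℝ} (hf : ContDiff ℝ ∞ f) (c : ℝ) (n : ℕ) :
    Continuous (derivSum f c n) := by
  unfold derivSum
  exact continuous_finsetSum _ fun j _ =>
    ((hf.continuous_iteratedDeriv j (mod_cast le_top)).abs).div_const _

/-- The jet of `t ↦ f (t / τ)`. -/
def linkJet (f : ℝ → ℝ) (τ : ℝ) (M : ℕ) (x : ℝ) : Polynomial ℝ := jet (fun t => f (t / τ)) M x

lemma contDiff_link {f : ℝ → ℝ} (hf : ContDiff ℝ ∞ f) (τ : ℝ) :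
    ContDiff ℝ ∞ fun t => f (t / τ) := hf.comp (contDiff_id.div_const τ)

lemma iteratedDeriv_link {f : ℝ → ℝ} (hf : ContDiff ℝ ∞ f) (τ : ℝ) (j : ℕ) (x : ℝ) :
    iteratedDeriv j (fun t => f (t / τ)) x = iteratedDeriv j f (x / τ) / τ ^ j := by
  have h := congrFun (iteratedDeriv_comp_const_mul (n := j) (hf.of_le (mod_cast le_top)) τ⁻¹) x
  simp only [inv_mul_eq_div] at h
  rw [h, inv_pow, inv_mul_eq_div]

lemma abs_coeff_linkJet_pow_le {f : ℝ → ℝ} (hf : ContDiff ℝ ∞ f) {τ c : ℝ} (hτ : 0 < τ)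
    (hc : 0 < c) (M l n : ℕ) (x : ℝ) :
    |((linkJet f τ M x) ^ l).coeff n| ≤ (c / τ) ^ n * derivSum f c M (x / τ) ^ l := by
  refine abs_coeff_pow_le _ M (fun j hj => ?_) _ _ (by positivity) (le_of_eq ?_) l n
  · rw [linkJet, coeff_jet, if_neg (by simp; omega)]
  · rw [derivSum, Finset.sum_range_succ']
    have h0 : (linkJet f τ M x).coeff 0 = 0 := by rw [linkJet, coeff_jet]; simp
    rw [h0, abs_zero, zero_div, add_zero, Finset.range_eq_Ico,
      Finset.sum_Ico_add' (fun j => |(linkJet f τ M x).coeff j| / (c / τ) ^ j) 0 M 1]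
    refine Finset.sum_congr (by ext j; simp) fun j hj => ?_
    rw [linkJet, coeff_jet, if_pos hj, iteratedDeriv_link hf, abs_div, abs_div, Nat.abs_cast,
      abs_pow, abs_of_pos hτ, div_pow]
    field_simp

lemma continuous_coeff_linkJet_pow {f : ℝ → ℝ} (hf : ContDiff ℝ ∞ f) (τ : ℝ) (M l n : ℕ) :
    Continuous fun x => ((linkJet f τ M x) ^ l).coeff n := by
  induction l generalizing n with
  | zero => simpa using continuous_const
  | succ l ih =>
    simp only [pow_succ, Polynomial.coeff_mul]
    refine continuous_finsetSum _ fun p _ => (ih p.1).mul ?_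
    simp only [linkJet, coeff_jet]
    split_ifs
    · exact ((contDiff_link hf τ).continuous_iteratedDeriv _ (mod_cast le_top)).div_const _
    · exact continuous_const

lemma iteratedDeriv_stdPDF_sub (y : ℝ) (l : ℕ) (w : ℝ) :
    iteratedDeriv l (fun w => stdPDF (y - w)) w = hermiteFun l (y - w) * stdPDF (y - w) := by
  induction l generalizing w with
  | zero => simp
  | succ l ih =>
    rw [iteratedDeriv_succ, funext ih]
    have h := (hasDerivAt_hermiteFun_mul_stdPDF l (y - w)).comp w
      ((hasDerivAt_id' w).const_sub y)
    simpa [Function.comp_def] using h.deriv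

lemma targetDensity_eq (f : ℝ → ℝ) (τ y t : ℝ) :
    targetDensity f τ y t = stdPDF (y - f (t / τ)) := gaussianPDFReal_one_eq _ _

lemma contDiff_targetDensity {f : ℝ → ℝ} (hf : ContDiff ℝ ∞ f) (τ y : ℝ) :
    ContDiff ℝ ∞ fun t => targetDensity f τ y t := by
  simp only [targetDensity_eq]
  exact contDiff_stdPDF.comp (contDiff_const.sub (contDiff_link hf τ))

lemma iteratedDeriv_targetDensity {f : ℝ → ℝ} (hf : ContDiff ℝ ∞ f) (τ y : ℝ) {n M : ℕ}
    (hn : n ≤ M) (x : ℝ) :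
    iteratedDeriv n (fun t => targetDensity f τ y t) x =
      n ! * ∑ l ∈ Finset.range (n + 1), hermiteFun l (y - f (x / τ)) * stdPDF (y - f (x / τ)) /
        (l ! : ℝ) * ((linkJet f τ M x) ^ l).coeff n := by
  simp only [targetDensity_eq]
  rw [iteratedDeriv_comp_eq (contDiff_link hf τ) M x n hn (fun w => stdPDF (y - w))
    (contDiff_stdPDF.comp (contDiff_const.sub contDiff_id))]
  simp only [iteratedDeriv_stdPDF_sub, linkJet]

lemma continuous_iteratedDeriv_targetDensity {f : ℝ → ℝ} (hf : ContDiff ℝ ∞ f) (τ : ℝ) (n : ℕ) :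
    Continuous fun p : ℝ × ℝ => iteratedDeriv n (fun t => targetDensity f τ p.1 t) p.2 := by
  simp only [iteratedDeriv_targetDensity hf τ _ le_rfl]
  have h1 := continuous_stdPDF
  have h2 := fun l => continuous_hermiteFun l
  have h3 : Continuous fun p : ℝ × ℝ => p.1 - f (p.2 / τ) :=
    continuous_fst.sub ((contDiff_link hf τ).continuous.comp continuous_snd)
  refine continuous_const.mul (continuous_finsetSum _ fun l _ => ?_)
  exact ((((h2 l).comp h3).mul (h1.comp h3)).div_const _).mul
    ((continuous_coeff_linkJet_pow hf τ n l n).comp continuous_snd)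

/-- Faà di Bruno's formula for `v`, with the coefficients of the powers of the jet bounded through
`derivSum`. -/
lemma abs_iteratedDeriv_targetDensity_le {f : ℝ → ℝ} (hf : ContDiff ℝ ∞ f) {τ c : ℝ} (hτ : 0 < τ)
    (hc : 0 < c) (y : ℝ) {n M : ℕ} (hn : n ≤ M) (x : ℝ) :
    |iteratedDeriv n (fun t => targetDensity f τ y t) x| ≤
      n ! * (c / τ) ^ n * stdPDF (y - f (x / τ)) * ∑ l ∈ Finset.range (n + 1),
        |hermiteFun l (y - f (x / τ))| / (l ! : ℝ) * derivSum f c M (x / τ) ^ l := by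
  rw [iteratedDeriv_targetDensity hf τ y hn, abs_mul, Nat.abs_cast, mul_assoc, mul_assoc]
  gcongr
  refine (Finset.abs_sum_le_sum_abs _ _).trans ?_
  rw [Finset.mul_sum, Finset.mul_sum]
  refine Finset.sum_le_sum fun l _ => ?_
  rw [abs_mul, abs_div, abs_mul, Nat.abs_cast, abs_of_nonneg (stdPDF_nonneg _)]
  refine (mul_le_mul_of_nonneg_left (abs_coeff_linkJet_pow_le hf hτ hc M l n x) ?_).trans_eq ?_
  · have := stdPDF_nonneg (y - f (x / τ))
    positivity
  · ring

lemma abs_iteratedDeriv_targetDensity_le_exp {f : ℝ → ℝ} (hf : ContDiff ℝ ∞ f) {τ c : ℝ}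
    (hτ : 0 < τ) (hc : 0 < c) (y : ℝ) (n : ℕ) (x : ℝ) :
    |iteratedDeriv n (fun t => targetDensity f τ y t) x| ≤
      n ! * (c / τ) ^ n * (1 + derivSum f c n (x / τ) ^ n) *
        (Real.exp (|y - f (x / τ)| + 1 / 2) * stdPDF (y - f (x / τ))) := by
  refine (abs_iteratedDeriv_targetDensity_le hf hτ hc y le_rfl x).trans ?_
  have ha := derivSum_nonneg f hc n (x / τ)
  set a := derivSum f c n (x / τ)
  set z := y - f (x / τ)
  have hz := stdPDF_nonneg z
  have h1 : ∑ l ∈ Finset.range (n + 1), |hermiteFun l z| / (l ! : ℝ) * a ^ l ≤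
      Real.exp (|z| + 1 / 2) * (1 + a ^ n) := by
    calc _ ≤ ∑ l ∈ Finset.range (n + 1), |hermiteFun l z| / (l ! : ℝ) * (1 + a ^ n) := by
          refine Finset.sum_le_sum fun l hl => ?_
          gcongr
          have hl' : l ≤ n := by have := Finset.mem_range.1 hl; omega
          rcases le_total a 1 with h | h
          · linarith [pow_le_one₀ ha h (n := l), pow_nonneg ha n]
          · linarith [pow_le_pow_right₀ h hl']
      _ ≤ _ := by
          rw [← Finset.sum_mul]
          gcongr
          exact sum_abs_hermiteFun_le_exp _ z
  calc _ ≤ n ! * (c / τ) ^ n * stdPDF z * (Real.exp (|z| + 1 / 2) * (1 + a ^ n)) := by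
        gcongr
    _ = _ := by ring

lemma lintegral_exp_mul_abs_sub_mul_stdPDF_le (c m : ℝ) :
    ∫⁻ y, ENNReal.ofReal (Real.exp (c * |y - m|) * stdPDF (y - m)) ≤
      ENNReal.ofReal (2 * Real.exp (c ^ 2 / 2)) := by
  rw [lintegral_sub_right_eq_self
    (fun y => ENNReal.ofReal (Real.exp (c * |y|) * stdPDF y)) m,
    ← ofReal_integral_eq_lintegral_ofReal (integrable_exp_mul_abs_mul_stdPDF c)
    (Filter.Eventually.of_forall fun x => mul_nonneg (Real.exp_pos _).le (stdPDF_nonneg x))]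
  exact ENNReal.ofReal_le_ofReal (integral_exp_mul_abs_mul_stdPDF_le c)

lemma lintegral_iteratedDeriv_targetDensity_le {f : ℝ → ℝ} (hf : ContDiff ℝ ∞ f) {τ c : ℝ}
    (hτ : 0 < τ) (hc : 0 < c) (n : ℕ) (x : ℝ) :
    ∫⁻ y, ‖iteratedDeriv n (fun t => targetDensity f τ y t) x‖ₑ ≤
      ENNReal.ofReal (6 * (n ! * (c / τ) ^ n) * (1 + derivSum f c n (x / τ) ^ n)) := by
  have ha := derivSum_nonneg f hc n (x / τ)
  set K : ℝ := n ! * (c / τ) ^ n * (1 + derivSum f c n (x / τ) ^ n) with hK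
  have hK0 : 0 ≤ K := by positivity
  calc ∫⁻ y, ‖iteratedDeriv n (fun t => targetDensity f τ y t) x‖ₑ
      ≤ ∫⁻ y, ENNReal.ofReal (K * Real.exp (1 / 2)) *
          ENNReal.ofReal (Real.exp (1 * |y - f (x / τ)|) * stdPDF (y - f (x / τ))) := by
        refine lintegral_mono fun y => ?_
        rw [Real.enorm_eq_ofReal_abs, ← ENNReal.ofReal_mul (by positivity)]
        refine ENNReal.ofReal_le_ofReal
          ((abs_iteratedDeriv_targetDensity_le_exp hf hτ hc y n x).trans_eq ?_)
        rw [one_mul, Real.exp_add]; ring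
    _ ≤ ENNReal.ofReal (K * Real.exp (1 / 2)) * ENNReal.ofReal (2 * Real.exp (1 ^ 2 / 2)) := by
        rw [lintegral_const_mul' _ _ ENNReal.ofReal_ne_top]
        exact mul_le_mul_right (lintegral_exp_mul_abs_sub_mul_stdPDF_le 1 _) _
    _ ≤ _ := by
        rw [← ENNReal.ofReal_mul (by positivity)]
        apply ENNReal.ofReal_le_ofReal
        have h1 : Real.exp (1 / 2) * Real.exp (1 ^ 2 / 2) ≤ 3 := by
          rw [← Real.exp_add]; norm_num
          linarith [Real.exp_one_lt_d9]
        calc K * Real.exp (1 / 2) * (2 * Real.exp (1 ^ 2 / 2))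
            = 2 * K * (Real.exp (1 / 2) * Real.exp (1 ^ 2 / 2)) := by ring
          _ ≤ 2 * K * 3 := by gcongr
          _ = _ := by rw [hK]; ring

lemma signedKernel_eq (v : ℝ → ℝ → ℝ) (N : ℕ) (y x : ℝ) :
    signedKernel v N y x = ∑ k ∈ Finset.range (N + 1),
      heatCoeff k * iteratedDeriv (2 * k) (fun t => v y t) x := rfl

lemma continuous_signedKernel {f : ℝ → ℝ} (hf : ContDiff ℝ ∞ f) (τ : ℝ) (N : ℕ) :
    Continuous fun p : ℝ × ℝ => signedKernel (targetDensity f τ) N p.1 p.2 := by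
  simp only [signedKernel_eq]
  exact continuous_finsetSum _ fun k _ =>
    continuous_const.mul (continuous_iteratedDeriv_targetDensity hf τ (2 * k))

lemma integrable_iteratedDeriv_targetDensity {f : ℝ → ℝ} (hf : ContDiff ℝ ∞ f) (τ : ℝ) (n : ℕ)
    (x : ℝ) : Integrable fun y => iteratedDeriv n (fun t => targetDensity f τ y t) x := by
  simp only [iteratedDeriv_targetDensity hf τ _ le_rfl]
  refine (integrable_finsetSum _ fun l _ => ?_).const_mul _
  exact (((integrable_hermiteFun_mul_stdPDF l).comp_sub_right (f (x / τ))).div_const _).mul_const _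

lemma integral_iteratedDeriv_targetDensity {f : ℝ → ℝ} (hf : ContDiff ℝ ∞ f) (τ : ℝ) (n : ℕ)
    (x : ℝ) : ∫ y, iteratedDeriv n (fun t => targetDensity f τ y t) x = if n = 0 then 1 else 0 := by
  simp only [iteratedDeriv_targetDensity hf τ _ le_rfl]
  have hI : ∀ l, Integrable fun y => hermiteFun l (y - f (x / τ)) * stdPDF (y - f (x / τ)) /
      (l ! : ℝ) * ((linkJet f τ n x) ^ l).coeff n := fun l =>
    (((integrable_hermiteFun_mul_stdPDF l).comp_sub_right (f (x / τ))).div_const _).mul_const _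
  rw [integral_const_mul, integral_finsetSum _ fun l _ => hI l, Finset.sum_range_succ']
  have h1 : ∀ l, ∫ y, hermiteFun (l + 1) (y - f (x / τ)) * stdPDF (y - f (x / τ)) /
      ((l + 1)! : ℝ) * ((linkJet f τ n x) ^ (l + 1)).coeff n = 0 := fun l => by
    rw [integral_mul_const, integral_div,
      integral_sub_right_eq_self (fun y => hermiteFun (l + 1) y * stdPDF y),
      integral_hermiteFun_succ_mul_stdPDF, zero_div, zero_mul]
  simp only [h1, Finset.sum_const_zero, zero_add, hermiteFun_zero, one_mul, pow_zero,
    Polynomial.coeff_one]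
  rw [integral_mul_const, integral_div, integral_sub_right_eq_self (fun y => stdPDF y),
    integral_stdPDF]
  split_ifs with h
  · subst h; simp
  · simp

lemma integrable_signedKernel {f : ℝ → ℝ} (hf : ContDiff ℝ ∞ f) (τ : ℝ) (N : ℕ) (x : ℝ) :
    Integrable fun y => signedKernel (targetDensity f τ) N y x := by
  simp only [signedKernel_eq]
  exact integrable_finsetSum _ fun k _ =>
    (integrable_iteratedDeriv_targetDensity hf τ (2 * k) x).const_mul _

lemma integral_signedKernel {f : ℝ → ℝ} (hf : ContDiff ℝ ∞ f) (τ : ℝ) (N : ℕ) (x : ℝ) :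
    ∫ y, signedKernel (targetDensity f τ) N y x = 1 := by
  simp only [signedKernel_eq]
  rw [integral_finsetSum _ fun k _ =>
    (integrable_iteratedDeriv_targetDensity hf τ (2 * k) x).const_mul _]
  simp only [integral_const_mul, integral_iteratedDeriv_targetDensity hf]
  rw [Finset.sum_range_succ']
  simp [heatCoeff]

lemma abs_heatCoeff_mul_factorial_le {k N : ℕ} (hk : k ≤ N) :
    |heatCoeff k| * ((2 * k)! : ℝ) ≤ (2 * N : ℝ) ^ k := by
  induction k with
  | zero => simp [heatCoeff]
  | succ k ih =>
    have h := heatCoeff_succ k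
    have h2 : (2 * k + 2 : ℝ) * |heatCoeff (k + 1)| = |heatCoeff k| := by
      have h3 := congrArg abs h
      rwa [abs_mul, abs_neg, abs_of_nonneg (by positivity : (0 : ℝ) ≤ 2 * k + 2)] at h3
    have hkN : (2 * k + 1 : ℝ) ≤ 2 * N := by
      have : ((k + 1 : ℕ) : ℝ) ≤ N := by exact_mod_cast hk
      push_cast at this; linarith
    rw [show 2 * (k + 1) = 2 * k + 1 + 1 by ring, Nat.factorial_succ, Nat.factorial_succ]
    push_cast
    calc |heatCoeff (k + 1)| * ((2 * k + 1 + 1) * ((2 * k + 1) * ((2 * k)! : ℝ)))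
        = (2 * k + 1) * (((2 * k + 2) * |heatCoeff (k + 1)|) * ((2 * k)! : ℝ)) := by ring
      _ = (2 * k + 1) * (|heatCoeff k| * ((2 * k)! : ℝ)) := by rw [h2]
      _ ≤ (2 * N) * (2 * N : ℝ) ^ k := by
          gcongr
          exact ih (by omega)
      _ = _ := by ring

/-- Bound on the `k`-th term of the signed kernel. The generating function of the Hermite
polynomials is used at `1/√N`: a power `A^l` with `l ≤ 2k` and `A ≥ 1` is at most
`(A √N)^(2k) (1/√N)^l`. -/
lemma abs_signedKernel_term_le {f : ℝ → ℝ} (hf : ContDiff ℝ ∞ f) {τ c A : ℝ} (hτ : 0 < τ)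
    (hc : 0 < c) {N : ℕ} (hN : 1 ≤ N) {x : ℝ} (hA : 1 ≤ A)
    (hxA : derivSum f c (2 * N) (x / τ) ≤ A) (y : ℝ) {k : ℕ} (hk : k ≤ N) :
    |heatCoeff k * iteratedDeriv (2 * k) (fun t => targetDensity f τ y t) x| ≤
      (2 * N ^ 2 * c ^ 2 * A ^ 2 / τ ^ 2) ^ k *
        (Real.exp (1 / √N * |y - f (x / τ)| + 1 / 2) * stdPDF (y - f (x / τ))) := by
  have hN' : (1 : ℝ) ≤ N := by exact_mod_cast hN
  have hs1 : 1 ≤ √(N : ℝ) := Real.one_le_sqrt.2 hN'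
  have hs2 : √(N : ℝ) ^ 2 = N := Real.sq_sqrt (by positivity)
  have ha := derivSum_nonneg f hc (2 * N) (x / τ)
  set a := derivSum f c (2 * N) (x / τ)
  set z := y - f (x / τ)
  set s := √(N : ℝ)
  have hz := stdPDF_nonneg z
  have h1 : ∑ l ∈ Finset.range (2 * k + 1), |hermiteFun l z| / (l ! : ℝ) * a ^ l ≤
      (A * s) ^ (2 * k) * Real.exp (1 / s * |z| + 1 / 2) := by
    calc _ ≤ ∑ l ∈ Finset.range (2 * k + 1), (A * s) ^ (2 * k) *
          (|hermiteFun l z| / (l ! : ℝ) * (1 / s) ^ l) := by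
          refine Finset.sum_le_sum fun l hl => ?_
          have hl' : l ≤ 2 * k := by have := Finset.mem_range.1 hl; omega
          have h2 : a ^ l ≤ (A * s) ^ (2 * k) * (1 / s) ^ l := by
            calc a ^ l ≤ A ^ l := by gcongr
              _ = (A * s) ^ l * (1 / s) ^ l := by rw [← mul_pow]; field_simp
              _ ≤ (A * s) ^ (2 * k) * (1 / s) ^ l := by
                  gcongr
                  exact one_le_mul_of_one_le_of_one_le hA hs1
          calc _ ≤ |hermiteFun l z| / (l ! : ℝ) * ((A * s) ^ (2 * k) * (1 / s) ^ l) := by gcongr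
            _ = _ := by ring
      _ ≤ _ := by
          rw [← Finset.mul_sum]
          gcongr
          refine (sum_abs_hermiteFun_le _ z (1 / s) (by positivity)).trans ?_
          gcongr
          apply pow_le_one₀ (by positivity)
          rw [div_le_one (by positivity)]; exact hs1
  rw [abs_mul]
  calc _ ≤ |heatCoeff k| * (((2 * k)! : ℝ) * (c / τ) ^ (2 * k) * stdPDF z *
        ((A * s) ^ (2 * k) * Real.exp (1 / s * |z| + 1 / 2))) := by
        refine mul_le_mul_of_nonneg_left ((abs_iteratedDeriv_targetDensity_le hf hτ hc y
          (show 2 * k ≤ 2 * N by omega) x).trans ?_) (abs_nonneg _)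
        gcongr
    _ = (|heatCoeff k| * ((2 * k)! : ℝ)) * ((c / τ) ^ (2 * k) * (A * s) ^ (2 * k)) *
        (Real.exp (1 / s * |z| + 1 / 2) * stdPDF z) := by ring
    _ ≤ (2 * N : ℝ) ^ k * ((c / τ) ^ (2 * k) * (A * s) ^ (2 * k)) *
        (Real.exp (1 / s * |z| + 1 / 2) * stdPDF z) := by
        gcongr
        exact abs_heatCoeff_mul_factorial_le hk
    _ = _ := by
        rw [← mul_pow, pow_mul, ← mul_pow]
        congr 2
        rw [mul_pow, mul_pow, hs2, div_pow]
        ring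

lemma sum_range_pow_le {q : ℝ} (hq0 : 0 ≤ q) (hq : q ≤ 1 / 5000) (n : ℕ) :
    ∑ k ∈ Finset.range n, q ^ k ≤ 5000 / 4999 := by
  have h1 : ∑ k ∈ Finset.range n, q ^ k ≤ ∑ k ∈ Finset.range n, (1 / 5000 : ℝ) ^ k :=
    Finset.sum_le_sum fun k _ => by gcongr
  refine h1.trans ?_
  rw [geom_sum_eq (by norm_num)]
  have : (0 : ℝ) < (1 / 5000) ^ n := by positivity
  rw [div_le_iff_of_neg (by norm_num)]
  linarith

/-! ### The negative part of the signed kernel -/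

/-- A real number `L ≥ 1` that bounds both suprema of the link function, together with the lower
bound on `τ`, the universal constant being `10^4`. -/
structure LinkBound (f : ℝ → ℝ) (c : ℝ) (N : ℕ) (τ L : ℝ) : Prop where
  smooth : ContDiff ℝ ∞ f
  pos : 0 < c
  τ_pos : 0 < τ
  one_le_N : 1 ≤ N
  one_le : 1 ≤ L
  inner : ∀ x, |x| ≤ 1 → derivSum f c (2 * N) x ≤ L
  outer : ∀ x, 1 ≤ |x| →
    derivSum f c (2 * N) x * Real.exp (-(τ ^ 2 * x ^ 2 / (8 * (2 * N : ℕ)))) ≤ L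
  scale : 10 ^ 4 * (max c 1 ^ 4 * L ^ 2 * (N : ℝ) ^ 2) ≤ τ ^ 2

namespace LinkBound

variable {f : ℝ → ℝ} {c τ L : ℝ} {N : ℕ}

lemma ratio_le (h : LinkBound f c N τ L) : 2 * N ^ 2 * c ^ 2 * L ^ 2 / τ ^ 2 ≤ 1 / 5000 := by
  have h1 : c ^ 2 ≤ max c 1 ^ 4 := by
    calc c ^ 2 ≤ max c 1 ^ 2 := by
          have := h.pos.le
          gcongr
          exact le_max_left _ _
      _ ≤ max c 1 ^ 4 := pow_le_pow_right₀ (le_max_right _ _) (by norm_num)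
  have hτ := h.τ_pos
  rw [div_le_div_iff₀ (by positivity) (by norm_num)]
  have h2 : (c ^ 2) * (L ^ 2 * (N : ℝ) ^ 2) ≤ max c 1 ^ 4 * (L ^ 2 * (N : ℝ) ^ 2) := by gcongr
  nlinarith [h.scale]

lemma sqrt_bound (h : LinkBound f c N τ L) : 1 / √(N : ℝ) ≤ 1 := by
  have : 1 ≤ √(N : ℝ) := Real.one_le_sqrt.2 (by exact_mod_cast h.one_le_N)
  rw [div_le_one (by positivity)]; exact this

/-- The leading term of the signed kernel is `v` itself; the others form a geometric series. -/
lemma abs_signedKernel_sub_le (h : LinkBound f c N τ L) {x : ℝ} (hx : |x| ≤ τ) (y : ℝ) :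
    |signedKernel (targetDensity f τ) N y x - stdPDF (y - f (x / τ))| ≤
      Real.exp (-2) * (Real.exp (1 / √N * |y - f (x / τ)|) * stdPDF (y - f (x / τ))) := by
  have hτ := h.τ_pos
  have hxτ : |x / τ| ≤ 1 := by rw [abs_div, abs_of_pos hτ, div_le_one hτ]; exact hx
  have ht : ∀ k ≤ N, _ := fun k hk =>
    abs_signedKernel_term_le h.smooth hτ h.pos h.one_le_N (x := x) h.one_le (h.inner _ hxτ) y hk
  have hq := h.ratio_le
  set q := 2 * N ^ 2 * c ^ 2 * L ^ 2 / τ ^ 2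
  have hq0 : 0 ≤ q := by positivity
  set z := y - f (x / τ)
  have hz := stdPDF_nonneg z
  have h0 : heatCoeff 0 * iteratedDeriv (2 * 0) (fun t => targetDensity f τ y t) x = stdPDF z := by
    simp [heatCoeff, targetDensity_eq, z]
  rw [signedKernel_eq, Finset.sum_range_succ', h0, add_sub_cancel_right]
  calc _ ≤ ∑ k ∈ Finset.range N, q ^ (k + 1) * (Real.exp (1 / √N * |z| + 1 / 2) * stdPDF z) :=
        (Finset.abs_sum_le_sum_abs _ _).trans
          (Finset.sum_le_sum fun k hk => ht (k + 1) (by have := Finset.mem_range.1 hk; omega))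
    _ = (q * ∑ k ∈ Finset.range N, q ^ k) * (Real.exp (1 / √N * |z| + 1 / 2) * stdPDF z) := by
        rw [Finset.mul_sum, ← Finset.sum_mul]
        simp only [pow_succ, mul_comm]
    _ ≤ (1 / 5000 * (5000 / 4999)) * (Real.exp (1 / √N * |z| + 1 / 2) * stdPDF z) := by
        gcongr
        exact sum_range_pow_le hq0 hq N
    _ ≤ _ := by
        rw [Real.exp_add]
        have h3 : 1 / 5000 * (5000 / 4999) * Real.exp (1 / 2) ≤ Real.exp (-2) := by
          have h4 : Real.exp (1 / 2) ≤ Real.exp (-2) * Real.exp 3 := by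
            rw [← Real.exp_add]; gcongr; norm_num
          have h5 : Real.exp 3 ≤ 27 := by
            have := Real.exp_one_lt_d9
            rw [show (3 : ℝ) = ((3 : ℕ) : ℝ) * 1 by norm_num, Real.exp_nat_mul]
            calc Real.exp 1 ^ 3 ≤ 3 ^ 3 := by gcongr; linarith
              _ = 27 := by norm_num
          nlinarith [Real.exp_pos (-2)]
        calc _ = (1 / 5000 * (5000 / 4999) * Real.exp (1 / 2)) *
              (Real.exp (1 / √N * |z|) * stdPDF z) := by ring
          _ ≤ _ := by gcongr

/-- For `|x| ≥ τ` the bound on `derivSum` at `x/τ` is worse by the factor `e^{x²/(16N)}`, which is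
raised to a power of at most `2N`. -/
lemma abs_signedKernel_le (h : LinkBound f c N τ L) {x : ℝ} (hx : τ ≤ |x|) (y : ℝ) :
    |signedKernel (targetDensity f τ) N y x| ≤
      2 * Real.exp (x ^ 2 / 8) *
        (Real.exp (1 / √N * |y - f (x / τ)|) * stdPDF (y - f (x / τ))) := by
  have hτ := h.τ_pos
  have hN : (1 : ℝ) ≤ N := by exact_mod_cast h.one_le_N
  have hxτ : 1 ≤ |x / τ| := by rw [abs_div, abs_of_pos hτ, le_div_iff₀ hτ]; simpa using hx
  set w := Real.exp (x ^ 2 / (16 * N)) with hw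
  have hw1 : 1 ≤ w := Real.one_le_exp (by positivity)
  have hA : derivSum f c (2 * N) (x / τ) ≤ L * w := by
    have h1 := h.outer _ hxτ
    have h2 : Real.exp (-(τ ^ 2 * (x / τ) ^ 2 / (8 * (2 * N : ℕ)))) = w⁻¹ := by
      rw [hw, ← Real.exp_neg]
      congr 1
      push_cast
      field_simp
      ring
    rw [h2] at h1
    exact (mul_inv_le_iff₀ (by positivity)).1 h1
  have ht : ∀ k ≤ N, _ := fun k hk =>
    abs_signedKernel_term_le h.smooth hτ h.pos h.one_le_N (x := x)
      (one_le_mul_of_one_le_of_one_le h.one_le hw1) hA y hk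
  have hq := h.ratio_le
  have hqw : 2 * N ^ 2 * c ^ 2 * (L * w) ^ 2 / τ ^ 2 =
      (2 * N ^ 2 * c ^ 2 * L ^ 2 / τ ^ 2) * w ^ 2 := by ring
  rw [hqw] at ht
  set q := 2 * N ^ 2 * c ^ 2 * L ^ 2 / τ ^ 2
  have hq0 : 0 ≤ q := by positivity
  set z := y - f (x / τ)
  have hz := stdPDF_nonneg z
  have hwk : ∀ k ≤ N, (w ^ 2) ^ k ≤ Real.exp (x ^ 2 / 8) := by
    intro k hk
    calc (w ^ 2) ^ k ≤ (w ^ 2) ^ N := pow_le_pow_right₀ (one_le_pow₀ hw1) hk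
      _ = Real.exp (x ^ 2 / 8) := by
          rw [← pow_mul, hw, ← Real.exp_nat_mul]
          congr 1
          push_cast
          field_simp
          ring
  rw [signedKernel_eq]
  calc _ ≤ ∑ k ∈ Finset.range (N + 1), q ^ k *
          (Real.exp (x ^ 2 / 8) * (Real.exp (1 / √N * |z| + 1 / 2) * stdPDF z)) := by
        refine (Finset.abs_sum_le_sum_abs _ _).trans (Finset.sum_le_sum fun k hk => ?_)
        have hk' : k ≤ N := by have := Finset.mem_range.1 hk; omega
        refine (ht k hk').trans ?_
        rw [mul_pow, mul_assoc]
        gcongr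
        exact hwk k hk'
    _ ≤ 5000 / 4999 * (Real.exp (x ^ 2 / 8) * (Real.exp (1 / √N * |z| + 1 / 2) * stdPDF z)) := by
        rw [← Finset.sum_mul]
        gcongr
        exact sum_range_pow_le hq0 hq _
    _ ≤ _ := by
        rw [Real.exp_add]
        have h3 : 5000 / 4999 * Real.exp (1 / 2) ≤ 2 := by
          have h4 : Real.exp (1 / 2) ^ 2 = Real.exp 1 := by
            rw [← Real.exp_nat_mul]; norm_num
          nlinarith [Real.exp_one_lt_d9, Real.exp_pos (1 / 2)]
        calc _ = (5000 / 4999 * Real.exp (1 / 2)) *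
              (Real.exp (x ^ 2 / 8) * (Real.exp (1 / √N * |z|) * stdPDF z)) := by ring
          _ ≤ 2 * (Real.exp (x ^ 2 / 8) * (Real.exp (1 / √N * |z|) * stdPDF z)) := by gcongr
          _ = _ := by ring

/-- Where the signed kernel is negative, its relative deviation from `v` is at least one, so that
deviation may be raised to the power `N`. -/
lemma lintegral_neg_signedKernel_le (h : LinkBound f c N τ L) {x : ℝ} (hx : |x| ≤ τ) :
    ∫⁻ y, ENNReal.ofReal (-signedKernel (targetDensity f τ) N y x) ≤
      ENNReal.ofReal (2 * Real.exp (-N)) := by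
  have hN : (0 : ℝ) < N := by exact_mod_cast h.one_le_N
  have hs : √(N : ℝ) ^ 2 = N := Real.sq_sqrt hN.le
  have hs0 : 0 < √(N : ℝ) := Real.sqrt_pos.2 hN
  have hpt : ∀ y, -signedKernel (targetDensity f τ) N y x ≤ Real.exp (-2 * N) *
      (Real.exp (√N * |y - f (x / τ)|) * stdPDF (y - f (x / τ))) := by
    intro y
    have h1 := h.abs_signedKernel_sub_le hx y
    set S := signedKernel (targetDensity f τ) N y x
    set z := y - f (x / τ)
    have hz := stdPDF_pos z
    rcases le_or_gt 0 S with hS | hS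
    · exact (neg_nonpos.2 hS).trans (mul_nonneg (Real.exp_pos _).le
        (mul_nonneg (Real.exp_pos _).le hz.le))
    have h2 : -S + stdPDF z ≤ Real.exp (-2 + 1 / √N * |z|) * stdPDF z := by
      rw [Real.exp_add, mul_assoc]
      refine le_trans ?_ h1
      rw [abs_sub_comm]
      exact (le_of_eq (by ring)).trans (le_abs_self _)
    -- `S < 0` forces the relative deviation `exp (-2 + |z| / √N)` to be at least one
    have h3 : 0 ≤ -2 + 1 / √N * |z| := by
      by_contra! hneg
      have := Real.exp_le_one_iff.2 hneg.le
      nlinarith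
    calc -S ≤ Real.exp (-2 + 1 / √N * |z|) * stdPDF z := by linarith
      _ ≤ Real.exp (N * (-2 + 1 / √N * |z|)) * stdPDF z := by
          gcongr
          have : (1 : ℝ) ≤ N := by exact_mod_cast h.one_le_N
          nlinarith
      _ = _ := by
          rw [← mul_assoc, ← Real.exp_add]
          congr 2
          have : (N : ℝ) * (1 / √N) = √N := by field_simp; exact hs.symm
          linear_combination |z| * this
  calc _ ≤ ∫⁻ y, ENNReal.ofReal (Real.exp (-2 * N)) *
        ENNReal.ofReal (Real.exp (√N * |y - f (x / τ)|) * stdPDF (y - f (x / τ))) := by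
        refine lintegral_mono fun y => ?_
        rw [← ENNReal.ofReal_mul (Real.exp_pos _).le]
        exact ENNReal.ofReal_le_ofReal (hpt y)
    _ ≤ ENNReal.ofReal (Real.exp (-2 * N)) * ENNReal.ofReal (2 * Real.exp (√N ^ 2 / 2)) := by
        rw [lintegral_const_mul' _ _ ENNReal.ofReal_ne_top]
        exact mul_le_mul_right (lintegral_exp_mul_abs_sub_mul_stdPDF_le _ _) _
    _ ≤ _ := by
        rw [← ENNReal.ofReal_mul (Real.exp_pos _).le, hs]
        apply ENNReal.ofReal_le_ofReal
        rw [mul_left_comm, ← Real.exp_add]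
        gcongr
        linarith

lemma lintegral_neg_signedKernel_le_of_le_abs (h : LinkBound f c N τ L) {x : ℝ} (hx : τ ≤ |x|) :
    ∫⁻ y, ENNReal.ofReal (-signedKernel (targetDensity f τ) N y x) ≤
      ENNReal.ofReal (7 * Real.exp (x ^ 2 / 8)) := by
  calc _ ≤ ∫⁻ y, ENNReal.ofReal (2 * Real.exp (x ^ 2 / 8)) *
        ENNReal.ofReal (Real.exp (1 / √N * |y - f (x / τ)|) * stdPDF (y - f (x / τ))) := by
        refine lintegral_mono fun y => ?_
        rw [← ENNReal.ofReal_mul (by positivity)]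
        exact ENNReal.ofReal_le_ofReal ((neg_le_abs _).trans (h.abs_signedKernel_le hx y))
    _ ≤ ENNReal.ofReal (2 * Real.exp (x ^ 2 / 8)) *
        ENNReal.ofReal (2 * Real.exp ((1 / √N) ^ 2 / 2)) := by
        rw [lintegral_const_mul' _ _ ENNReal.ofReal_ne_top]
        exact mul_le_mul_right (lintegral_exp_mul_abs_sub_mul_stdPDF_le _ _) _
    _ ≤ _ := by
        rw [← ENNReal.ofReal_mul (by positivity)]
        apply ENNReal.ofReal_le_ofReal
        have h1 : (1 / √(N : ℝ)) ^ 2 ≤ 1 := pow_le_one₀ (by positivity) h.sqrt_bound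
        have h2 : Real.exp ((1 / √(N : ℝ)) ^ 2 / 2) ≤ 1.75 := by
          refine (Real.exp_le_exp.2 (by linarith : _ ≤ (1 : ℝ) / 2)).trans ?_
          have h4 : Real.exp (1 / 2) ^ 2 = Real.exp 1 := by
            rw [← Real.exp_nat_mul]; norm_num
          nlinarith [Real.exp_one_lt_d9, Real.exp_pos (1 / 2)]
        nlinarith [Real.exp_pos (x ^ 2 / 8)]

/-- The envelope condition of rejection sampling: the positive part of the signed kernel is at most
four times the density of `N(f(x/τ), 2)`. -/
lemma signedKernel_le_proposal (h : LinkBound f c N τ L) {x : ℝ} (hx : |x| ≤ τ) (y : ℝ) :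
    signedKernel (targetDensity f τ) N y x ≤ 4 * gaussianPDFReal (f (x / τ)) 2 y := by
  have h1 := (le_abs_self _).trans (h.abs_signedKernel_sub_le hx y)
  set z := y - f (x / τ) with hz
  have hE : Real.exp (1 / √N * |z|) * Real.exp (-z ^ 2 / 4) ≤ Real.exp 1 :=
    (exp_abs_mul_exp_neg_le _ z).trans
      (Real.exp_le_exp.2 (pow_le_one₀ (by positivity) h.sqrt_bound))
  have hg1 : Real.exp (-z ^ 2 / 4) ≤ 1 := Real.exp_le_one_iff.2 (by nlinarith [sq_nonneg z])
  have hp : gaussianPDFReal (f (x / τ)) 2 y =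
      (√2)⁻¹ * (√(2 * Real.pi))⁻¹ * Real.exp (-z ^ 2 / 4) := by
    rw [gaussianPDFReal, ← mul_inv, ← Real.sqrt_mul (by norm_num)]
    norm_num
    rw [hz]
    ring
  have hφ : stdPDF z = (√(2 * Real.pi))⁻¹ * (Real.exp (-z ^ 2 / 4) * Real.exp (-z ^ 2 / 4)) := by
    rw [stdPDF_eq, ← Real.exp_add]; ring_nf
  have hs2 : √2 ≤ 2 := by rw [Real.sqrt_le_left (by norm_num)]; norm_num
  have hinv : (1 : ℝ) / 2 ≤ (√2)⁻¹ := by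
    rw [one_div]; exact inv_anti₀ (by positivity) hs2
  have he2 : Real.exp (-2) * Real.exp 1 ≤ 1 := by
    rw [← Real.exp_add]; exact Real.exp_le_one_iff.2 (by norm_num)
  rw [hp]
  set G := Real.exp (-z ^ 2 / 4)
  set K := (√(2 * Real.pi))⁻¹
  have hG : 0 < G := Real.exp_pos _
  have hK : 0 < K := by positivity
  calc _ ≤ stdPDF z + Real.exp (-2) * (Real.exp (1 / √N * |z|) * stdPDF z) := by linarith
    _ = K * G * (G + Real.exp (-2) * (Real.exp (1 / √N * |z|) * G)) := by rw [hφ]; ring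
    _ ≤ K * G * (1 + Real.exp (-2) * Real.exp 1) := by gcongr
    _ ≤ K * G * 2 := by gcongr; linarith
    _ = 4 * (1 / 2 * K * G) := by ring
    _ ≤ _ := by gcongr

end LinkBound

/-! ### The bias of the signed kernel -/

lemma lintegral_derivSum_pow_le {f : ℝ → ℝ} {Cf : ℕ} {c : ℝ} (h : IsGaussianAnalytic f Cf c)
    {n : ℕ} (hn : 1 ≤ n) {θ τ : ℝ} (hτ : 2 * √2 * max 1 |θ| ≤ τ) :
    ∫⁻ u, ENNReal.ofReal (derivSum f c n ((θ + u) / τ) ^ n * Real.exp (-u ^ 2 / 4)) ≤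
      4 * ((Cf * n)! : ℝ≥0∞) := by
  have h0 := derivSum_nonneg f h.pos n
  have h2 : (0 : ℝ) < √2 := by positivity
  have hsq : √2 ^ 2 = (2 : ℝ) := Real.sq_sqrt (by norm_num)
  set g : ℝ → ℝ≥0∞ := fun u =>
    ENNReal.ofReal (derivSum f c n ((θ + u) / τ) ^ n * Real.exp (-u ^ 2 / 4)) with hg
  have hgm : Measurable g := by
    have h1 := (continuous_derivSum h.smooth c n).measurable
    fun_prop
  have hmap := Real.map_volume_mul_left h2.ne'
  have h3 : ∫⁻ x, g (√2 * x) = ENNReal.ofReal |(√2)⁻¹| * ∫⁻ u, g u := by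
    rw [← lintegral_map hgm (by fun_prop : Measurable fun x : ℝ => √2 * x), hmap,
      lintegral_smul_measure, smul_eq_mul]
  have h4 : ∫⁻ u, g u = ENNReal.ofReal √2 * ∫⁻ x, g (√2 * x) := by
    rw [h3, ← mul_assoc, ← ENNReal.ofReal_mul h2.le, abs_of_pos (by positivity),
      mul_inv_cancel₀ h2.ne', ENNReal.ofReal_one, one_mul]
  have h5 : ∫⁻ x, g (√2 * x) ≤ ENNReal.ofReal √(2 * Real.pi) * ((Cf * n)! : ℝ≥0∞) := by
    refine le_trans (le_of_eq ?_) (mul_le_mul_right (h.bound n hn θ τ hτ) _)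
    rw [← lintegral_const_mul' _ _ ENNReal.ofReal_ne_top]
    refine lintegral_congr fun x => ?_
    simp only [hg]
    rw [← ENNReal.ofReal_mul (by positivity)]
    congr 1
    have h6 : √(2 * Real.pi) ≠ 0 := by positivity
    rw [mul_pow, hsq, show -(2 * x ^ 2) / 4 = -x ^ 2 / 2 by ring]
    field_simp
  rw [h4]
  calc _ ≤ ENNReal.ofReal √2 * (ENNReal.ofReal √(2 * Real.pi) * ((Cf * n)! : ℝ≥0∞)) :=
        mul_le_mul_right h5 _
    _ ≤ _ := by
        rw [← mul_assoc, ← ENNReal.ofReal_mul h2.le]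
        gcongr
        rw [show (4 : ℝ≥0∞) = ENNReal.ofReal 4 by simp]
        apply ENNReal.ofReal_le_ofReal
        rw [← Real.sqrt_mul (by norm_num), Real.sqrt_le_left (by norm_num)]
        linarith [Real.pi_le_four]

lemma lintegral_exp_neg_sq_div_four_le :
    ∫⁻ u : ℝ, ENNReal.ofReal (Real.exp (-u ^ 2 / 4)) ≤ 4 := by
  rw [← ofReal_integral_eq_lintegral_ofReal integrable_exp_neg_sq_div_four
    (Filter.Eventually.of_forall fun u => (Real.exp_pos _).le)]
  have h := integral_gaussian (1 / 4)
  have h1 : ∫ u : ℝ, Real.exp (-u ^ 2 / 4) = √(Real.pi / (1 / 4)) := by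
    rw [← h]; congr! 3; ring
  rw [h1, show (4 : ℝ≥0∞) = ENNReal.ofReal 4 by simp]
  apply ENNReal.ofReal_le_ofReal
  rw [Real.sqrt_le_left (by norm_num)]
  linarith [Real.pi_le_four]

lemma exp_abs_add_mul_stdPDF_le (z : ℝ) : Real.exp (|z| + 1 / 2) * stdPDF z ≤ Real.exp 2 := by
  have h1 := exp_abs_mul_exp_neg_le 1 z
  rw [one_mul, one_pow] at h1
  calc Real.exp (|z| + 1 / 2) * stdPDF z
      ≤ Real.exp (|z| + 1 / 2) * Real.exp (-z ^ 2 / 2) := by gcongr; exact stdPDF_le_exp z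
    _ = Real.exp (1 / 2) * (Real.exp |z| * Real.exp (-z ^ 2 / 4)) * Real.exp (-z ^ 2 / 4) := by
        rw [← Real.exp_add, ← Real.exp_add, ← Real.exp_add, ← Real.exp_add]; ring_nf
    _ ≤ Real.exp (1 / 2) * Real.exp 1 * 1 := by
        gcongr
        exact Real.exp_le_one_iff.2 (by nlinarith [sq_nonneg z])
    _ ≤ _ := by rw [mul_one, ← Real.exp_add]; gcongr; norm_num

lemma integrable_derivSum_pow_mul_exp_neg {f : ℝ → ℝ} {Cf : ℕ} {c : ℝ}
    (h : IsGaussianAnalytic f Cf c) (n : ℕ) {θ τ : ℝ} (hτ : 2 * √2 * max 1 |θ| ≤ τ) :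
    Integrable fun u => derivSum f c n ((θ + u) / τ) ^ n * Real.exp (-u ^ 2 / 4) := by
  rcases Nat.eq_zero_or_pos n with rfl | hn
  · simpa using integrable_exp_neg_sq_div_four
  have hc := continuous_derivSum h.smooth c n
  refine ⟨(by fun_prop : Continuous _).aestronglyMeasurable, ?_⟩
  rw [hasFiniteIntegral_iff_ofReal (Filter.Eventually.of_forall fun u => ?_)]
  · refine (lintegral_derivSum_pow_le h hn hτ).trans_lt ?_
    exact ENNReal.mul_lt_top (by simp) (ENNReal.natCast_lt_top _)
  · have := derivSum_nonneg f h.pos n ((θ + u) / τ)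
    simp only [Pi.zero_apply]
    positivity

lemma iteratedDeriv_targetDensity_shift (f : ℝ → ℝ) (τ y θ : ℝ) (j : ℕ) (t : ℝ) :
    iteratedDeriv j (fun t => targetDensity f τ y (θ + t)) t =
      iteratedDeriv j (fun t => targetDensity f τ y t) (θ + t) :=
  congrFun (iteratedDeriv_comp_const_add j (fun t => targetDensity f τ y t) θ) t

lemma integrable_iteratedDeriv_targetDensity_shift {f : ℝ → ℝ} {Cf : ℕ} {c : ℝ}
    (h : IsGaussianAnalytic f Cf c) {θ τ : ℝ} (hτ0 : 0 < τ) (hτ : 2 * √2 * max 1 |θ| ≤ τ)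
    (y : ℝ) (j : ℕ) :
    Integrable fun t => iteratedDeriv j (fun t => targetDensity f τ y (θ + t)) t *
      Real.exp (-t ^ 2 / 4) := by
  simp only [iteratedDeriv_targetDensity_shift]
  have hcont := (contDiff_targetDensity h.smooth τ y).continuous_iteratedDeriv j (mod_cast le_top)
  refine (((integrable_exp_neg_sq_div_four.add
    (integrable_derivSum_pow_mul_exp_neg h j hτ)).const_mul (j ! * (c / τ) ^ j *
      Real.exp 2))).mono' (by fun_prop : Continuous _).aestronglyMeasurable
    (Filter.Eventually.of_forall fun t => ?_)
  have ha := derivSum_nonneg f h.pos j ((θ + t) / τ)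
  have hc := h.pos
  rw [norm_mul, Real.norm_eq_abs, Real.norm_of_nonneg (Real.exp_pos _).le]
  simp only [Pi.add_apply]
  calc _ ≤ (j ! * (c / τ) ^ j * (1 + derivSum f c j ((θ + t) / τ) ^ j) * Real.exp 2) *
        Real.exp (-t ^ 2 / 4) := by
        gcongr
        refine (abs_iteratedDeriv_targetDensity_le_exp h.smooth hτ0 h.pos y j (θ + t)).trans ?_
        gcongr
        exact exp_abs_add_mul_stdPDF_le _
    _ = _ := by ring

lemma sourceDensity_eq (x θ : ℝ) : sourceDensity x θ = stdPDF (x - θ) := gaussianPDFReal_one_eq _ _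

lemma integrable_iteratedDeriv_mul_sourceDensity {f : ℝ → ℝ} {Cf : ℕ} {c : ℝ}
    (h : IsGaussianAnalytic f Cf c) {θ τ : ℝ} (hτ0 : 0 < τ) (hτ : 2 * √2 * max 1 |θ| ≤ τ)
    (y : ℝ) (j : ℕ) :
    Integrable fun x => iteratedDeriv j (fun t => targetDensity f τ y t) x *
      sourceDensity x θ := by
  have h1 := integrable_mul_hermiteFun_mul_stdPDF 0
    (integrable_iteratedDeriv_targetDensity_shift h hτ0 hτ y j)
  simp only [hermiteFun_zero, one_mul, iteratedDeriv_targetDensity_shift] at h1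
  have h2 := h1.comp_sub_right θ
  simpa [sourceDensity_eq] using h2

lemma integrable_signedKernel_mul_sourceDensity {f : ℝ → ℝ} {Cf : ℕ} {c : ℝ}
    (h : IsGaussianAnalytic f Cf c) {θ τ : ℝ} (hτ0 : 0 < τ) (hτ : 2 * √2 * max 1 |θ| ≤ τ)
    (N : ℕ) (y : ℝ) :
    Integrable fun x => signedKernel (targetDensity f τ) N y x * sourceDensity x θ := by
  simp only [signedKernel_eq, Finset.sum_mul, mul_assoc]
  exact integrable_finsetSum _ fun k _ =>
    (integrable_iteratedDeriv_mul_sourceDensity h hτ0 hτ y (2 * k)).const_mul _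

lemma integral_signedKernel_mul_sourceDensity {f : ℝ → ℝ} {Cf : ℕ} {c : ℝ}
    (h : IsGaussianAnalytic f Cf c) {θ τ : ℝ} (hτ0 : 0 < τ) (hτ : 2 * √2 * max 1 |θ| ≤ τ)
    (N : ℕ) (y : ℝ) :
    ∫ x, signedKernel (targetDensity f τ) N y x * sourceDensity x θ =
      ∑ k ∈ Finset.range (N + 1), heatCoeff k *
        ∫ t, iteratedDeriv (2 * k) (fun t => targetDensity f τ y (θ + t)) t * stdPDF t := by
  simp only [signedKernel_eq, Finset.sum_mul, mul_assoc]
  rw [integral_finsetSum _ fun k _ =>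
    (integrable_iteratedDeriv_mul_sourceDensity h hτ0 hτ y (2 * k)).const_mul _]
  refine Finset.sum_congr rfl fun k _ => ?_
  rw [integral_const_mul]
  congr 1
  simp only [iteratedDeriv_targetDensity_shift, sourceDensity_eq]
  rw [← integral_add_left_eq_self (fun x => iteratedDeriv (2 * k)
    (fun t => targetDensity f τ y t) x * stdPDF (x - θ)) θ]
  simp

/-- The bias, in terms of the derivative of order `n` of `v`: its `L¹` norm in `y` is bounded by a
power of `derivSum`, and the weight `e^{-u²/4}` is the Gaussian weight of the moment hypothesis,
where the argument is `θ + √2 x`. -/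
theorem lintegral_bias_le {f : ℝ → ℝ} {Cf : ℕ} {c : ℝ} (h : IsGaussianAnalytic f Cf c)
    {θ τ : ℝ} (hτ0 : 0 < τ) (hτ : 2 * √2 * max 1 |θ| ≤ τ) {N n : ℕ} (hn : 1 ≤ n)
    (hnN : n ≤ 2 * N + 2) :
    ∫⁻ y, ‖(∫ x, signedKernel (targetDensity f τ) N y x * sourceDensity x θ) -
        targetDensity f τ y θ‖ₑ ≤
      ENNReal.ofReal (384 * (N + 1) * (n ! * (c / τ) ^ n * (Cf * n)!)) := by
  obtain ⟨n, rfl⟩ : ∃ m, n = m + 1 := ⟨n - 1, by omega⟩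
  have hc := h.pos
  set K : ℝ := (n + 1)! * (c / τ) ^ (n + 1) with hK
  have hK0 : 0 ≤ K := by positivity
  have hmeas : Measurable fun p : ℝ × ℝ =>
      ‖iteratedDeriv (n + 1) (fun t => targetDensity f τ p.1 t) (θ + p.2)‖ₑ :=
    ((continuous_iteratedDeriv_targetDensity h.smooth τ (n + 1)).comp
      (continuous_fst.prodMk (continuous_const.add continuous_snd))).measurable.enorm
  have hcont := continuous_derivSum h.smooth c (n + 1)
  calc _ ≤ ∫⁻ y, ∫⁻ u, ‖iteratedDeriv (n + 1) (fun t => targetDensity f τ y t) (θ + u)‖ₑ *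
        ENNReal.ofReal (8 * (N + 1) * Real.exp (-u ^ 2 / 4)) := by
        refine lintegral_mono fun y => ?_
        rw [integral_signedKernel_mul_sourceDensity h hτ0 hτ]
        have h1 := hermite_projection_error (g := fun t => targetDensity f τ y (θ + t))
          ((contDiff_targetDensity h.smooth τ y).comp (contDiff_const.add contDiff_id)) N n
          (by omega) (integrable_iteratedDeriv_targetDensity_shift h hτ0 hτ y)
        simp only [add_zero, iteratedDeriv_targetDensity_shift] at h1 ⊢
        exact h1
    _ = ∫⁻ u, ∫⁻ y, ‖iteratedDeriv (n + 1) (fun t => targetDensity f τ y t) (θ + u)‖ₑ *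
        ENNReal.ofReal (8 * (N + 1) * Real.exp (-u ^ 2 / 4)) := by
        rw [lintegral_lintegral_swap]
        exact (hmeas.mul (by fun_prop)).aemeasurable
    _ ≤ ∫⁻ u, ENNReal.ofReal (48 * (N + 1) * K) * (ENNReal.ofReal (Real.exp (-u ^ 2 / 4)) +
          ENNReal.ofReal (derivSum f c (n + 1) ((θ + u) / τ) ^ (n + 1) *
            Real.exp (-u ^ 2 / 4))) := by
        refine lintegral_mono fun u => ?_
        have ha := derivSum_nonneg f hc (n + 1) ((θ + u) / τ)
        rw [lintegral_mul_const' _ _ ENNReal.ofReal_ne_top]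
        refine (mul_le_mul_left (lintegral_iteratedDeriv_targetDensity_le h.smooth hτ0 hc
          (n + 1) (θ + u)) _).trans_eq ?_
        rw [← ENNReal.ofReal_mul (by positivity),
          ← ENNReal.ofReal_add (by positivity) (by positivity),
          ← ENNReal.ofReal_mul (by positivity)]
        congr 1
        rw [hK]; ring
    _ ≤ ENNReal.ofReal (48 * (N + 1) * K) * (4 + 4 * ((Cf * (n + 1))! : ℝ≥0∞)) := by
        rw [lintegral_const_mul' _ _ ENNReal.ofReal_ne_top, lintegral_add_left (by fun_prop)]
        exact mul_le_mul_right (add_le_add lintegral_exp_neg_sq_div_four_le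
          (lintegral_derivSum_pow_le h hn hτ)) _
    _ ≤ ENNReal.ofReal (48 * (N + 1) * K) * ENNReal.ofReal (8 * (Cf * (n + 1))!) := by
        gcongr
        have h1 : (1 : ℝ) ≤ (Cf * (n + 1))! := by exact_mod_cast Nat.factorial_pos _
        have h2 : (4 + 4 * ((Cf * (n + 1))! : ℝ≥0∞)) =
            ENNReal.ofReal (4 + 4 * ((Cf * (n + 1))! : ℝ)) := by
          rw [ENNReal.ofReal_add (by norm_num) (by positivity), ENNReal.ofReal_mul (by norm_num),
            ENNReal.ofReal_natCast]
          simp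
        rw [h2]
        apply ENNReal.ofReal_le_ofReal
        linarith
    _ = _ := by
        rw [← ENNReal.ofReal_mul (by positivity)]
        congr 1
        ring

/-! ### The order of the expansion -/

lemma exp_le_barC (Cf : ℕ) : Real.exp (4 * (1 + (Cf : ℝ)) ^ 2) ≤ barC Cf := by
  have h1 : (1 : ℝ) ≤ 32 * Real.pi ^ 2 := by nlinarith [Real.pi_gt_three]
  have h2 : (1 : ℝ) ≤ (2 * Real.exp 1) ^ (4 * (1 + Cf)) :=
    one_le_pow₀ (by linarith [Real.one_le_exp (zero_le_one (α := ℝ))])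
  rw [barC]
  exact le_mul_of_one_le_left (Real.exp_pos _).le (one_le_mul_of_one_le_of_one_le h1 h2)

lemma pow_le_barC (Cf : ℕ) : (2 * Real.exp 1) ^ (4 * (1 + Cf)) ≤ barC Cf := by
  have h1 : (1 : ℝ) ≤ 32 * Real.pi ^ 2 := by nlinarith [Real.pi_gt_three]
  have h2 : 1 ≤ Real.exp (4 * (1 + (Cf : ℝ)) ^ 2) := Real.one_le_exp (by positivity)
  rw [barC]
  have h3 : (0 : ℝ) ≤ (2 * Real.exp 1) ^ (4 * (1 + Cf)) := by positivity
  exact (le_mul_of_one_le_left h3 h1).trans (le_mul_of_one_le_right (by positivity) h2)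

lemma four_lt_barC (Cf : ℕ) : 4 < barC Cf := by
  have h := exp_le_barC Cf
  have h1 : Real.exp 4 ≤ Real.exp (4 * (1 + (Cf : ℝ)) ^ 2) := by
    gcongr
    have : (0 : ℝ) ≤ Cf := Nat.cast_nonneg _
    nlinarith
  have h2 := Real.add_one_le_exp (4 : ℝ)
  linarith

/-- The exponent `(2N + 1)^{1/(2(1 + C_f))} / (2e)` of the rate. -/
def rateExp (Cf N : ℕ) : ℝ := (2 * (N : ℝ) + 1) ^ (1 / (2 * (1 + (Cf : ℝ)))) / (2 * Real.exp 1)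

lemma rateExp_pow (Cf N : ℕ) :
    (2 * Real.exp 1 * rateExp Cf N) ^ (2 * (1 + Cf)) = 2 * (N : ℝ) + 1 := by
  rw [rateExp, mul_div_cancel₀ _ (by positivity), ← Real.rpow_natCast,
    ← Real.rpow_mul (by positivity)]
  push_cast
  rw [one_div_mul_cancel (by positivity), Real.rpow_one]

lemma rateExp_pos (Cf N : ℕ) : 0 < rateExp Cf N := by
  rw [rateExp]; positivity

lemma five_le_rateExp {Cf N : ℕ} (hN : barC Cf ≤ 2 * (N : ℝ) + 1) : 5 ≤ rateExp Cf N := by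
  have h1 := (pow_le_barC Cf).trans hN
  rw [← rateExp_pow Cf N, show 4 * (1 + Cf) = 2 * (2 * (1 + Cf)) by ring, pow_mul] at h1
  have h2 := (pow_le_pow_iff_left₀ (by positivity)
    (mul_nonneg (by positivity) (rateExp_pos Cf N).le) (by positivity)).1 h1
  have he := Real.exp_one_gt_d9
  nlinarith

/-- With `n` of the order of `rateExp`, the factorials in the bias are beaten by `(c/τ)^n`. -/
lemma factorial_bound {Cf N : ℕ} (hN : barC Cf ≤ 2 * (N : ℝ) + 1) :
    ∃ n : ℕ, 1 ≤ n ∧ n ≤ 2 * N + 2 ∧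
      384 * ((N : ℝ) + 1) * (n ! * (1 / (100 * N)) ^ n * (Cf * n)!) ≤
        Real.exp (-rateExp Cf N) := by
  set M := rateExp Cf N with hM
  have hM5 : 5 ≤ M := five_le_rateExp hN
  have hMp : (2 * Real.exp 1 * M) ^ (2 * (1 + Cf)) = 2 * (N : ℝ) + 1 := rateExp_pow Cf N
  have he1 : 1 ≤ Real.exp 1 := Real.one_le_exp zero_le_one
  set n := ⌈M⌉₊ with hn
  have hMn : M ≤ n := Nat.le_ceil M
  have hn1 : (n : ℝ) < M + 1 := Nat.ceil_lt_add_one (by linarith)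
  have hn5 : 5 ≤ n := by exact_mod_cast hM5.trans hMn
  have hN1 : (1 : ℝ) ≤ N := by
    have : (1 : ℝ) < N := by linarith [four_lt_barC Cf]
    linarith
  set D := 1 + Cf with hD
  have hen : (Real.exp 1 * n) ^ (2 * D) ≤ 2 * (N : ℝ) + 1 := by
    rw [← hMp]
    refine pow_le_pow_left₀ (by positivity) ?_ _
    nlinarith
  refine ⟨n, by omega, ?_, ?_⟩
  · have h1 : Real.exp 1 * n ≤ (Real.exp 1 * n) ^ (2 * D) := by
      refine le_self_pow₀ ?_ (by omega)
      have : (1 : ℝ) ≤ n := by exact_mod_cast (by omega : 1 ≤ n)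
      nlinarith
    have h2 : (n : ℝ) ≤ 2 * N + 1 := by
      have : (0 : ℝ) ≤ n := Nat.cast_nonneg _
      nlinarith
    have h3 : n ≤ 2 * N + 1 := by exact_mod_cast h2
    omega
  -- `X ^ n` bounds the product of the two factorials, and `e X` is at most of order `N ^ (3 / 4)`
  set X : ℝ := ((D : ℝ) * n) ^ D with hX
  have hX0 : 0 ≤ X := by positivity
  have hfac : (n ! : ℝ) * (Cf * n)! ≤ X ^ n := by
    have h1 : n ! * (Cf * n)! ≤ (D * n) ^ (D * n) := by
      have h2 := Nat.le_of_dvd (Nat.factorial_pos _)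
        (Nat.factorial_mul_factorial_dvd_factorial_add n (Cf * n))
      rw [show n + Cf * n = D * n by rw [hD]; ring] at h2
      exact h2.trans (Nat.factorial_le_pow _)
    rw [hX, ← pow_mul]
    exact_mod_cast h1
  have hX4 : (Real.exp 1 * X) ^ 4 ≤ (2 * (N : ℝ) + 1) ^ 3 := by
    have hD1 : (1 : ℝ) ≤ D := by exact_mod_cast (by omega : 1 ≤ D)
    have h1 : (D : ℝ) ^ (4 * D) ≤ 2 * (N : ℝ) + 1 := by
      calc (D : ℝ) ^ (4 * D) ≤ Real.exp D ^ (4 * D) := by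
            gcongr
            linarith [Real.add_one_le_exp (D : ℝ)]
        _ = Real.exp (4 * (1 + (Cf : ℝ)) ^ 2) := by
            rw [← Real.exp_nat_mul]; congr 1; rw [hD]; push_cast; ring
        _ ≤ _ := (exp_le_barC Cf).trans hN
    have h2 : (Real.exp 1 * n) ^ (4 * D) ≤ (2 * (N : ℝ) + 1) ^ 2 := by
      rw [show 4 * D = 2 * D * 2 by ring, pow_mul]
      gcongr
    calc (Real.exp 1 * X) ^ 4 ≤ (Real.exp 1 ^ D * X) ^ 4 := by
          gcongr
          exact le_self_pow₀ he1 (by omega)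
      _ = (D : ℝ) ^ (4 * D) * (Real.exp 1 * n) ^ (4 * D) := by
          rw [hX, ← mul_pow, ← pow_mul, ← mul_pow, mul_comm D 4]; ring
      _ ≤ (2 * (N : ℝ) + 1) * (2 * (N : ℝ) + 1) ^ 2 := by gcongr
      _ = _ := by ring
  set r : ℝ := Real.exp 1 * X / (100 * N) with hr
  have hr0 : 0 ≤ r := by positivity
  have hr4 : r ^ 4 ≤ 27 / (10 ^ 8 * N) := by
    rw [hr, div_pow, div_le_div_iff₀ (by positivity) (by positivity)]
    have h1 : (2 * (N : ℝ) + 1) ^ 3 ≤ (3 * N) ^ 3 := by gcongr; linarith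
    calc _ ≤ (3 * (N : ℝ)) ^ 3 * (10 ^ 8 * N) := by gcongr; exact hX4.trans h1
      _ = _ := by ring
  have hr1 : r ≤ 1 := by
    by_contra! hgt
    have h1 := one_lt_pow₀ hgt (n := 4) (by norm_num)
    have h2 : 27 / (10 ^ 8 * (N : ℝ)) ≤ 1 := by
      rw [div_le_one (by positivity)]; linarith
    linarith
  -- four of the `n ≥ 5` factors `r` already beat the prefactor of order `N`
  have hrn : r ^ n ≤ 27 / (10 ^ 8 * N) := (pow_le_pow_of_le_one hr0 hr1 (by omega)).trans hr4
  have hexp : Real.exp 1 ^ n * Real.exp (-(n : ℝ)) = 1 := by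
    rw [← Real.exp_nat_mul, ← Real.exp_add]; simp
  calc 384 * ((N : ℝ) + 1) * (n ! * (1 / (100 * N)) ^ n * (Cf * n)!)
      = 384 * ((N : ℝ) + 1) * ((n ! * (Cf * n)!) * (1 / (100 * N)) ^ n) := by ring
    _ ≤ 384 * ((N : ℝ) + 1) * (X ^ n * (1 / (100 * N)) ^ n) := by gcongr
    _ = 384 * ((N : ℝ) + 1) * (r ^ n * Real.exp (-(n : ℝ))) := by
        have hrX : r ^ n = Real.exp 1 ^ n * X ^ n * (1 / (100 * N)) ^ n := by
          rw [hr, ← mul_pow, ← mul_pow]; congr 1; ring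
        rw [hrX]
        linear_combination (-384 * ((N : ℝ) + 1) * X ^ n * (1 / (100 * (N : ℝ))) ^ n) * hexp
    _ ≤ 384 * ((N : ℝ) + 1) * (27 / (10 ^ 8 * N) * Real.exp (-M)) := by gcongr
    _ = (384 * ((N : ℝ) + 1) * 27 / (10 ^ 8 * N)) * Real.exp (-M) := by ring
    _ ≤ 1 * Real.exp (-M) := by
        gcongr
        rw [div_le_one (by positivity)]
        linarith
    _ = _ := one_mul _

/-! ### The Markov kernel and its deficiency -/

/-- The normalizing constant of the Markov kernel. -/
def kernelMass (f : ℝ → ℝ) (τ : ℝ) (N : ℕ) (x : ℝ) : ℝ :=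
  ∫ y, max (signedKernel (targetDensity f τ) N y x) 0

lemma markovKernel_eq (f : ℝ → ℝ) (τ : ℝ) (N : ℕ) (y x : ℝ) :
    markovKernel (targetDensity f τ) N y x =
      max (signedKernel (targetDensity f τ) N y x) 0 / kernelMass f τ N x := rfl

lemma integrable_max_signedKernel {f : ℝ → ℝ} (hf : ContDiff ℝ ∞ f) (τ : ℝ) (N : ℕ) (x : ℝ) :
    Integrable fun y => max (signedKernel (targetDensity f τ) N y x) 0 :=
  (integrable_signedKernel hf τ N x).pos_part

lemma one_le_kernelMass {f : ℝ → ℝ} (hf : ContDiff ℝ ∞ f) (τ : ℝ) (N : ℕ) (x : ℝ) :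
    1 ≤ kernelMass f τ N x := by
  rw [← integral_signedKernel hf τ N x]
  exact integral_mono (integrable_signedKernel hf τ N x) (integrable_max_signedKernel hf τ N x)
    fun y => le_max_left _ _

lemma measurable_kernelMass {f : ℝ → ℝ} (hf : ContDiff ℝ ∞ f) (τ : ℝ) (N : ℕ) :
    Measurable (kernelMass f τ N) := by
  have h : StronglyMeasurable (Function.uncurry fun x y =>
      max (signedKernel (targetDensity f τ) N y x) 0) :=
    (((continuous_signedKernel hf τ N).comp continuous_swap).max
      continuous_const).stronglyMeasurable
  exact h.integral_prod_right.measurable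

lemma measurable_markovKernel {f : ℝ → ℝ} (hf : ContDiff ℝ ∞ f) (τ : ℝ) (N : ℕ) :
    Measurable fun p : ℝ × ℝ => markovKernel (targetDensity f τ) N p.1 p.2 := by
  simp only [markovKernel_eq]
  exact ((continuous_signedKernel hf τ N).max continuous_const).measurable.div
    ((measurable_kernelMass hf τ N).comp measurable_snd)

lemma markovKernel_nonneg {f : ℝ → ℝ} (hf : ContDiff ℝ ∞ f) (τ : ℝ) (N : ℕ) (y x : ℝ) :
    0 ≤ markovKernel (targetDensity f τ) N y x := by
  have := one_le_kernelMass hf τ N x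
  rw [markovKernel_eq]
  positivity

lemma markovKernel_le {f : ℝ → ℝ} (hf : ContDiff ℝ ∞ f) (τ : ℝ) (N : ℕ) (y x : ℝ) :
    markovKernel (targetDensity f τ) N y x ≤ max (signedKernel (targetDensity f τ) N y x) 0 :=
  div_le_self (le_max_right _ _) (one_le_kernelMass hf τ N x)

lemma integrable_markovKernel {f : ℝ → ℝ} (hf : ContDiff ℝ ∞ f) (τ : ℝ) (N : ℕ) (x : ℝ) :
    Integrable fun y => markovKernel (targetDensity f τ) N y x :=
  (integrable_max_signedKernel hf τ N x).div_const _

lemma integral_markovKernel {f : ℝ → ℝ} (hf : ContDiff ℝ ∞ f) (τ : ℝ) (N : ℕ) (x : ℝ) :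
    ∫ y, markovKernel (targetDensity f τ) N y x = 1 := by
  have h1 := one_le_kernelMass hf τ N x
  simp only [markovKernel_eq]
  rw [integral_div, ← kernelMass, div_self (by positivity)]

/-- Since `∫ S = 1`, normalizing costs as much mass as cutting off the negative part. -/
lemma lintegral_markovKernel_sub_le {f : ℝ → ℝ} (hf : ContDiff ℝ ∞ f) (τ : ℝ) (N : ℕ) (x : ℝ) :
    ∫⁻ y, ‖markovKernel (targetDensity f τ) N y x - signedKernel (targetDensity f τ) N y x‖ₑ ≤
      2 * ∫⁻ y, ENNReal.ofReal (-signedKernel (targetDensity f τ) N y x) := by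
  have hS := integrable_signedKernel hf τ N x
  have hSp := integrable_max_signedKernel hf τ N x
  have hT := integrable_markovKernel hf τ N x
  have hT1 := integral_markovKernel hf τ N x
  have hS1 := integral_signedKernel hf τ N x
  set S := fun y => signedKernel (targetDensity f τ) N y x
  set T := fun y => markovKernel (targetDensity f τ) N y x
  have hle : ∀ y, T y ≤ max (S y) 0 := fun y => markovKernel_le hf τ N y x
  have h0 : ∀ y, 0 ≤ T y := fun y => markovKernel_nonneg hf τ N y x
  have hST : Integrable fun y => max (S y) 0 - T y := hSp.sub hT
  have hSS : Integrable fun y => max (S y) 0 - S y := hSp.sub hS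
  have hmass : ∫⁻ y, ENNReal.ofReal (max (S y) 0 - T y) = ∫⁻ y, ENNReal.ofReal (-S y) := by
    have h1 : ∀ y, ENNReal.ofReal (-S y) = ENNReal.ofReal (max (S y) 0 - S y) := fun y => by
      rcases le_total 0 (S y) with h | h
      · rw [max_eq_left h, sub_self, ENNReal.ofReal_zero, ENNReal.ofReal_of_nonpos (by linarith)]
      · rw [max_eq_right h, zero_sub]
    simp only [h1]
    rw [← ofReal_integral_eq_lintegral_ofReal hST
        (Filter.Eventually.of_forall fun y => sub_nonneg.2 (hle y)),
      ← ofReal_integral_eq_lintegral_ofReal hSS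
        (Filter.Eventually.of_forall fun y => sub_nonneg.2 (le_max_left _ _)),
      integral_sub hSp hT, integral_sub hSp hS, hT1, hS1]
  rw [two_mul]
  conv_rhs => enter [1]; rw [← hmass]
  rw [← lintegral_add_left' hST.aestronglyMeasurable.aemeasurable.ennreal_ofReal]
  refine lintegral_mono fun y => ?_
  rw [Real.enorm_eq_ofReal_abs]
  have h2 : |T y - S y| ≤ (max (S y) 0 - T y) + max (-S y) 0 := by
    have h3 := hle y
    have h4 := h0 y
    rcases le_total 0 (S y) with h | h
    · simp only [max_eq_left h] at h3 ⊢
      rw [abs_sub_comm, abs_of_nonneg (sub_nonneg.2 h3)]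
      linarith [le_max_right (-S y) 0]
    · rw [max_eq_right h] at h3 ⊢
      rw [abs_of_nonneg (by linarith)]
      linarith [le_max_left (-S y) 0]
  refine (ENNReal.ofReal_le_ofReal h2).trans (ENNReal.ofReal_add_le.trans ?_)
  refine add_le_add le_rfl ?_
  rcases le_total 0 (-S y) with h | h
  · rw [max_eq_left h]
  · rw [max_eq_right h, ENNReal.ofReal_zero]; exact zero_le

lemma integrable_markovKernel_mul_sourceDensity {f : ℝ → ℝ} {Cf : ℕ} {c : ℝ}
    (h : IsGaussianAnalytic f Cf c) {θ τ : ℝ} (hτ0 : 0 < τ) (hτ : 2 * √2 * max 1 |θ| ≤ τ)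
    (N : ℕ) (y : ℝ) :
    Integrable fun x => markovKernel (targetDensity f τ) N y x * sourceDensity x θ := by
  have hm : Measurable fun x => markovKernel (targetDensity f τ) N y x * sourceDensity x θ := by
    have hT := measurable_markovKernel h.smooth τ N
    generalize markovKernel (targetDensity f τ) N = T at hT
    have h1 : Measurable fun x => T y x := hT.comp measurable_prodMk_left
    have h2 : Measurable fun x => sourceDensity x θ := measurable_gaussianPDFReal θ 1
    exact h1.mul h2
  refine (integrable_signedKernel_mul_sourceDensity h hτ0 hτ N y).mono hm.aestronglyMeasurable
    (Filter.Eventually.of_forall fun x => ?_)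
  rw [norm_mul, norm_mul]
  gcongr
  rw [Real.norm_of_nonneg (markovKernel_nonneg h.smooth τ N y x)]
  exact (markovKernel_le h.smooth τ N y x).trans (max_le (le_abs_self _) (abs_nonneg _))

lemma lintegral_exp_mul_sourceDensity_le (θ : ℝ) :
    ∫⁻ x, ENNReal.ofReal (Real.exp (x ^ 2 / 4) * sourceDensity x θ) ≤
      ENNReal.ofReal (2 * Real.exp (θ ^ 2 / 2)) := by
  have hpi : (√(2 * Real.pi))⁻¹ ≤ 1 / 2 := by
    rw [one_div]
    apply inv_anti₀ (by norm_num)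
    apply Real.le_sqrt_of_sq_le
    linarith [Real.pi_gt_three]
  calc _ ≤ ∫⁻ x, ENNReal.ofReal (1 / 2 * Real.exp (θ ^ 2 / 2)) *
        ENNReal.ofReal (Real.exp (-(x - 2 * θ) ^ 2 / 4)) := by
        refine lintegral_mono fun x => ?_
        rw [← ENNReal.ofReal_mul (by positivity)]
        apply ENNReal.ofReal_le_ofReal
        rw [sourceDensity_eq, stdPDF_eq]
        calc _ = (√(2 * Real.pi))⁻¹ * (Real.exp (θ ^ 2 / 2) *
              Real.exp (-(x - 2 * θ) ^ 2 / 4)) := by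
              rw [mul_left_comm, ← Real.exp_add, ← Real.exp_add]
              ring_nf
          _ ≤ 1 / 2 * (Real.exp (θ ^ 2 / 2) * Real.exp (-(x - 2 * θ) ^ 2 / 4)) := by gcongr
          _ = _ := by ring
    _ ≤ ENNReal.ofReal (1 / 2 * Real.exp (θ ^ 2 / 2)) * 4 := by
        rw [lintegral_const_mul' _ _ ENNReal.ofReal_ne_top, lintegral_sub_right_eq_self
          (fun x : ℝ => ENNReal.ofReal (Real.exp (-x ^ 2 / 4))) (2 * θ)]
        exact mul_le_mul_right lintegral_exp_neg_sq_div_four_le _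
    _ = _ := by
        rw [show (4 : ℝ≥0∞) = ENNReal.ofReal 4 by simp, ← ENNReal.ofReal_mul (by positivity)]
        congr 1; ring

lemma lintegral_sourceDensity (θ : ℝ) : ∫⁻ x, ENNReal.ofReal (sourceDensity x θ) = 1 :=
  lintegral_gaussianPDFReal_eq_one θ one_ne_zero

lemma measurable_sourceDensity (θ : ℝ) : Measurable fun x => sourceDensity x θ :=
  measurable_gaussianPDFReal θ 1

lemma sourceDensity_nonneg (x θ : ℝ) : 0 ≤ sourceDensity x θ := gaussianPDFReal_nonneg θ 1 x

namespace LinkBound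

variable {f : ℝ → ℝ} {c τ L : ℝ} {N : ℕ}

lemma ratio_le_inv (h : LinkBound f c N τ L) : c / τ ≤ 1 / (100 * N) := by
  have hN : (1 : ℝ) ≤ N := by exact_mod_cast h.one_le_N
  have hτ := h.τ_pos
  have hc := h.pos
  rw [div_le_div_iff₀ hτ (by positivity), one_mul]
  refine (pow_le_pow_iff_left₀ (by positivity) hτ.le two_ne_zero).1 ?_
  refine le_trans ?_ h.scale
  have h1 : c ^ 2 ≤ max c 1 ^ 4 := by
    calc c ^ 2 ≤ max c 1 ^ 2 := by gcongr; exact le_max_left _ _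
      _ ≤ max c 1 ^ 4 := pow_le_pow_right₀ (le_max_right _ _) (by norm_num)
  have h2 : 1 ≤ L ^ 2 := one_le_pow₀ h.one_le
  calc (c * (100 * N)) ^ 2 = 10 ^ 4 * (c ^ 2 * 1 * (N : ℝ) ^ 2) := by ring
    _ ≤ _ := by gcongr

lemma hundred_le (h : LinkBound f c N τ L) : 100 ≤ τ := by
  have hN : (1 : ℝ) ≤ N := by exact_mod_cast h.one_le_N
  have h1 : 1 ≤ max c 1 ^ 4 := one_le_pow₀ (le_max_right _ _)
  have h2 : 1 ≤ L ^ 2 := one_le_pow₀ h.one_le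
  have h3 : 1 ≤ (N : ℝ) ^ 2 := one_le_pow₀ hN
  have h4 : 1 ≤ max c 1 ^ 4 * L ^ 2 * (N : ℝ) ^ 2 :=
    one_le_mul_of_one_le_of_one_le (one_le_mul_of_one_le_of_one_le h1 h2) h3
  nlinarith [h.scale, h.τ_pos]

lemma admissible (h : LinkBound f c N τ L) {θ : ℝ} (hθ : 10 ^ 4 * θ ^ 2 ≤ τ ^ 2) :
    2 * √2 * max 1 |θ| ≤ τ := by
  have h1 : max 1 |θ| ≤ τ / 100 := by
    refine max_le (by linarith [h.hundred_le]) ?_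
    refine abs_le_of_sq_le_sq ?_ (by linarith [h.τ_pos])
    nlinarith
  have h2 : √2 ≤ 2 := by rw [Real.sqrt_le_left (by norm_num)]; norm_num
  have h3 : 0 ≤ max 1 |θ| := le_trans zero_le_one (le_max_left _ _)
  have h4 := h.τ_pos
  calc 2 * √2 * max 1 |θ| ≤ 2 * 2 * (τ / 100) := by gcongr
    _ ≤ τ := by linarith

/-- Beyond `|x| = τ` the negative mass may be of order `e^{x²/8}`; multiplying it by
`e^{(x² - τ²)/8} ≥ 1` gives a bound valid for all `x` that is integrable against the source. -/
lemma lintegral_neg_signedKernel_le_add (h : LinkBound f c N τ L) (x : ℝ) :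
    ∫⁻ y, ENNReal.ofReal (-signedKernel (targetDensity f τ) N y x) ≤
      ENNReal.ofReal (2 * Real.exp (-N)) +
        ENNReal.ofReal (7 * Real.exp (-τ ^ 2 / 8)) * ENNReal.ofReal (Real.exp (x ^ 2 / 4)) := by
  rcases le_total |x| τ with hx | hx
  · exact (h.lintegral_neg_signedKernel_le hx).trans le_self_add
  · refine (h.lintegral_neg_signedKernel_le_of_le_abs hx).trans (le_trans ?_ le_add_self)
    rw [← ENNReal.ofReal_mul (by positivity), mul_assoc, ← Real.exp_add]
    apply ENNReal.ofReal_le_ofReal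
    gcongr
    have : τ ^ 2 ≤ x ^ 2 := by
      rw [← sq_abs x]
      exact pow_le_pow_left₀ h.τ_pos.le hx 2
    linarith

lemma lintegral_bias_le_rate (h : LinkBound f c N τ L) {Cf : ℕ} (hG : IsGaussianAnalytic f Cf c)
    (hN : barC Cf ≤ 2 * (N : ℝ) + 1) {θ : ℝ} (hθ : 10 ^ 4 * θ ^ 2 ≤ τ ^ 2) :
    ∫⁻ y, ‖(∫ x, signedKernel (targetDensity f τ) N y x * sourceDensity x θ) -
        targetDensity f τ y θ‖ₑ ≤ ENNReal.ofReal (Real.exp (-rateExp Cf N)) := by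
  obtain ⟨n, hn1, hn2, hn⟩ := factorial_bound hN
  refine (lintegral_bias_le hG h.τ_pos (h.admissible hθ) hn1 hn2).trans
    (ENNReal.ofReal_le_ofReal (le_trans ?_ hn))
  have := h.τ_pos
  have := h.pos
  have hr := h.ratio_le_inv
  gcongr

lemma rateExp_le (Cf N : ℕ) (hN : barC Cf ≤ 2 * (N : ℝ) + 1) : rateExp Cf N ≤ N := by
  have h5 := five_le_rateExp hN
  have he := Real.exp_one_gt_d9
  have h1 : 2 * Real.exp 1 * rateExp Cf N ≤ 2 * (N : ℝ) + 1 := by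
    conv_rhs => rw [← rateExp_pow Cf N]
    exact le_self_pow₀ (by nlinarith) (by omega)
  have h2 : (1 : ℝ) ≤ N := by
    have : (1 : ℝ) < N := by linarith [four_lt_barC Cf]
    linarith
  nlinarith

/-- The deviation of the output density from the target is at most the bias plus twice the averaged
negative mass. -/
theorem lintegral_deficiency_le (h : LinkBound f c N τ L) {Cf : ℕ} (hG : IsGaussianAnalytic f Cf c)
    (hN : barC Cf ≤ 2 * (N : ℝ) + 1) {θ : ℝ} (hθ : 10 ^ 4 * θ ^ 2 ≤ τ ^ 2) :
    ∫⁻ y, ‖(∫ x, markovKernel (targetDensity f τ) N y x * sourceDensity x θ) -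
        targetDensity f τ y θ‖ₑ ≤
      ENNReal.ofReal (5 * Real.exp (-rateExp Cf N)) +
        28 * ENNReal.ofReal (Real.exp (θ ^ 2 / 2 - τ ^ 2 / 8)) := by
  have hτ := h.τ_pos
  have hadm := h.admissible hθ
  have hSm := (continuous_signedKernel h.smooth τ N).measurable
  have hTm := measurable_markovKernel h.smooth τ N
  have hu := measurable_sourceDensity θ
  set S := signedKernel (targetDensity f τ) N
  set T := markovKernel (targetDensity f τ) N
  have hsplit : ∀ y, (∫ x, T y x * sourceDensity x θ) - targetDensity f τ y θ =
      ((∫ x, S y x * sourceDensity x θ) - targetDensity f τ y θ) +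
        ∫ x, (T y x - S y x) * sourceDensity x θ := by
    intro y
    have : ∫ x, (T y x - S y x) * sourceDensity x θ =
        (∫ x, T y x * sourceDensity x θ) - ∫ x, S y x * sourceDensity x θ := by
      rw [← integral_sub (integrable_markovKernel_mul_sourceDensity hG hτ hadm N y)
        (integrable_signedKernel_mul_sourceDensity hG hτ hadm N y)]
      simp only [sub_mul, S, T]
    rw [this]; ring
  have hmeasB : Measurable fun y =>
      ‖(∫ x, S y x * sourceDensity x θ) - targetDensity f τ y θ‖ₑ := by
    have h1 : StronglyMeasurable (Function.uncurry fun y x => S y x * sourceDensity x θ) :=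
      (hSm.mul (hu.comp measurable_snd)).stronglyMeasurable
    have h2 : Measurable fun y => targetDensity f τ y θ :=
      measurable_gaussianPDFReal _ _
    exact (h1.integral_prod_right.measurable.sub h2).enorm
  have hsecond : ∫⁻ y, ‖∫ x, (T y x - S y x) * sourceDensity x θ‖ₑ ≤
      ENNReal.ofReal (4 * Real.exp (-N)) +
        28 * ENNReal.ofReal (Real.exp (θ ^ 2 / 2 - τ ^ 2 / 8)) := by
    calc _ ≤ ∫⁻ y, ∫⁻ x, ‖T y x - S y x‖ₑ * ENNReal.ofReal (sourceDensity x θ) := by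
          refine lintegral_mono fun y => (enorm_integral_le_lintegral_enorm _).trans_eq
            (lintegral_congr fun x => ?_)
          rw [enorm_mul, Real.enorm_of_nonneg (sourceDensity_nonneg x θ)]
      _ = ∫⁻ x, ∫⁻ y, ‖T y x - S y x‖ₑ * ENNReal.ofReal (sourceDensity x θ) := by
          rw [lintegral_lintegral_swap]
          exact ((hTm.sub hSm).enorm.mul
            (hu.comp measurable_snd).ennreal_ofReal).aemeasurable
      _ ≤ ∫⁻ x, (ENNReal.ofReal (4 * Real.exp (-N)) * ENNReal.ofReal (sourceDensity x θ) +
            ENNReal.ofReal (14 * Real.exp (-τ ^ 2 / 8)) *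
              ENNReal.ofReal (Real.exp (x ^ 2 / 4) * sourceDensity x θ)) := by
          refine lintegral_mono fun x => ?_
          rw [lintegral_mul_const' _ _ ENNReal.ofReal_ne_top]
          refine (mul_le_mul_left ((lintegral_markovKernel_sub_le h.smooth τ N x).trans
            (mul_le_mul_right (h.lintegral_neg_signedKernel_le_add x) 2)) _).trans_eq ?_
          rw [ENNReal.ofReal_mul (Real.exp_pos (x ^ 2 / 4)).le,
            ENNReal.ofReal_mul (p := 2) (by norm_num), ENNReal.ofReal_mul (p := 4) (by norm_num),
            ENNReal.ofReal_mul (p := 7) (by norm_num), ENNReal.ofReal_mul (p := 14) (by norm_num),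
            show ENNReal.ofReal 2 = 2 by simp, show ENNReal.ofReal 4 = 4 by simp,
            show ENNReal.ofReal 7 = 7 by simp, show ENNReal.ofReal 14 = 14 by simp]
          ring
      _ ≤ ENNReal.ofReal (4 * Real.exp (-N)) * 1 + ENNReal.ofReal (14 * Real.exp (-τ ^ 2 / 8)) *
            ENNReal.ofReal (2 * Real.exp (θ ^ 2 / 2)) := by
          rw [lintegral_add_left (hu.ennreal_ofReal.const_mul _),
            lintegral_const_mul' _ _ ENNReal.ofReal_ne_top,
            lintegral_const_mul' _ _ ENNReal.ofReal_ne_top, lintegral_sourceDensity]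
          gcongr
          exact lintegral_exp_mul_sourceDensity_le θ
      _ = _ := by
          rw [mul_one, ← ENNReal.ofReal_mul (by positivity),
            show (28 : ℝ≥0∞) = ENNReal.ofReal 28 by simp, ← ENNReal.ofReal_mul (by norm_num)]
          congr 2
          rw [show θ ^ 2 / 2 - τ ^ 2 / 8 = -τ ^ 2 / 8 + θ ^ 2 / 2 by ring, Real.exp_add]
          ring
  calc _ ≤ ∫⁻ y, (‖(∫ x, S y x * sourceDensity x θ) - targetDensity f τ y θ‖ₑ +
        ‖∫ x, (T y x - S y x) * sourceDensity x θ‖ₑ) := by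
        refine lintegral_mono fun y => ?_
        rw [hsplit]
        exact enorm_add_le _ _
    _ ≤ ENNReal.ofReal (Real.exp (-rateExp Cf N)) + (ENNReal.ofReal (4 * Real.exp (-N)) +
        28 * ENNReal.ofReal (Real.exp (θ ^ 2 / 2 - τ ^ 2 / 8))) := by
        rw [lintegral_add_left hmeasB]
        exact add_le_add (h.lintegral_bias_le_rate hG hN hθ) hsecond
    _ ≤ _ := by
        rw [← add_assoc, ← ENNReal.ofReal_add (Real.exp_pos _).le (by positivity)]
        gcongr
        have : Real.exp (-(N : ℝ)) ≤ Real.exp (-rateExp Cf N) := by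
          gcongr; exact rateExp_le Cf N hN
        linarith

end LinkBound

/-! ### Programs: measurability and subroutine calls -/

section

variable {P : Primitives} {f : ℝ → ℝ}

lemma Instr.measurable_law (hf : Measurable f) {n : ℕ} (a : Instr P n) :
    Measurable fun s => a.law f s := by
  have hd : ∀ g : (Fin n → ℝ) → ℝ, Measurable g → Measurable fun s => Measure.dirac (g s) :=
    fun g hg => Measure.measurable_dirac.comp hg
  cases a with
  | const c => exact hd _ measurable_const
  | add i j => exact hd _ (by fun_prop)
  | sub i j => exact hd _ (by fun_prop)
  | mul i j => exact hd _ (by fun_prop)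
  | div i j => exact hd _ ((measurable_pi_apply i).div (measurable_pi_apply j))
  | exp i => exact hd _ (by fun_prop)
  | link i => exact hd _ (hf.comp (measurable_pi_apply i))
  | prim a args =>
    exact hd _ ((P.measurable_fn a).comp (measurable_pi_lambda _ fun l => measurable_pi_apply _))
  | unif => exact measurable_const
  | gauss => exact measurable_const

instance Instr.isProbabilityMeasure_law {n : ℕ} (a : Instr P n) (s : Fin n → ℝ) :
    IsProbabilityMeasure (a.law f s) := by
  cases a with
  | unif => exact ⟨by simp [Instr.law]⟩
  | _ => unfold Instr.law; infer_instance

lemma measurable_vecCons {n : ℕ} :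
    Measurable fun p : (Fin n → ℝ) × ℝ => (Matrix.vecCons p.2 p.1 : Fin (n + 1) → ℝ) := by
  refine measurable_pi_lambda _ fun i => ?_
  refine Fin.cases ?_ (fun j => ?_) i
  · exact measurable_snd
  · exact (measurable_pi_apply j).comp measurable_fst

lemma Program.measurable_law (hf : Measurable f) {n : ℕ} (p : Program P n) :
    Measurable fun s => p.law f s := by
  induction p with
  | halt i => exact Measure.measurable_dirac.comp (measurable_pi_apply i)
  | step a p ih =>
    refine Measure.measurable_of_measurable_coe _ fun A hA => ?_
    have h2 : Measurable fun q : (Fin _ → ℝ) × ℝ => p.law f (Matrix.vecCons q.2 q.1) :=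
      ih.comp measurable_vecCons
    let κ : Kernel (Fin _ → ℝ) ℝ := ⟨fun s => a.law f s, a.measurable_law hf⟩
    have : IsMarkovKernel κ := ⟨fun s => a.isProbabilityMeasure_law s⟩
    have h3 : ∀ s, (Program.step a p).law f s A =
        ∫⁻ z, p.law f (Matrix.vecCons z s) A ∂(κ s) := fun s => by
      rw [Program.law]
      exact Measure.bind_apply hA (h2.comp measurable_prodMk_left).aemeasurable
    simp only [h3]
    exact Measurable.lintegral_kernel_prod_right' (κ := κ)
      ((Measure.measurable_coe hA).comp h2)
  | branch i p q ihp ihq =>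
    simp only [Program.law]
    exact Measurable.ite (measurableSet_le (measurable_pi_apply i) measurable_const) ihp ihq

lemma Program.measurable_law_vecCons (hf : Measurable f) {n : ℕ} (p : Program P (n + 1))
    (s : Fin n → ℝ) : Measurable fun z => p.law f (Matrix.vecCons z s) :=
  ((p.measurable_law hf).comp measurable_vecCons).comp measurable_prodMk_left

lemma Program.isProbabilityMeasure_law (hf : Measurable f) {n : ℕ} (p : Program P n) :
    ∀ s, IsProbabilityMeasure (p.law f s) := by
  induction p with
  | halt i => intro s; unfold Program.law; infer_instance
  | step a p ih =>
    intro s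
    refine ⟨?_⟩
    rw [Program.law, Measure.bind_apply MeasurableSet.univ
      (p.measurable_law_vecCons hf s).aemeasurable]
    have : ∀ z, p.law f (Matrix.vecCons z s) Set.univ = 1 := fun z => (ih _).measure_univ
    simp [this]
  | branch i p q ihp ihq =>
    intro s
    unfold Program.law
    split_ifs
    · exact ihp s
    · exact ihq s

lemma Program.law_step_of_dirac (hf : Measurable f) {n : ℕ} (a : Instr P n)
    (p : Program P (n + 1)) (s : Fin n → ℝ) {v : ℝ} (hv : a.law f s = Measure.dirac v) :
    (Program.step a p).law f s = p.law f (Matrix.vecCons v s) := by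
  rw [Program.law, hv, Measure.dirac_bind]
  exact p.measurable_law_vecCons hf s

/-- The instruction that reads its arguments through the renaming `σ`. -/
def Instr.rename {m n : ℕ} (σ : Fin m → Fin n) : Instr P m → Instr P n
  | .const c => .const c
  | .add i j => .add (σ i) (σ j)
  | .sub i j => .sub (σ i) (σ j)
  | .mul i j => .mul (σ i) (σ j)
  | .div i j => .div (σ i) (σ j)
  | .exp i => .exp (σ i)
  | .link i => .link (σ i)
  | .prim a args => .prim a (fun l => σ (args l))
  | .unif => .unif
  | .gauss => .gauss

lemma Instr.law_rename {m n : ℕ} (σ : Fin m → Fin n) (a : Instr P m) (s : Fin n → ℝ) :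
    (a.rename σ).law f s = a.law f (s ∘ σ) := by
  cases a <;> rfl

lemma Instr.cost_rename {m n : ℕ} (σ : Fin m → Fin n) (a : Instr P m) :
    (a.rename σ).cost = a.cost := by
  cases a <;> rfl

/-- Run a program as a subroutine. The numbers it starts with are read through `σ`; wherever it
halts, the continuation `k` takes over. The continuation is told where the `n₀` numbers of the
caller (`ι`) and the output of the subroutine are to be found among the numbers then present. -/
def Program.call {n₀ : ℕ} (k : ∀ n, (Fin n₀ → Fin n) → Fin n → Program P n) :
    {m : ℕ} → Program P m → {n : ℕ} → (Fin m → Fin n) → (Fin n₀ → Fin n) → Program P n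
  | _, .halt i, n, σ, ι => k n ι (σ i)
  | _, .step a p, _, σ, ι =>
      .step (a.rename σ) (p.call k (Fin.cons 0 (Fin.succ ∘ σ)) (Fin.succ ∘ ι))
  | _, .branch i p q, _, σ, ι => .branch (σ i) (p.call k σ ι) (q.call k σ ι)

lemma Program.cost_call_le {n₀ : ℕ} {k : ∀ n, (Fin n₀ → Fin n) → Fin n → Program P n} {c : ℕ}
    (hk : ∀ n ι i, (k n ι i).cost ≤ c) {m : ℕ} (E : Program P m) :
    ∀ {n : ℕ} (σ : Fin m → Fin n) (ι : Fin n₀ → Fin n), (E.call k σ ι).cost ≤ E.cost + c := by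
  induction E with
  | halt i => intro n σ ι; exact (hk _ _ _).trans (by simp [Program.cost])
  | step a p ih =>
    intro n σ ι
    have := ih (Fin.cons 0 (Fin.succ ∘ σ)) (Fin.succ ∘ ι)
    simp only [Program.call, Program.cost, Instr.cost_rename]
    omega
  | branch i p q ihp ihq =>
    intro n σ ι
    have h1 := ihp σ ι
    have h2 := ihq σ ι
    simp only [Program.call, Program.cost]
    omega

lemma Program.measurable_of_law_eq (hf : Measurable f) {n₀ : ℕ}
    {k : ∀ n, (Fin n₀ → Fin n) → Fin n → Program P n} {G : (Fin n₀ → ℝ) → ℝ → Measure ℝ}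
    (hk : ∀ n ι i (s : Fin n → ℝ), (k n ι i).law f s = G (s ∘ ι) (s i)) (r : Fin n₀ → ℝ) :
    Measurable (G r) := by
  have h1 : ∀ w, G r w = (k (n₀ + 1) Fin.succ 0).law f (Matrix.vecCons w r) := fun w => by
    rw [hk]; rfl
  simp only [funext h1]
  exact (k (n₀ + 1) Fin.succ 0).measurable_law_vecCons hf r

lemma Program.law_call (hf : Measurable f) {n₀ : ℕ}
    {k : ∀ n, (Fin n₀ → Fin n) → Fin n → Program P n} {G : (Fin n₀ → ℝ) → ℝ → Measure ℝ}
    (hk : ∀ n ι i (s : Fin n → ℝ), (k n ι i).law f s = G (s ∘ ι) (s i)) {m : ℕ}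
    (E : Program P m) :
    ∀ {n : ℕ} (σ : Fin m → Fin n) (ι : Fin n₀ → Fin n) (s : Fin n → ℝ),
      (E.call k σ ι).law f s = (E.law f (s ∘ σ)).bind (G (s ∘ ι)) := by
  have hG := Program.measurable_of_law_eq hf hk
  induction E with
  | halt i =>
    intro n σ ι s
    simp only [Program.call, Program.law]
    rw [hk, Measure.dirac_bind (hG _)]
    rfl
  | step a p ih =>
    intro n σ ι s
    simp only [Program.call, Program.law, Instr.law_rename]
    rw [Measure.bind_bind (p.measurable_law_vecCons hf _).aemeasurable (hG _).aemeasurable]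
    congr 1
    funext z
    rw [ih]
    congr 2
    funext j
    refine Fin.cases ?_ (fun j => ?_) j <;> simp
  | branch i p q ihp ihq =>
    intro n σ ι s
    simp only [Program.call, Program.law, Function.comp_apply]
    split_ifs
    · exact ihp σ ι s
    · exact ihq σ ι s

/-! ### Rejection sampling -/

/-- The threshold constant `4 / √(4π)`: at `y = m + √2 g`, four times the density of `N(m, 2)` is
`acceptConst * exp(-g²/2)`. -/
def acceptConst : ℝ := 4 * (√(4 * Real.pi))⁻¹

/-- The law of the output of `t` rounds of rejection sampling from `S(· | x)`, with proposals from
`N(f(x/τ), 2)`. If every round rejects, the output is `x`. -/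
def rejectionLaw (f : ℝ → ℝ) (τ : ℝ) (S : ℝ → ℝ → ℝ) : ℕ → ℝ → Measure ℝ
  | 0, x => Measure.dirac x
  | t + 1, x => (gaussianReal 0 1).bind fun g =>
      (volume.restrict (Set.Icc (0 : ℝ) 1)).bind fun u =>
        if u * acceptConst - S (f (x / τ) + g * √2) x * Real.exp (g * g * (1 / 2)) ≤ 0 then
          Measure.dirac (f (x / τ) + g * √2)
        else rejectionLaw f τ S t x

/-- The acceptance step: `ι` locates the proposal `y` (index `0`) and the Gaussian sample `g`
(index `3`) of the caller, `i` the value of the kernel. It goes on with `q` upon rejection. -/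
def acceptStep {n₀ : ℕ} (q : ∀ n, (Fin (n₀ + 4) → Fin n) → Program P n) (n : ℕ)
    (ι : Fin (n₀ + 4) → Fin n) (i : Fin n) : Program P n :=
  .step (.mul (ι (Fin.succ (Fin.succ (Fin.succ 0)))) (ι (Fin.succ (Fin.succ (Fin.succ 0))))) <|
  .step (.const (1 / 2)) <|
  .step (.mul (Fin.succ 0) 0) <|
  .step (.exp 0) <|
  .step (.mul i.succ.succ.succ.succ 0) <|
  .step .unif <|
  .step (.const acceptConst) <|
  .step (.mul (Fin.succ 0) 0) <|
  .step (.sub 0 (Fin.succ (Fin.succ (Fin.succ 0)))) <|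
  .branch 0 (.halt (ι 0).succ.succ.succ.succ.succ.succ.succ.succ.succ)
    (q _ fun j => (ι j).succ.succ.succ.succ.succ.succ.succ.succ.succ)

/-- The program of `rejectionLaw`, with the input `x` at index `j` and `E` evaluating `S`. -/
def rejection (E : Program P 2) (τ : ℝ) : ℕ → {n : ℕ} → Fin n → Program P n
  | 0, _, j => .halt j
  | t + 1, _, j =>
    .step (.const τ) <|
    .step (.div j.succ 0) <|
    .step (.link 0) <|
    .step .gauss <|
    .step (.const √2) <|
    .step (.mul (Fin.succ 0) 0) <|
    .step (.add (Fin.succ (Fin.succ (Fin.succ 0))) 0) <|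
    E.call (acceptStep fun _ ι => rejection E τ t (ι j.succ.succ.succ.succ.succ.succ.succ))
      ![j.succ.succ.succ.succ.succ.succ.succ, 0] id

lemma law_acceptStep (hf : Measurable f) {n₀ : ℕ} {q : ∀ n, (Fin (n₀ + 4) → Fin n) → Program P n}
    {Q : (Fin (n₀ + 4) → ℝ) → Measure ℝ} (hq : ∀ n ι (s : Fin n → ℝ), (q n ι).law f s = Q (s ∘ ι))
    (n : ℕ) (ι : Fin (n₀ + 4) → Fin n) (i : Fin n) (s : Fin n → ℝ) :
    (acceptStep q n ι i).law f s = (volume.restrict (Set.Icc (0 : ℝ) 1)).bind fun u =>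
      if u * acceptConst - s i * Real.exp (s (ι (Fin.succ (Fin.succ (Fin.succ 0)))) *
          s (ι (Fin.succ (Fin.succ (Fin.succ 0)))) * (1 / 2)) ≤ 0 then
        Measure.dirac (s (ι 0)) else Q (s ∘ ι) := by
  unfold acceptStep
  rw [Program.law_step_of_dirac hf _ _ _ rfl, Program.law_step_of_dirac hf _ _ _ rfl,
    Program.law_step_of_dirac hf _ _ _ rfl, Program.law_step_of_dirac hf _ _ _ rfl,
    Program.law_step_of_dirac hf _ _ _ rfl, Program.law]
  congr 1
  funext u
  rw [Program.law_step_of_dirac hf _ _ _ rfl, Program.law_step_of_dirac hf _ _ _ rfl,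
    Program.law_step_of_dirac hf _ _ _ rfl, Program.law, Program.law, hq]
  rfl

lemma law_rejection (hf : Measurable f) {E : Program P 2} {S : ℝ → ℝ → ℝ} (hE : Evaluates f E S)
    (τ : ℝ) (t : ℕ) :
    ∀ {n : ℕ} (j : Fin n) (s : Fin n → ℝ),
      (rejection E τ t j).law f s = rejectionLaw f τ S t (s j) := by
  induction t with
  | zero => intro n j s; rfl
  | succ t ih =>
    intro n j s
    rw [rejection, Program.law_step_of_dirac hf _ _ _ rfl, Program.law_step_of_dirac hf _ _ _ rfl,
      Program.law_step_of_dirac hf _ _ _ rfl, Program.law, rejectionLaw]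
    congr 1
    funext g
    rw [Program.law_step_of_dirac hf _ _ _ rfl, Program.law_step_of_dirac hf _ _ _ rfl,
      Program.law_step_of_dirac hf _ _ _ rfl]
    set w : Fin (n + 7) → ℝ := _
    change (Program.call _ E _ _).law f w = _
    have hk := fun (n' : ℕ) (ι : Fin (n + 3 + 4) → Fin n') (i : Fin n') (s : Fin n' → ℝ) =>
      law_acceptStep hf (q := fun _ ι => rejection E τ t (ι j.succ.succ.succ.succ.succ.succ.succ))
        (Q := fun r => rejectionLaw f τ S t (r j.succ.succ.succ.succ.succ.succ.succ))
        (fun n' ι s => ih _ s) n' ι i s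
    let G : (Fin (n + 3 + 4) → ℝ) → ℝ → Measure ℝ := fun r w =>
      (volume.restrict (Set.Icc (0 : ℝ) 1)).bind fun u =>
        if u * acceptConst - w * Real.exp (r (Fin.succ (Fin.succ (Fin.succ 0))) *
            r (Fin.succ (Fin.succ (Fin.succ 0))) * (1 / 2)) ≤ 0 then
          Measure.dirac (r 0)
        else rejectionLaw f τ S t (r j.succ.succ.succ.succ.succ.succ.succ)
    rw [Program.law_call hf (G := G) hk]
    have hσ : w ∘ ![j.succ.succ.succ.succ.succ.succ.succ, 0] = ![s j, f (s j / τ) + g * √2] := by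
      funext i
      fin_cases i <;> rfl
    rw [hσ, hE, Measure.dirac_bind (Program.measurable_of_law_eq hf (G := G) hk _)]
    rfl

/-- Besides one call of `E`, a round takes at most `18` units of time; the output takes one. -/
lemma cost_rejection_le (E : Program P 2) (τ : ℝ) (t : ℕ) :
    ∀ {n : ℕ} (j : Fin n), (rejection E τ t j).cost ≤ t * (E.cost + 18) + 1 := by
  induction t with
  | zero => intro n j; simp [rejection, Program.cost]
  | succ t ih =>
    intro n j
    have h := Program.cost_call_le (c := 10 + (t * (E.cost + 18) + 1))
      (k := acceptStep fun _ ι => rejection E τ t (ι j.succ.succ.succ.succ.succ.succ.succ))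
      (fun n' ι i => by
        have := ih
          ((ι j.succ.succ.succ.succ.succ.succ.succ).succ.succ.succ.succ.succ.succ.succ.succ.succ)
        simp only [acceptStep, Program.cost, Instr.cost]
        omega) E ![j.succ.succ.succ.succ.succ.succ.succ, 0] id
    simp only [rejection, Program.cost, Instr.cost]
    have e : (t + 1) * (E.cost + 18) = t * (E.cost + 18) + (E.cost + 18) := by ring
    omega

end

/-! ### The law of rejection sampling -/

lemma acceptConst_mul_exp (m g : ℝ) :
    acceptConst * Real.exp (-(g * g * (1 / 2))) = 4 * gaussianPDFReal m 2 (m + g * √2) := by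
  have h2 : √2 ^ 2 = (2 : ℝ) := Real.sq_sqrt (by norm_num)
  rw [acceptConst, gaussianPDFReal_def, mul_assoc]
  congr 2
  · congr 2
    push_cast
    ring
  · congr 1
    push_cast
    rw [add_sub_cancel_left, mul_pow, h2]
    ring

/-- The acceptance condition compares a uniform variable with `S / (4 q)`, where `q` is the density
of the proposal. -/
lemma accept_iff (m g u s : ℝ) :
    u * acceptConst - s * Real.exp (g * g * (1 / 2)) ≤ 0 ↔
      u ≤ s / (4 * gaussianPDFReal m 2 (m + g * √2)) := by
  have hq : 0 < gaussianPDFReal m 2 (m + g * √2) := gaussianPDFReal_pos _ _ _ two_ne_zero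
  rw [le_div_iff₀ (by positivity), ← acceptConst_mul_exp, sub_nonpos, Real.exp_neg, ← mul_assoc,
    ← div_eq_mul_inv, div_le_iff₀ (Real.exp_pos _)]

lemma map_gaussianReal_affine (m : ℝ) :
    (gaussianReal 0 1).map (fun g => m + g * √2) = gaussianReal m 2 := by
  have h1 : (fun g : ℝ => m + g * √2) = (fun z => m + z) ∘ fun g => g * √2 := rfl
  rw [h1, ← Measure.map_map (by fun_prop) (by fun_prop), gaussianReal_map_mul_const,
    gaussianReal_map_const_add]
  congr 1
  · simp
  · ext
    simp

lemma lintegral_uniform_ite {c : ℝ} (hc : c ≤ 1) (a b : ℝ≥0∞) :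
    ∫⁻ u in Set.Icc (0 : ℝ) 1, (if u ≤ c then a else b) =
      ENNReal.ofReal (max c 0) * a + ENNReal.ofReal (1 - max c 0) * b := by
  have hP : IsProbabilityMeasure (volume.restrict (Set.Icc (0 : ℝ) 1)) := ⟨by simp⟩
  have hs : MeasurableSet {u : ℝ | u ≤ c} := measurableSet_Iic
  have h1 : volume.restrict (Set.Icc (0 : ℝ) 1) {u | u ≤ c} = ENNReal.ofReal (max c 0) := by
    rw [Measure.restrict_apply hs]
    have : {u : ℝ | u ≤ c} ∩ Set.Icc 0 1 = Set.Icc 0 c := by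
      ext u
      simp only [Set.mem_inter_iff, Set.mem_ofPred_eq, Set.mem_Icc]
      constructor
      · rintro ⟨h1, h2, -⟩; exact ⟨h2, h1⟩
      · rintro ⟨h1, h2⟩; exact ⟨h2, h1, h2.trans hc⟩
    rw [this, Real.volume_Icc, sub_zero, ENNReal.ofReal_max, ENNReal.ofReal_zero, max_eq_left]
    exact zero_le
  have h2 : volume.restrict (Set.Icc (0 : ℝ) 1) {u | u ≤ c}ᶜ =
      ENNReal.ofReal (1 - max c 0) := by
    rw [prob_compl_eq_one_sub hs, h1, ENNReal.ofReal_sub _ (le_max_right _ _), ENNReal.ofReal_one]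
  rw [← lintegral_add_compl _ hs, setLIntegral_congr_fun hs (g := fun _ => a),
    setLIntegral_congr_fun hs.compl (g := fun _ => b)]
  · rw [setLIntegral_const, setLIntegral_const, h1, h2, mul_comm a, mul_comm b]
  · intro u hu
    exact if_neg hu
  · intro u hu
    exact if_pos hu

/-- One round of rejection sampling with target density proportional to `max S 0`. -/
lemma rejection_round {S : ℝ → ℝ} (hS : Measurable S) (hSi : Integrable S) {m : ℝ}
    (hle : ∀ y, S y ≤ 4 * gaussianPDFReal m 2 y) (Q : Measure ℝ)
    {A : Set ℝ} (hA : MeasurableSet A) :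
    ((gaussianReal 0 1).bind fun g => (volume.restrict (Set.Icc (0 : ℝ) 1)).bind fun u =>
      if u * acceptConst - S (m + g * √2) * Real.exp (g * g * (1 / 2)) ≤ 0 then
        Measure.dirac (m + g * √2) else Q) A =
      ENNReal.ofReal (1 / 4 * ∫ y in A, max (S y) 0) +
        ENNReal.ofReal (1 - 1 / 4 * ∫ y, max (S y) 0) * Q A := by
  have hq : ∀ y, 0 < gaussianPDFReal m 2 y := fun y => gaussianPDFReal_pos _ _ _ two_ne_zero
  have hqm : Measurable (gaussianPDFReal m 2) := measurable_gaussianPDFReal m 2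
  have hqi : Integrable (gaussianPDFReal m 2) := integrable_gaussianPDFReal m 2
  have hSp : Integrable fun y => max (S y) 0 := hSi.pos_part
  -- joint measurability in the two samples
  have hJ : Measurable fun p : ℝ × ℝ =>
      if p.2 * acceptConst - S (m + p.1 * √2) * Real.exp (p.1 * p.1 * (1 / 2)) ≤ 0 then
        Measure.dirac (m + p.1 * √2) else Q := by
    refine Measurable.ite (measurableSet_le ?_ measurable_const)
      (Measure.measurable_dirac.comp (by fun_prop)) measurable_const
    exact (measurable_snd.mul_const _).sub
      ((hS.comp (by fun_prop)).mul (by fun_prop))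
  have hin : ∀ (g : ℝ) {B : Set ℝ}, MeasurableSet B →
      ((volume.restrict (Set.Icc (0 : ℝ) 1)).bind fun u =>
        if u * acceptConst - S (m + g * √2) * Real.exp (g * g * (1 / 2)) ≤ 0 then
          Measure.dirac (m + g * √2) else Q) B =
      ∫⁻ u in Set.Icc (0 : ℝ) 1,
        (if u * acceptConst - S (m + g * √2) * Real.exp (g * g * (1 / 2)) ≤ 0 then
          Measure.dirac (m + g * √2) else Q) B := fun g B hB =>
    Measure.bind_apply hB (hJ.comp measurable_prodMk_left).aemeasurable
  have hout : Measurable fun g => (volume.restrict (Set.Icc (0 : ℝ) 1)).bind fun u =>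
      if u * acceptConst - S (m + g * √2) * Real.exp (g * g * (1 / 2)) ≤ 0 then
        Measure.dirac (m + g * √2) else Q := by
    refine Measure.measurable_of_measurable_coe _ fun B hB => ?_
    simp only [hin _ hB]
    exact ((Measure.measurable_coe hB).comp hJ).lintegral_prod_right'
  -- the conditional probability of `A`, as a function of the proposal
  let F : ℝ → ℝ≥0∞ := fun y =>
    ENNReal.ofReal (max (S y / (4 * gaussianPDFReal m 2 y)) 0) * A.indicator 1 y +
      ENNReal.ofReal (1 - max (S y / (4 * gaussianPDFReal m 2 y)) 0) * Q A
  have hF : Measurable F := by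
    have h0 : Measurable fun y => max (S y / (4 * gaussianPDFReal m 2 y)) 0 :=
      (hS.div (hqm.const_mul 4)).max measurable_const
    exact (h0.ennreal_ofReal.mul (measurable_one.indicator hA)).add
      ((measurable_const.sub h0).ennreal_ofReal.mul_const _)
  have hround : ∀ g, ((volume.restrict (Set.Icc (0 : ℝ) 1)).bind fun u =>
      if u * acceptConst - S (m + g * √2) * Real.exp (g * g * (1 / 2)) ≤ 0 then
        Measure.dirac (m + g * √2) else Q) A = F (m + g * √2) := by
    intro g
    rw [hin g hA]
    have h4 : S (m + g * √2) / (4 * gaussianPDFReal m 2 (m + g * √2)) ≤ 1 := by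
      rw [div_le_one (by linarith [hq (m + g * √2)])]
      exact hle _
    simp only [F]
    rw [← lintegral_uniform_ite h4]
    refine lintegral_congr fun u => ?_
    simp only [accept_iff m]
    split_ifs
    · exact Measure.dirac_apply' _ hA
    · rfl
  have hpt : ∀ y, gaussianPDF m 2 y * F y =
      A.indicator (fun y => ENNReal.ofReal (1 / 4 * max (S y) 0)) y +
        ENNReal.ofReal (gaussianPDFReal m 2 y - 1 / 4 * max (S y) 0) * Q A := by
    intro y
    have h5 : gaussianPDFReal m 2 y * max (S y / (4 * gaussianPDFReal m 2 y)) 0 =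
        1 / 4 * max (S y) 0 := by
      have := (hq y).ne'
      rw [mul_max_of_nonneg _ _ (hq y).le, mul_max_of_nonneg _ _ (by norm_num : (0:ℝ) ≤ 1 / 4)]
      congr 1
      · field_simp
      · simp
    simp only [F, gaussianPDF]
    rw [mul_add, ← mul_assoc, ← mul_assoc, ← ENNReal.ofReal_mul (hq y).le,
      ← ENNReal.ofReal_mul (hq y).le, mul_sub, h5, mul_one]
    congr 1
    by_cases hy : y ∈ A <;> simp [hy]
  rw [Measure.bind_apply hA hout.aemeasurable]
  simp only [hround]
  rw [← lintegral_map (f := F) (g := fun g => m + g * √2) hF (by fun_prop),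
    map_gaussianReal_affine, gaussianReal_of_var_ne_zero m two_ne_zero,
    lintegral_withDensity_eq_lintegral_mul _ (measurable_gaussianPDF m 2) hF]
  simp only [Pi.mul_apply, hpt]
  have hRm : Measurable fun y =>
      ENNReal.ofReal (gaussianPDFReal m 2 y - 1 / 4 * max (S y) 0) :=
    (hqm.sub ((hS.max measurable_const).const_mul _)).ennreal_ofReal
  have hSpm : Measurable fun y => ENNReal.ofReal (1 / 4 * max (S y) 0) :=
    ((hS.max measurable_const).const_mul _).ennreal_ofReal
  rw [lintegral_add_left (hSpm.indicator hA), lintegral_indicator hA,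
    lintegral_mul_const _ hRm]
  congr 2
  · rw [← integral_const_mul, ofReal_integral_eq_lintegral_ofReal
      (hSp.const_mul _).integrableOn (ae_of_all _ fun y => by positivity)]
  · rw [← integral_const_mul]
    nth_rewrite 2 [← integral_gaussianPDFReal_eq_one m two_ne_zero]
    rw [← integral_sub hqi (hSp.const_mul _)]
    refine (ofReal_integral_eq_lintegral_ofReal (hqi.sub (hSp.const_mul _))
      (ae_of_all _ fun y => ?_)).symm
    have h1 := hle y
    have h2 := hq y
    have : max (S y) 0 ≤ 4 * gaussianPDFReal m 2 y := max_le h1 (by linarith)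
    simp only [Pi.zero_apply, Pi.sub_apply]
    linarith

namespace LinkBound

variable {c τ L : ℝ} {N : ℕ} {f : ℝ → ℝ}

lemma kernelMass_le_four (h : LinkBound f c N τ L) {x : ℝ} (hx : |x| ≤ τ) :
    kernelMass f τ N x ≤ 4 := by
  calc kernelMass f τ N x ≤ ∫ y, 4 * gaussianPDFReal (f (x / τ)) 2 y := by
        refine integral_mono (integrable_max_signedKernel h.smooth τ N x)
          ((integrable_gaussianPDFReal _ 2).const_mul 4) fun y => ?_
        exact max_le (h.signedKernel_le_proposal hx y)
          (mul_nonneg (by norm_num) (gaussianPDFReal_nonneg _ _ _))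
    _ = 4 := by
        rw [integral_const_mul, integral_gaussianPDFReal_eq_one _ two_ne_zero, mul_one]

/-- Each round accepts with probability at least `1/4`, and the output given acceptance has density
`markovKernel`; so the error decays geometrically. -/
lemma rejectionLaw_apply_le (h : LinkBound f c N τ L) {x : ℝ} (hx : |x| ≤ τ) {A : Set ℝ}
    (hA : MeasurableSet A) (t : ℕ) :
    rejectionLaw f τ (signedKernel (targetDensity f τ) N) t x A ≤
      ENNReal.ofReal ((∫ y in A, markovKernel (targetDensity f τ) N y x) + (3 / 4) ^ t) := by
  have hk : 0 ≤ ∫ y in A, markovKernel (targetDensity f τ) N y x :=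
    integral_nonneg fun y => markovKernel_nonneg h.smooth τ N y x
  have hp1 := one_le_kernelMass h.smooth τ N x
  have hp4 := h.kernelMass_le_four hx
  induction t with
  | zero =>
    -- without any round the error is at most one
    rw [rejectionLaw, pow_zero]
    refine prob_le_one.trans ?_
    rw [← ENNReal.ofReal_one]
    exact ENNReal.ofReal_le_ofReal (by linarith)
  | succ t ih =>
    have hSm : Measurable fun y => signedKernel (targetDensity f τ) N y x := by
      have h1 := (continuous_signedKernel h.smooth τ N).measurable
      generalize signedKernel (targetDensity f τ) N = S at h1
      exact h1.comp measurable_prodMk_right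
    have hT : ∫ y in A, max (signedKernel (targetDensity f τ) N y x) 0 =
        kernelMass f τ N x * ∫ y in A, markovKernel (targetDensity f τ) N y x := by
      simp only [markovKernel_eq]
      rw [integral_div, mul_div_cancel₀]
      positivity
    have hr := rejection_round hSm (integrable_signedKernel h.smooth τ N x)
      (h.signedKernel_le_proposal hx)
      (rejectionLaw f τ (signedKernel (targetDensity f τ) N) t x) hA
    rw [hT, ← kernelMass] at hr
    rw [rejectionLaw]
    refine hr.le.trans ?_
    refine (add_le_add le_rfl (mul_le_mul_right ih _)).trans ?_
    rw [← ENNReal.ofReal_mul (by linarith), ← ENNReal.ofReal_add (by positivity)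
      (mul_nonneg (by linarith) (by positivity))]
    apply ENNReal.ofReal_le_ofReal
    have h3 : (0 : ℝ) ≤ (3 / 4) ^ t := by positivity
    rw [pow_succ]
    nlinarith

end LinkBound

/-! ### Assembling the two parts -/

/-- The condition on `τ` forces both suprema to be finite, because its other factors are nonzero. -/
lemma exists_linkBound {f : ℝ → ℝ} {Cf : ℕ} {c : ℝ} (hG : IsGaussianAnalytic f Cf c) {Θ : Set ℝ}
    {N : ℕ} {τ : ℝ} (hτ : 0 < τ) (hN : barC Cf ≤ 2 * (N : ℝ) + 1)
    (H : ENNReal.ofReal (10 ^ 4) *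
      max (ENNReal.ofReal (max c 1) ^ 4 *
          (max (max (linkL f c (2 * N)) (linkLTilde f c (2 * N) τ)) 1) ^ 2 * (N : ℝ≥0∞) ^ 2)
        (supSq Θ) ≤ ENNReal.ofReal (τ ^ 2)) :
    ∃ L, LinkBound f c N τ L ∧ ∀ θ ∈ Θ, 10 ^ 4 * θ ^ 2 ≤ τ ^ 2 := by
  have hN1 : 1 ≤ N := by
    have : (1 : ℝ) < N := by linarith [four_lt_barC Cf]
    exact_mod_cast this.le
  set M := max (max (linkL f c (2 * N)) (linkLTilde f c (2 * N) τ)) 1 with hM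
  have hM1 : 1 ≤ M := le_max_right _ _
  have h1 := (mul_le_mul_right (le_max_left _ _) _).trans H
  have h2 := (mul_le_mul_right (le_max_right _ _) _).trans H
  have hMtop : M ≠ ⊤ := by
    intro hT
    refine (lt_of_le_of_lt h1 ENNReal.ofReal_lt_top).ne ?_
    have ha : ENNReal.ofReal (max c 1) ^ 4 ≠ 0 :=
      pow_ne_zero _ (ENNReal.ofReal_pos.2 (lt_max_of_lt_right one_pos)).ne'
    have hb : (N : ℝ≥0∞) ^ 2 ≠ 0 := pow_ne_zero _ (by exact_mod_cast (by omega : N ≠ 0))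
    rw [hT, ENNReal.top_pow two_ne_zero, ENNReal.mul_top ha, ENNReal.top_mul hb,
      ENNReal.mul_top (ENNReal.ofReal_pos.2 (by norm_num)).ne']
  refine ⟨M.toReal, ⟨hG.smooth, hG.pos, hτ, hN1, ?_, ?_, ?_, ?_⟩, ?_⟩
  · rw [← ENNReal.toReal_one]
    exact (ENNReal.toReal_le_toReal ENNReal.one_ne_top hMtop).2 hM1
  · intro x hx
    rw [← ENNReal.ofReal_le_iff_le_toReal hMtop]
    exact (le_iSup₂ (f := fun (x : ℝ) (_ : |x| ≤ 1) => ENNReal.ofReal (derivSum f c (2 * N) x))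
      x hx).trans ((le_max_left _ _).trans (le_max_left _ _))
  · intro x hx
    rw [← ENNReal.ofReal_le_iff_le_toReal hMtop]
    exact (le_iSup₂ (f := fun (x : ℝ) (_ : 1 ≤ |x|) => ENNReal.ofReal
      (derivSum f c (2 * N) x * Real.exp (-(τ ^ 2 * x ^ 2 / (8 * (2 * N : ℕ))))))
      x hx).trans ((le_max_right _ _).trans (le_max_left _ _))
  · rw [← ENNReal.ofReal_toReal hMtop, ← ENNReal.ofReal_natCast,
      ← ENNReal.ofReal_pow (by positivity),
      ← ENNReal.ofReal_pow (by positivity), ← ENNReal.ofReal_pow (by positivity),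
      ← ENNReal.ofReal_mul (by positivity), ← ENNReal.ofReal_mul (by positivity),
      ← ENNReal.ofReal_mul (by positivity), ENNReal.ofReal_le_ofReal_iff (by positivity)] at h1
    exact h1
  · intro θ hθ
    have h3 := (mul_le_mul_right (le_iSup₂ (f := fun (θ : ℝ) (_ : θ ∈ Θ) => ENNReal.ofReal (θ ^ 2))
      θ hθ) (ENNReal.ofReal (10 ^ 4))).trans h2
    rw [← ENNReal.ofReal_mul (by positivity), ENNReal.ofReal_le_ofReal_iff (by positivity)] at h3
    exact h3

/-- An upper bound `μ A ≤ ν A + δ` for all `A` is two-sided, because it applies to `Aᶜ`. -/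
lemma tvDist_le_of_forall_le {μ ν : Measure ℝ} [IsProbabilityMeasure μ] [IsProbabilityMeasure ν]
    {δ : ℝ} (hδ : 0 ≤ δ) (h : ∀ A, MeasurableSet A → μ A ≤ ν A + ENNReal.ofReal δ) :
    tvDist μ ν ≤ ENNReal.ofReal δ := by
  have hr : ∀ A, MeasurableSet A → μ.real A ≤ ν.real A + δ := fun A hA => by
    have h1 := ENNReal.toReal_mono
      (ENNReal.add_ne_top.2 ⟨measure_ne_top ν A, ENNReal.ofReal_ne_top⟩) (h A hA)
    rwa [ENNReal.toReal_add (measure_ne_top ν A) ENNReal.ofReal_ne_top,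
      ENNReal.toReal_ofReal hδ] at h1
  refine iSup₂_le fun A hA => ENNReal.ofReal_le_ofReal ?_
  have h1 := hr A hA
  have h2 := hr Aᶜ hA.compl
  rw [probReal_compl_eq_one_sub hA, probReal_compl_eq_one_sub hA] at h2
  rw [abs_le]
  constructor <;> linarith

namespace LinkBound

variable {c τ L : ℝ} {N : ℕ} {f : ℝ → ℝ}

/-- Inputs `|x| > τ`, for which rejection sampling may fail, have small probability. -/
lemma gaussianReal_tail_le (hτ : 0 < τ) (θ : ℝ) :
    gaussianReal θ 1 {x | τ < |x|} ≤
      ENNReal.ofReal (2 * Real.exp (θ ^ 2 / 2 - τ ^ 2 / 8)) := by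
  have hs : MeasurableSet {x : ℝ | τ < |x|} := measurableSet_lt measurable_const (by fun_prop)
  rw [gaussianReal_apply _ one_ne_zero]
  calc ∫⁻ x in {x : ℝ | τ < |x|}, gaussianPDF θ 1 x
      ≤ ∫⁻ x, ENNReal.ofReal (Real.exp (-τ ^ 2 / 4)) *
          ENNReal.ofReal (Real.exp (x ^ 2 / 4) * sourceDensity x θ) := by
        rw [← lintegral_indicator hs]
        refine lintegral_mono fun x => ?_
        by_cases hx : τ < |x|
        · rw [Set.indicator_of_mem (show x ∈ {x : ℝ | τ < |x|} from hx),
            ← ENNReal.ofReal_mul (Real.exp_pos _).le, ← mul_assoc, ← Real.exp_add]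
          refine ENNReal.ofReal_le_ofReal ?_
          have h1 : τ ^ 2 ≤ x ^ 2 := by rw [← sq_abs x]; gcongr
          exact le_mul_of_one_le_left (sourceDensity_nonneg x θ)
            (Real.one_le_exp (by linarith))
        · rw [Set.indicator_of_notMem (show x ∉ {x : ℝ | τ < |x|} from hx)]
          exact zero_le
    _ ≤ ENNReal.ofReal (Real.exp (-τ ^ 2 / 4)) * ENNReal.ofReal (2 * Real.exp (θ ^ 2 / 2)) := by
        rw [lintegral_const_mul' _ _ ENNReal.ofReal_ne_top]
        exact mul_le_mul_right (lintegral_exp_mul_sourceDensity_le θ) _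
    _ ≤ ENNReal.ofReal (2 * Real.exp (θ ^ 2 / 2 - τ ^ 2 / 8)) := by
        rw [← ENNReal.ofReal_mul (Real.exp_pos _).le, mul_left_comm, ← Real.exp_add]
        gcongr
        nlinarith [sq_nonneg τ]

/-- The error of `t` rounds on inputs `|x| ≤ τ`, the deficiency, and the probability of `|x| > τ`
add up. -/
theorem tvDist_rejectionLaw_le (h : LinkBound f c N τ L) {Cf : ℕ} (hG : IsGaussianAnalytic f Cf c)
    (hN : barC Cf ≤ 2 * (N : ℝ) + 1) {θ : ℝ} (hθ : 10 ^ 4 * θ ^ 2 ≤ τ ^ 2) (t : ℕ)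
    {R : ℝ → Measure ℝ} (hRm : Measurable R) (hRp : ∀ x, IsProbabilityMeasure (R x))
    (hR : ∀ x, R x = rejectionLaw f τ (signedKernel (targetDensity f τ) N) t x) :
    tvDist ((gaussianReal θ 1).bind R) (gaussianReal (f (θ / τ)) 1) ≤
      ENNReal.ofReal ((3 / 4) ^ t + 5 * Real.exp (-rateExp Cf N) +
        30 * Real.exp (θ ^ 2 / 2 - τ ^ 2 / 8)) := by
  have hf := h.smooth
  have hτ := h.τ_pos
  have hP : IsProbabilityMeasure ((gaussianReal θ 1).bind R) := by
    refine ⟨?_⟩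
    rw [Measure.bind_apply MeasurableSet.univ hRm.aemeasurable]
    simp [(hRp _).measure_univ]
  refine tvDist_le_of_forall_le (by positivity) fun A hA => ?_
  set e := Real.exp (θ ^ 2 / 2 - τ ^ 2 / 8) with he
  have hD := h.lintegral_deficiency_le hG hN hθ
  have hTm := measurable_markovKernel hf τ N
  have hT0 := markovKernel_nonneg hf τ N
  have hTi := integrable_markovKernel hf τ N
  have hTu := integrable_markovKernel_mul_sourceDensity hG hτ (h.admissible hθ) N
  have hR1 : ∀ x, |x| ≤ τ → R x A ≤ ENNReal.ofReal
      ((∫ y in A, markovKernel (targetDensity f τ) N y x) + (3 / 4) ^ t) := fun x hx => by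
    rw [hR]; exact h.rejectionLaw_apply_le hx hA t
  generalize markovKernel (targetDensity f τ) N = T at hD hTm hT0 hTi hTu hR1
  have hR2 : ∀ x, R x A ≤ (∫⁻ y in A, ENNReal.ofReal (T y x)) + ENNReal.ofReal ((3 / 4) ^ t) +
      {x : ℝ | τ < |x|}.indicator 1 x := by
    intro x
    rcases le_or_gt |x| τ with hx | hx
    · refine (hR1 x hx).trans ?_
      rw [ENNReal.ofReal_add (integral_nonneg fun y => hT0 y x) (by positivity),
        ofReal_integral_eq_lintegral_ofReal (hTi x).integrableOn (ae_of_all _ fun y => hT0 y x)]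
      exact le_self_add
    · have := hRp x
      refine prob_le_one.trans ?_
      rw [Set.indicator_of_mem (show x ∈ {x : ℝ | τ < |x|} from hx)]
      exact le_add_self
  have hs : MeasurableSet {x : ℝ | τ < |x|} := measurableSet_lt measurable_const (by fun_prop)
  have hTe : Measurable fun p : ℝ × ℝ => ENNReal.ofReal (T p.1 p.2) := hTm.ennreal_ofReal
  have hk : Measurable fun x => ∫⁻ y in A, ENNReal.ofReal (T y x) :=
    (hTe.comp measurable_swap).lintegral_prod_right'
  have hmix : ∫⁻ x, (∫⁻ y in A, ENNReal.ofReal (T y x)) ∂(gaussianReal θ 1) ≤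
      gaussianReal (f (θ / τ)) 1 A + (ENNReal.ofReal (5 * Real.exp (-rateExp Cf N)) +
        28 * ENNReal.ofReal e) := by
    calc ∫⁻ x, (∫⁻ y in A, ENNReal.ofReal (T y x)) ∂(gaussianReal θ 1)
        = ∫⁻ x, ∫⁻ y in A, ENNReal.ofReal (T y x * sourceDensity x θ) := by
          rw [gaussianReal_of_var_ne_zero _ one_ne_zero,
            lintegral_withDensity_eq_lintegral_mul _ (measurable_gaussianPDF θ 1) hk]
          refine lintegral_congr fun x => ?_
          rw [Pi.mul_apply, mul_comm, gaussianPDF, ← lintegral_mul_const' _ _ ENNReal.ofReal_ne_top]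
          refine lintegral_congr fun y => ?_
          rw [ENNReal.ofReal_mul (hT0 y x)]
          rfl
      _ = ∫⁻ y in A, ∫⁻ x, ENNReal.ofReal (T y x * sourceDensity x θ) := by
          refine lintegral_lintegral_swap ?_
          refine Measurable.aemeasurable ?_
          exact ((hTm.comp measurable_swap).mul
            ((measurable_sourceDensity θ).comp measurable_fst)).ennreal_ofReal
      _ = ∫⁻ y in A, ENNReal.ofReal (∫ x, T y x * sourceDensity x θ) := by
          refine lintegral_congr fun y => ?_
          rw [ofReal_integral_eq_lintegral_ofReal (hTu y)
            (ae_of_all _ fun x => mul_nonneg (hT0 y x) (sourceDensity_nonneg x θ))]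
      _ ≤ ∫⁻ y in A, (gaussianPDF (f (θ / τ)) 1 y +
            ‖(∫ x, T y x * sourceDensity x θ) - targetDensity f τ y θ‖ₑ) := by
          refine lintegral_mono fun y => ?_
          rw [← ofReal_norm, gaussianPDF,
            ← ENNReal.ofReal_add (gaussianPDFReal_nonneg _ _ _) (norm_nonneg _)]
          refine ENNReal.ofReal_le_ofReal ?_
          have := le_abs_self ((∫ x, T y x * sourceDensity x θ) - targetDensity f τ y θ)
          rw [Real.norm_eq_abs]
          unfold targetDensity at this ⊢
          linarith
      _ ≤ _ := by
          rw [lintegral_add_left (measurable_gaussianPDF _ _), gaussianReal_apply _ one_ne_zero]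
          exact add_le_add le_rfl ((setLIntegral_le_lintegral _ _).trans hD)
  rw [Measure.bind_apply hA hRm.aemeasurable]
  refine (lintegral_mono hR2).trans ?_
  rw [lintegral_add_right _ (measurable_one.indicator hs), lintegral_add_right _ measurable_const,
    lintegral_indicator_one hs, lintegral_const, measure_univ, mul_one]
  refine (add_le_add (add_le_add hmix le_rfl) (gaussianReal_tail_le hτ θ)).trans ?_
  have h28 : (28 : ℝ≥0∞) * ENNReal.ofReal e = ENNReal.ofReal (28 * e) := by
    rw [ENNReal.ofReal_mul (by norm_num)]
    norm_num
  rw [h28, add_assoc, add_assoc, ← ENNReal.ofReal_add (by positivity) (by positivity),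
    ← ENNReal.ofReal_add (by positivity) (by positivity),
    ← ENNReal.ofReal_add (by positivity) (by positivity)]
  refine add_le_add le_rfl (ENNReal.ofReal_le_ofReal (le_of_eq ?_))
  ring

end LinkBound

lemma exists_evaluates_of_evalTime_ne_top {P : Primitives} {f : ℝ → ℝ} {S : ℝ → ℝ → ℝ}
    (h : evalTime P f S ≠ ⊤) :
    ∃ E : Program P 2, Evaluates f E S ∧ E.cost = (evalTime P f S).toNat := by
  have hne : Nonempty {E : Program P 2 // Evaluates f E S} := by
    by_contra hcon
    refine h (iInf₂_eq_top.2 fun E hE => (hcon ⟨⟨E, hE⟩⟩).elim)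
  have h1 : evalTime P f S = ⨅ E : {E : Program P 2 // Evaluates f E S}, (E.1.cost : ℕ∞) :=
    iInf_subtype'
  obtain ⟨E, hE⟩ := ENat.exists_eq_iInf fun E : {E : Program P 2 // Evaluates f E S} =>
    (E.1.cost : ℕ∞)
  refine ⟨E.1, E.2, ?_⟩
  rw [h1, ← hE, ENat.toNat_natCast]

lemma Program.cost_pos {P : Primitives} {n : ℕ} (p : Program P n) : 1 ≤ p.cost := by
  induction p with
  | halt i => exact le_rfl
  | step a p ih => exact ih.trans (Nat.le_add_left _ _)
  | branch i p q ihp ihq => exact Nat.le_add_right _ _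

/-- The condition of part (b) on `N`, in terms of the rate. -/
lemma barC_mul_exp_neg_rateExp_le {Cf N : ℕ} {ε : ℝ} (hε : 0 < ε) (hε1 : ε < 1)
    (h : (2 * Real.exp 1 * Real.log (4 * barC Cf / ε)) ^ (2 * (1 + Cf)) ≤ 2 * (N : ℝ) + 1) :
    barC Cf * Real.exp (-rateExp Cf N) ≤ ε / 4 := by
  have hb := four_lt_barC Cf
  have hx : 0 < 4 * barC Cf / ε := by positivity
  have hl : Real.log (4 * barC Cf / ε) ≤ rateExp Cf N := by
    rw [← rateExp_pow Cf N] at h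
    have hp := rateExp_pos Cf N
    have h1 := (pow_le_pow_iff_left₀ (mul_nonneg (by positivity) (Real.log_nonneg (by
      rw [le_div_iff₀ hε]; linarith))) (by positivity) (by omega)).1 h
    exact le_of_mul_le_mul_left h1 (by positivity)
  have h2 : 4 * barC Cf / ε ≤ Real.exp (rateExp Cf N) := (Real.log_le_iff_le_exp hx).1 hl
  rw [Real.exp_neg, ← div_eq_mul_inv, div_le_iff₀ (Real.exp_pos _)]
  rw [div_le_iff₀ hε] at h2
  linarith

lemma three_quarters_pow_le {ε : ℝ} (hε : 0 < ε) {t : ℕ} (ht : 4 * Real.log (4 / ε) ≤ t) :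
    (3 / 4 : ℝ) ^ t ≤ ε / 4 := by
  have h1 : (3 / 4 : ℝ) ≤ Real.exp (-(1 / 4)) := by
    have := Real.add_one_le_exp (-(1 / 4) : ℝ)
    linarith
  calc (3 / 4 : ℝ) ^ t ≤ Real.exp (-(1 / 4)) ^ t := by gcongr
    _ = Real.exp (-(t / 4)) := by rw [← Real.exp_nat_mul]; congr 1; ring
    _ ≤ Real.exp (-Real.log (4 / ε)) := Real.exp_le_exp.2 (by linarith)
    _ = ε / 4 := by rw [Real.exp_neg, Real.exp_log (by positivity), inv_div]

namespace LinkBound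

variable {c τ L : ℝ} {N Cf : ℕ} {f : ℝ → ℝ} {Θ : Set ℝ}

/-- The `L¹` bound, halved, with the constants absorbed: `5/2 ≤ barC Cf` and `14 ≤ 15`. -/
theorem deficiency_le (h : LinkBound f c N τ L) (hG : IsGaussianAnalytic f Cf c)
    (hN : barC Cf ≤ 2 * (N : ℝ) + 1) (hΘ : ∀ θ ∈ Θ, 10 ^ 4 * θ ^ 2 ≤ τ ^ 2) :
    deficiency Θ sourceDensity (targetDensity f τ) (markovKernel (targetDensity f τ) N) ≤
      ENNReal.ofReal (barC Cf *
        Real.exp (-((2 * (N : ℝ) + 1) ^ (1 / (2 * (1 + (Cf : ℝ)))) / (2 * Real.exp 1)))) +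
      ENNReal.ofReal (12 * Real.exp (-τ / 8)) +
      15 * ⨆ θ ∈ Θ, ENNReal.ofReal (Real.exp (θ ^ 2 / 2 - τ ^ 2 / 8)) := by
  refine iSup₂_le fun θ hθ => ?_
  refine (mul_le_mul_right (h.lintegral_deficiency_le hG hN (hΘ θ hθ)) _).trans ?_
  have h1 := le_iSup₂ (f := fun (θ : ℝ) (_ : θ ∈ Θ) =>
    ENNReal.ofReal (Real.exp (θ ^ 2 / 2 - τ ^ 2 / 8))) θ hθ
  rw [mul_add, add_right_comm]
  refine le_trans (add_le_add ?_ ?_) le_self_add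
  · rw [show (1 / 2 : ℝ≥0∞) = ENNReal.ofReal (1 / 2) by
      rw [ENNReal.ofReal_div_of_pos two_pos]; norm_num, ← ENNReal.ofReal_mul (by norm_num)]
    apply ENNReal.ofReal_le_ofReal
    change _ ≤ barC Cf * Real.exp (-rateExp Cf N)
    nlinarith [four_lt_barC Cf, Real.exp_pos (-rateExp Cf N)]
  · have h2 : (1 / 2 : ℝ≥0∞) * 28 ≤ 15 := by
      rw [one_div, mul_comm, ← div_eq_mul_inv]
      refine ENNReal.div_le_of_le_mul ?_
      norm_num
    rw [← mul_assoc]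
    exact mul_le_mul' h2 h1

/-- The error is at most `ε/4` for `⌈4 log(4/ε)⌉` rounds, `5ε/16` for the truncation, and `ε/4` for
the terms with `e^{θ²/2 - τ²/8} ≤ ε/120`. -/
theorem exists_program_tvDist_le (h : LinkBound f c N τ L) (hG : IsGaussianAnalytic f Cf c)
    (hN : barC Cf ≤ 2 * (N : ℝ) + 1) (hΘ : ∀ θ ∈ Θ, 10 ^ 4 * θ ^ 2 ≤ τ ^ 2) {ε : ℝ} (hε : 0 < ε)
    (hε1 : ε < 1)
    (hNε : (2 * Real.exp 1 * Real.log (4 * barC Cf / ε)) ^ (2 * (1 + Cf)) ≤ 2 * (N : ℝ) + 1)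
    (hτε : ENNReal.ofReal (8 * Real.log (120 / ε)) + 4 * supSq Θ ≤ ENNReal.ofReal (τ ^ 2))
    {P : Primitives} (hP : evalTime P f (signedKernel (targetDensity f τ) N) ≠ ⊤) :
    ∃ K : Program P 1,
      (K.cost : ℝ) ≤ 120 * Real.log (4 / ε) *
        ((evalTime P f (signedKernel (targetDensity f τ) N)).toNat : ℝ) ∧
      (⨆ θ ∈ Θ, tvDist (K.outputLaw f (gaussianReal θ 1)) (gaussianReal (f (θ / τ)) 1)) ≤
        ENNReal.ofReal ε := by
  obtain ⟨E, hE, hcost⟩ := exists_evaluates_of_evalTime_ne_top hP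
  have hfm : Measurable f := h.smooth.continuous.measurable
  have hlog : 1 ≤ Real.log (4 / ε) := by
    rw [Real.le_log_iff_exp_le (by positivity), le_div_iff₀ hε]
    nlinarith [Real.exp_one_lt_d9, Real.exp_pos 1]
  set t := ⌈4 * Real.log (4 / ε)⌉₊ with ht
  have ht1 : 4 * Real.log (4 / ε) ≤ t := Nat.le_ceil _
  have ht2 : (t : ℝ) ≤ 5 * Real.log (4 / ε) := by
    have := (Nat.ceil_lt_add_one (a := 4 * Real.log (4 / ε)) (by linarith)).le
    linarith
  refine ⟨rejection E τ t 0, ?_, ?_⟩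
  · rw [← hcost]
    have h1 : ((rejection E τ t (0 : Fin 1)).cost : ℝ) ≤ t * (E.cost + 18) + 1 := by
      exact_mod_cast cost_rejection_le E τ t (0 : Fin 1)
    have h2 : (1 : ℝ) ≤ E.cost := by exact_mod_cast E.cost_pos
    have h3 : (t : ℝ) * (E.cost + 18) ≤ 5 * Real.log (4 / ε) * (19 * E.cost) := by
      apply mul_le_mul ht2 (by linarith) (by positivity) (by linarith)
    nlinarith
  · refine iSup₂_le fun θ hθ => ?_
    have hK : ∀ x, (rejection E τ t (0 : Fin 1)).law f ![x] =
        rejectionLaw f τ (signedKernel (targetDensity f τ) N) t x := fun x =>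
      law_rejection hfm hE τ t 0 ![x]
    have hm : Measurable fun x => (rejection E τ t (0 : Fin 1)).law f ![x] :=
      ((rejection E τ t (0 : Fin 1)).measurable_law hfm).comp
        (measurable_pi_lambda _ fun i => by fin_cases i; exact measurable_id)
    refine (h.tvDist_rejectionLaw_le hG hN (hΘ θ hθ) t hm
      (fun x => (rejection E τ t (0 : Fin 1)).isProbabilityMeasure_law hfm _) hK).trans ?_
    apply ENNReal.ofReal_le_ofReal
    have h1 := three_quarters_pow_le hε ht1
    have h2 := barC_mul_exp_neg_rateExp_le hε hε1 hNε
    have h3 : Real.exp (θ ^ 2 / 2 - τ ^ 2 / 8) ≤ ε / 120 := by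
      have h4 : ENNReal.ofReal (8 * Real.log (120 / ε) + 4 * θ ^ 2) ≤
          ENNReal.ofReal (τ ^ 2) := by
        refine le_trans ?_ hτε
        have h5 := le_iSup₂ (f := fun (θ : ℝ) (_ : θ ∈ Θ) => ENNReal.ofReal (θ ^ 2)) θ hθ
        refine ENNReal.ofReal_add_le.trans (add_le_add le_rfl ?_)
        rw [ENNReal.ofReal_mul (by norm_num)]
        refine mul_le_mul' (by norm_num) h5
      rw [ENNReal.ofReal_le_ofReal_iff (by positivity)] at h4
      calc Real.exp (θ ^ 2 / 2 - τ ^ 2 / 8) ≤ Real.exp (-Real.log (120 / ε)) :=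
            Real.exp_le_exp.2 (by linarith)
        _ = ε / 120 := by rw [Real.exp_neg, Real.exp_log (by positivity), inv_div]
    have h6 : 4 * Real.exp (-rateExp Cf N) ≤ ε / 4 :=
      le_trans (mul_le_mul_of_nonneg_right (four_lt_barC Cf).le (Real.exp_pos _).le) h2
    linarith

end LinkBound

end GaussianReduction

end

theorem theorem2 :
    ∃ C C' : ℝ, 0 < C ∧ 0 < C' ∧
      ∀ (f : ℝ → ℝ) (Cf : ℕ) (Ct : ℝ), GaussianReduction.IsGaussianAnalytic f Cf Ct →
      ∀ (Θ : Set ℝ) (N : ℕ) (τ : ℝ), 0 < τ →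
        GaussianReduction.barC Cf ≤ 2 * (N : ℝ) + 1 →
        ENNReal.ofReal C *
            max (ENNReal.ofReal (max Ct 1) ^ 4 *
                (max (max (GaussianReduction.linkL f Ct (2 * N))
                  (GaussianReduction.linkLTilde f Ct (2 * N) τ)) 1) ^ 2 * (N : ℝ≥0∞) ^ 2)
              (GaussianReduction.supSq Θ) ≤ ENNReal.ofReal (τ ^ 2) →
        -- part (a)
        (GaussianReduction.deficiency Θ GaussianReduction.sourceDensity
            (GaussianReduction.targetDensity f τ)
            (GaussianReduction.markovKernel (GaussianReduction.targetDensity f τ) N) ≤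
          ENNReal.ofReal (GaussianReduction.barC Cf *
              Real.exp (-((2 * (N : ℝ) + 1) ^ (1 / (2 * (1 + (Cf : ℝ)))) / (2 * Real.exp 1)))) +
            ENNReal.ofReal (12 * Real.exp (-τ / 8)) +
            15 * ⨆ θ ∈ Θ, ENNReal.ofReal (Real.exp (θ ^ 2 / 2 - τ ^ 2 / 8))) ∧
        -- part (b)
        (∀ ε : ℝ, 0 < ε → ε < 1 →
          (2 * Real.exp 1 * Real.log (4 * GaussianReduction.barC Cf / ε)) ^ (2 * (1 + Cf)) ≤
            2 * (N : ℝ) + 1 →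
          max (ENNReal.ofReal (64 * Real.log (96 / ε) ^ 2))
              (ENNReal.ofReal (8 * Real.log (120 / ε)) + 4 * GaussianReduction.supSq Θ) ≤
            ENNReal.ofReal (τ ^ 2) →
          ∀ P : GaussianReduction.Primitives,
            GaussianReduction.evalTime P f (GaussianReduction.signedKernel
              (GaussianReduction.targetDensity f τ) N) ≠ ⊤ →
            ∃ K : GaussianReduction.Program P 1,
              (K.cost : ℝ) ≤ C' * Real.log (4 / ε) *
                ((GaussianReduction.evalTime P f (GaussianReduction.signedKernel
                  (GaussianReduction.targetDensity f τ) N)).toNat : ℝ) ∧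
              (⨆ θ ∈ Θ, GaussianReduction.tvDist
                (K.outputLaw f (gaussianReal θ 1)) (gaussianReal (f (θ / τ)) 1)) ≤
                ENNReal.ofReal ε) := by
  refine ⟨10 ^ 4, 120, by norm_num, by norm_num, ?_⟩
  intro f Cf Ct hG Θ N τ hτ hN hscale
  obtain ⟨L, h, hΘ⟩ := GaussianReduction.exists_linkBound hG hτ hN hscale
  exact ⟨h.deficiency_le hG hN hΘ, fun ε hε hε1 hNε hτε P hP =>
    h.exists_program_tvDist_le hG hN hΘ hε hε1 hNε ((le_max_right _ _).trans hτε) hP⟩
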